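/- **Setting.** Let $N\le M$, $\rho=N/M$, and let $U$ be a unitary $M\times M$ matrix ($M$-port). $N$ indistinguishable bosons enter the ports $1,\dots,N$, one per port. The output configuration $\mathbf m=(m_1,\dots,m_M)$, $\sum_l m_l=N$, belonging to the output ports $l_1\le\dots\le l_N$, has probability $\hat p_U(\mathbf m)=|\mathrm{per}\,U[1,\dots,N|l_1,\dots,l_N]|^2/(m_1!\cdots m_M!)$. **Sampler.** The chain-rule (Clifford–Clifford) sampler draws a uniformly random permutation $\pi$ of the $N$ bosons ($N^2$ operations) and then, for $K=1,\dots,N$, draws the port $l_K=j\in\{1,\dots,M\}$ with probability proportional to $$\Big|\sum_{\alpha=1}^{K}U_{\pi(\alpha),j}\,\mathrm{per}\,U[\pi(1),\dots,\widehat{\pi(\alpha)},\dots,\pi(K)\,|\,l_1,\dots,l_{K-1}]\Big|^2 .$$ The $K$ permanents are computed together, up to a common factor, by the modified Glynn formula: if the ports $l_1,\dots,l_{K-1}$ occupy $s$ distinct ports $1,\dots,s$ (after relabelling) with occupations $m_1,\dots,m_s\geq1$ and $m_s$ is the least of them, then the permanent with the row $\pi(\alpha)$ removed equals $\prod_{j=1}^{s}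 m_j!$ times $$\frac{1}{\prod_{j<s}(m_j+1)}\sum_{x_1,\dots,x_{s-1}}x_1\cdots x_{s-1}\prod_{\beta\ne\alpha,\ \beta\le K}\Big(U_{\pi(\beta),s}+\sum_{j<s}x_jU_{\pi(\beta),j}\Big),\qquad x_j\in\{e^{2\pi i t/(m_j+1)}:0\le t\le m_j\},$$ where the row sums are updated when one $x_j$ changes and, for each $x$, the $K$ products are obtained by one forward and one backward pass. Each arithmetic operation on complex numbers, each evaluation of a root of unity or of $|z|^2$ counts as one operation; a draw from $M$ weights counts as $2M$ operations and updating the $M$ occupation numbers as $M$. Let $\mathcal C$ be the total number of operations in a run on $U$ (a random variable, which depends on the sampled ports), $\mathbb E_U\,\mathcal C$ its mean over the runs on $U$, and $m=\max_l m_l$ the maximal bunching of the sampled output. **Theorem 2.** (1) For all $N\le M$ with $M\ge 1$ and every unitary $U$, the sampler outputs the configuration $\mathbf m$ with probability $\hat p_U(\mathbf m)$. (2) For $\varepsilon>0$ put $$\delta=\sqrt{\tfrac{4(1+\rho)}{N}\ln\tfrac2\varepsilon},\qquad r=\max\Big(1,\frac{1+\rho}{1+\delta}\Big),\qquad m_*=\frac{\ln\frac{N}{\rho\varepsilon}}{\ln\frac{1+\rho}{\rho}}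 .$$ There are absolute constants $c,C>0$, and for every $\varepsilon>0$ a constant $\kappa=\kappa(\varepsilon)>0$, such that for every $\eta>0$ there is $N_0=N_0(\varepsilon,\eta)$ with the following property. For all $M\ge N\ge N_0$ there is a measurable set of unitary $M$-ports of Haar probability at least $1-\varepsilon$ such that, for every $U$ in it: (a) with probability at least $1-\varepsilon$ over the run of the sampler, $$c\left(N2^{\frac{(1-\delta)N}{1+\rho}}+MN^2\right)\le\mathcal C\le C\left((m+2)N(1+r)^{N/r}+MN^2\right)\quad\text{and}\quad m\le(1+\eta)\,m_* ;$$ (b) $$c\left(N2^{\frac{(1-\delta)N}{1+\rho}}+MN^2\right)\le\mathbb E_U\,\mathcal C\le C\left((m_*+2)N(1+r)^{N/r}+MN^2\right);$$ (c) sampling $N$ bosons on $U$ is at least as hard as sampling $n=\lceil N/(1+N/M)\rceil$ bosons in the no-collision regime: $\mathbb E_U\,\mathcal C\ge\kappa\,\mathbb E_V\,\mathcal C$ for every unitary $M'$-port $V$ used with $n$ bosons, for all $M'\ge n$ with $M'n\le2^n$ (in particular for port numbers $M'\gg n^2$ of the no-collision regime, as long as the cost $M'n^2$ of scanning the ports does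 not exceed the leading term $n2^n$). -/

import Mathlib

open scoped ENNReal

noncomputable section

namespace BosonSampling

/-! ### Haar measure on the unitary group -/

instance instMeasurableSpaceU (M : ℕ) : MeasurableSpace (Matrix.unitaryGroup (Fin M) ℂ) :=
  borel _

instance instBorelSpaceU (M : ℕ) : BorelSpace (Matrix.unitaryGroup (Fin M) ℂ) := ⟨rfl⟩

theorem isCompact_unitaryGroup (M : ℕ) :
    IsCompact (Matrix.unitaryGroup (Fin M) ℂ : Set (Matrix (Fin M) (Fin M) ℂ)) := by
  have hK : IsCompact (Set.pi Set.univ fun _ : Fin M =>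
      Set.pi Set.univ fun _ : Fin M => Metric.closedBall (0 : ℂ) 1) :=
    isCompact_univ_pi fun _ => isCompact_univ_pi fun _ => isCompact_closedBall _ _
  refine IsCompact.of_isClosed_subset (s := Set.pi Set.univ fun _ : Fin M =>
      Set.pi Set.univ fun _ : Fin M => Metric.closedBall (0 : ℂ) 1) hK ?_ ?_
  · have h : (Matrix.unitaryGroup (Fin M) ℂ : Set (Matrix (Fin M) (Fin M) ℂ)) =
        (fun A : Matrix (Fin M) (Fin M) ℂ => A * star A) ⁻¹' {1} := by
      ext A
      simp [Matrix.mem_unitaryGroup_iff]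
    rw [h]
    exact isClosed_singleton.preimage (by fun_prop)
  · intro A hA i _ j _
    simpa using entry_norm_bound_of_unitary hA i j

instance instCompactSpaceU (M : ℕ) : CompactSpace (Matrix.unitaryGroup (Fin M) ℂ) :=
  isCompact_iff_compactSpace.mp (isCompact_unitaryGroup M)

/-- The Haar probability measure on the group of unitary `M`-ports. -/
def haarU (M : ℕ) : MeasureTheory.Measure (Matrix.unitaryGroup (Fin M) ℂ) :=
  MeasureTheory.Measure.haarMeasure ⊤

instance instHaarU (M : ℕ) : (haarU M).IsHaarMeasure := by
  unfold haarU; infer_instance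

instance instProbHaarU (M : ℕ) : MeasureTheory.IsProbabilityMeasure (haarU M) :=
  ⟨MeasureTheory.Measure.haarMeasure_self
    (K₀ := (⊤ : TopologicalSpace.PositiveCompacts (Matrix.unitaryGroup (Fin M) ℂ)))⟩

/-! ### The output distribution of `N` bosons on an `M`-port -/

/-- The `N × M` matrix formed by the rows `1, …, N` of `U`: the bosons enter the first `N` ports,
one boson per port. -/
def inputRows {N M : ℕ} (h : N ≤ M) (U : Matrix.unitaryGroup (Fin M) ℂ) :
    Matrix (Fin N) (Fin M) ℂ :=
  (U : Matrix (Fin M) (Fin M) ℂ).submatrix (Fin.castLE h) id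

/-- `occ l j` is the number of bosons in port `j` for the sequence of output ports `l`. -/
def occ {K M : ℕ} (l : Fin K → Fin M) (j : Fin M) : ℕ :=
  (Finset.univ.filter fun k => l k = j).card

/-- The largest number of bosons in one output port. -/
def maxBunch {K M : ℕ} (l : Fin K → Fin M) : ℕ :=
  Finset.univ.sup (occ l)

/-- The probability of the output configuration `m = occ l`:
`|per A[1,…,N | l_1,…,l_N]|² / (m_1! ⋯ m_M!)`. -/
def outputProb {N M : ℕ} (A : Matrix (Fin N) (Fin M) ℂ) (l : Fin N → Fin M) : ℝ :=
  ‖(A.submatrix id l).permanent‖ ^ 2 / (∏ j, ((occ l j).factorial : ℝ))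

/-! ### Computations with an operation count

A value of type `Counted α` is the result of a computation together with the number of operations
that the computation has used.  Sequential composition adds the counts. -/

/-- A result and the number of operations used for it. -/
@[ext]
structure Counted (α : Type) where
  /-- the result -/
  val : α
  /-- the number of operations -/
  ops : ℕ

instance : Monad Counted where
  pure a := ⟨a, 0⟩
  bind x f := ⟨(f x.val).val, x.ops + (f x.val).ops⟩

namespace Counted

/-- Use `n` operations without a result (bookkeeping). -/
def charge (n : ℕ) : Counted Unit := ⟨(), n⟩

/-- One addition. -/
def add (x y : ℂ) : Counted ℂ := ⟨x + y, 1⟩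

/-- One multiplication. -/
def mul (x y : ℂ) : Counted ℂ := ⟨x * y, 1⟩

/-- One division. -/
def div (x y : ℂ) : Counted ℂ := ⟨x / y, 1⟩

/-- One evaluation of `|z|²`. -/
def normSq (z : ℂ) : Counted ℝ := ⟨Complex.normSq z, 1⟩

/-- One evaluation of the root of unity `exp (2πi·i/(m+1))`. -/
def root (m i : ℕ) : Counted ℂ :=
  ⟨Complex.exp (2 * Real.pi * Complex.I * i / (m + 1)), 1⟩

/-- Summation of `n` numbers, `n` additions. -/
def sumOf {n : ℕ} (v : Fin n → ℂ) : Counted ℂ := ⟨∑ i, v i, n⟩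

/-- A loop: run `f 0, …, f (n-1)` and collect the results. -/
def tabulate {α : Type} {n : ℕ} (f : Fin n → Counted α) : Counted (Fin n → α) :=
  ⟨fun i => (f i).val, ∑ i, (f i).ops⟩

end Counted

open Counted

/-! ### The modified Glynn formula -/

/-- One forward and backward pass through a list `w_1, …, w_k`: the products
`p * ∏_{b ≠ a} w_b` for all `a`, and the product `∏_b w_b`. -/
def exclAux (p : ℂ) : List ℂ → Counted (List ℂ × ℂ)
  | [] => pure ([], 1)
  | w :: ws => do
    let p' ← mul p w
    let t ← exclAux p' ws
    let e ← mul p t.2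
    let q ← mul w t.2
    pure (e :: t.1, q)

/-- The products `y * ∏_{b ≠ a} w_b` for all `a`. -/
def exclProds {k : ℕ} (y : ℂ) (w : Fin k → ℂ) : Counted (Fin k → ℂ) := do
  let t ← exclAux y (List.ofFn w)
  pure fun a => t.1.getD a 0

/-- The sums over the auxiliary variables `x_j ∈ {exp (2πi·i/(m_j+1)) : 0 ≤ i ≤ m_j}`, one for
every port `j` of the list, in the modified Glynn formula.  `w` holds the row sums and `y` the
prefactor accumulated so far, so a change of one variable `x_j` costs a bounded number of
operations per row.  For all rows `a` at once the result is
`y * ∏_j 1/(m_j+1) * ∑_x (∏_j x_j) * ∏_{b ≠ a} (w_b + ∑_j x_j B_{b j})`. -/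
def glynnLoop {k M : ℕ} (m : Fin M → ℕ) (B : Fin k → Fin M → ℂ) :
    List (Fin M) → (Fin k → ℂ) → ℂ → Counted (Fin k → ℂ)
  | [], w, y => exclProds y w
  | j :: js, w, y => do
    let vs ← tabulate (n := m j + 1) fun i => do
      let x ← root (m j) i
      let yx ← mul y x
      let y' ← div yx (m j + 1)
      let w' ← tabulate fun b => do
        let t ← mul x (B b j)
        add (w b) t
      glynnLoop m B js w' y'
    tabulate fun a => sumOf fun i => vs i a

/-- The list of the occupied output ports. -/
def occupied {K M : ℕ} (l : Fin K → Fin M) : List (Fin M) :=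
  (List.finRange M).filter fun j => 0 < occ l j

/-- For all `a` at once, the permanent of the matrix with the columns `l_1, …, l_K` of `B` and all
rows of `B` except the row `a`, divided by `∏_j m_j!` (a factor that does not depend on `a` and
cancels when ports are drawn): the modified Glynn formula, in which the variable of an occupied
port `j₀` with the least occupation is set to `1` and not summed over. -/
def minors {K M : ℕ} (l : Fin K → Fin M) (B : Fin (K + 1) → Fin M → ℂ) :
    Counted (Fin (K + 1) → ℂ) :=
  match (occupied l).argmin (occ l) with
  | none => pure fun _ => 1
  | some j₀ => glynnLoop (occ l) B ((occupied l).erase j₀) (fun b => B b j₀) 1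

/-! ### The chain-rule sampler -/

/-- Given the ports `l_1, …, l_K` and the rows `B` of the first `K + 1` bosons, numbers
proportional to the probabilities of the next port: for every port `j` the Laplace expansion
`|∑_a B_{a j} per (B without row a, columns l_1, …, l_K)|²`.  The `M` initial operations update and
inspect the occupation numbers of the `M` ports. -/
def stepWeights {K M : ℕ} (l : Fin K → Fin M) (B : Fin (K + 1) → Fin M → ℂ) :
    Counted (Fin M → ℝ) := do
  charge M
  let q ← minors l B
  tabulate fun j => do
    let t ← tabulate fun a => mul (B a j) (q a)
    let s ← sumOf t
    normSq s

open Classical in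
/-- Draw a port with probability proportional to the weights `w` (port `0` if all weights
vanish). -/
def draw {M : ℕ} [NeZero M] (w : Fin M → ℝ) : PMF (Fin M) :=
  if h : (∑' j, ENNReal.ofReal (w j)) ≠ 0 then
    PMF.normalize (fun j => ENNReal.ofReal (w j)) h
      (by rw [tsum_fintype]; exact (ENNReal.sum_lt_top.2 fun _ _ => ENNReal.ofReal_lt_top).ne)
  else PMF.pure 0

/-- The first `K` rounds of the chain-rule sampler for a fixed order of the bosons (`row k` is the
row of the `k`-th boson): the joint law of the sequence of drawn ports and of the number of
operations.  A draw from `M` weights is charged `2M` operations (cumulative sums and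
comparisons). -/
def rounds {M : ℕ} [NeZero M] (row : ℕ → Fin M → ℂ) : (K : ℕ) → PMF ((Fin K → Fin M) × ℕ)
  | 0 => PMF.pure (Fin.elim0, 0)
  | K + 1 => (rounds row K).bind fun s =>
      (draw (stepWeights s.1 fun a => row a).val).map fun j =>
        (Fin.snoc (α := fun _ => Fin M) s.1 j,
          s.2 + (stepWeights s.1 fun a => row a).ops + 2 * M)

/-- The rows of `A` in the order `π`. -/
def permutedRows {N M : ℕ} (A : Matrix (Fin N) (Fin M) ℂ) (π : Equiv.Perm (Fin N)) (k : ℕ) :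
    Fin M → ℂ :=
  if h : k < N then A (π ⟨k, h⟩) else 0

/-- The sampler: draw a uniformly random order of the bosons (`N²` operations), then draw the `N`
output ports one after the other.  The result is the joint law of the sampled sequence of output
ports and of the total number of operations used in the run. -/
def sampler {N M : ℕ} [NeZero M] (A : Matrix (Fin N) (Fin M) ℂ) : PMF ((Fin N → Fin M) × ℕ) :=
  (PMF.uniformOfFintype (Equiv.Perm (Fin N))).bind fun π =>
    (rounds (permutedRows A π) N).map fun s => (s.1, s.2 + N ^ 2)

/-- The mean number of operations of a run of the sampler. -/
def meanOps {N M : ℕ} [NeZero M] (A : Matrix (Fin N) (Fin M) ℂ) : ℝ≥0∞ :=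
  ∑' s, sampler A s * (s.2 : ℝ≥0∞)

/-! ### The bounds -/

/-- The density of bosons. -/
def rho (N M : ℕ) : ℝ := N / M

/-- `δ = √((4(1+ρ)/N) ln(2/ε))`. -/
def delta (N M : ℕ) (ε : ℝ) : ℝ := √(4 * (1 + rho N M) / N * Real.log (2 / ε))

/-- `r = max(1, (1+ρ)/(1+δ))`. -/
def rPar (N M : ℕ) (ε : ℝ) : ℝ := max 1 ((1 + rho N M) / (1 + delta N M ε))

/-- `ln(N/(ρε)) / ln((1+ρ)/ρ)`, the scale that bounds the maximal bunching. -/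
def bunchScale (N M : ℕ) (ε : ℝ) : ℝ :=
  Real.log (N / (rho N M * ε)) / Real.log ((1 + rho N M) / rho N M)

/-- `N 2^{(1-δ)N/(1+ρ)} + M N²`. -/
def lowerBound (N M : ℕ) (ε : ℝ) : ℝ :=
  N * (2 : ℝ) ^ ((1 - delta N M ε) / (1 + rho N M) * N) + M * (N : ℝ) ^ 2

/-- `(m+2) N (1+r)^{N/r} + M N²`. -/
def upperBound (N M : ℕ) (ε m : ℝ) : ℝ :=
  (m + 2) * N * (1 + rPar N M ε) ^ (N / rPar N M ε) + M * (N : ℝ) ^ 2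

end BosonSampling

end

/-!
The proof has a pointwise, an averaged and a numerical part.

*The sampler.* The modified Glynn formula is a discrete Fourier inversion, so the weights of a
round are proportional to `|per|²` of the rows of the first bosons on the ports drawn so far.
Orthonormality of the rows makes the sum of `|per|²` over all sequences of `K` ports equal to `K!`
for every set of `K` rows; with the average over the order of the bosons the laws of the earlier
rounds add up to the normalization of the last one, and the law of the sequence is `seqProb A l =
|per A[·|l]|² / N!` (`sum_perm_portLaw`). A run on the ports `l` uses a number of operations
`runCost N l` that is a function of `l` alone, so both halves of the theorem are statements on the
law `seqProb`.

*The cost.* Round `K + 1` sums over `∏_j (m_j + 1)` values of the variables, the factor of one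
least occupied port being omitted. Hence the cost is at most a constant times `N ∑_K occProd + M
N²` (`runCost_le`), where `occProd = ∏_j (m_j + 1)` grows by at least the factor `(m + 1) / m` in
each round, so that the sum is at most `m` times its last term (`prefixSum_le_maxBunch_mul`), and
by concavity `occProd ≤ (1 + N / s) ^ s` for `s` occupied ports. It is at least a constant times
`N 2 ^ s + M N²` (`le_runCost_of_two_le`). So everything depends on the number of occupied ports
and on the maximal bunching.

*The Haar average.* The Haar average of `|∏_i ∑_j U_{ij} x_j|²` depends on the vector `x` only
through its norm; comparing coefficients in the squared moduli of the `x_j` shows that the Haar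
average of `|per|²` on the ports `l` is proportional to `∏_j m_j!`: the average of `seqProb` is
the law of a Pólya urn with one initial ball of each colour (`integral_sum_seqProb`). In the urn
the number of empty ports, suitably scaled, is a martingale with bounded increments, whence a
sub-Gaussian tail around `N / (1 + ρ)` occupied ports (`urnMean_emptyPorts_tail`); a port holds
`k` bosons with probability at most `(N / (M + N - 1)) ^ k` (`urnMean_le_occ`), and the union
bound over the ports gives the scale of the bunching. The deviation `δ` is chosen so that the
tails are of order `ε²`; Markov's inequality then turns the averaged bounds into bounds for all
multiports outside a set of Haar probability `ε` (`le_haarU_goodSet`).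

*The mean cost.* The mean of `occProd` in the urn is the product of `(2 M + i) / (M + i)` over `i
< N`, at most `2 (2 + ρ) ^ (N / (1 + ρ))`. For `r ≠ 1` this is smaller than the upper bound by a
factor `exp (√N / 8)`, up to a constant (`prod_mul_exp_le`), which leaves room for Markov's
inequality; for `r = 1` the upper bound is the trivial one, `2 ^ N`. For the comparison with the
no-collision regime the factor `2 ^ (-δ N / (1 + ρ))` must not be lost. By Jensen's inequality the
mean cost is at least `N 2 ^ (E - 5 / 2)` where `E` is the mean of `logOcc`, a lower bound for the
binary logarithm of `occProd` that is linear in the number of pairs of bosons sharing a port. The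
probability that two bosons share a port is bounded by the squared column weights of the input
rows (`le_sum_seqProb_logOcc`); for most multiports the squared deviations of the weights from
their mean add up to `O(1)` (`integral_colDeviation_le`), so that `E ≥ N / (1 + ρ) - O(1)`.
-/

noncomputable section

namespace BosonSampling

open MeasureTheory

/-! ### Occupation numbers -/

theorem sum_occ {K M : ℕ} (l : Fin K → Fin M) : ∑ j, occ l j = K := by
  have h := Finset.card_eq_sum_card_fiberwise (f := l) (s := Finset.univ) (t := Finset.univ)
    (fun _ _ => Finset.mem_coe.2 (Finset.mem_univ _))
  simpa [occ] using h.symm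

theorem occ_snoc {K M : ℕ} (l : Fin K → Fin M) (j j' : Fin M) :
    occ (Fin.snoc (α := fun _ => Fin M) l j) j' = occ l j' + if j' = j then 1 else 0 := by
  simp only [occ, Finset.card_filter, Fin.sum_univ_castSucc, Fin.snoc_castSucc, Fin.snoc_last]
  simp only [eq_comm]

theorem occ_comp_perm {K M : ℕ} (l : Fin K → Fin M) (σ : Equiv.Perm (Fin K)) :
    occ (l ∘ σ) = occ l := by
  ext j
  simp only [occ, Finset.card_filter, Function.comp]
  exact Equiv.sum_comp σ fun k => if l k = j then 1 else 0

theorem prod_comp_occ {K M : ℕ} {R : Type*} [CommMonoid R] (l : Fin K → Fin M) (f : Fin M → R) :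
    ∏ b, f (l b) = ∏ j, f j ^ occ l j := by
  rw [← Finset.prod_fiberwise Finset.univ l fun b => f (l b)]
  refine Finset.prod_congr rfl fun j _ => ?_
  rw [Finset.prod_congr rfl fun b hb => by rw [(Finset.mem_filter.1 hb).2]]
  simp [occ]

theorem exists_perm_of_occ_eq {K M : ℕ} {l l' : Fin K → Fin M} (h : occ l' = occ l) :
    ∃ σ : Equiv.Perm (Fin K), l ∘ σ = l' := by
  have e : ∀ c, Nonempty ({a // l' a = c} ≃ {b // l b = c}) := fun c => by
    refine Fintype.card_eq.1 ?_
    have := congrFun h c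
    simpa [occ, Fintype.card_subtype] using this
  refine ⟨Equiv.ofFiberEquiv fun c => (e c).some, ?_⟩
  exact funext fun a => Equiv.ofFiberEquiv_map _ a

theorem card_perm_comp_eq {K M : ℕ} {l l' : Fin K → Fin M} (h : occ l' = occ l) :
    (Finset.univ.filter fun σ : Equiv.Perm (Fin K) => l ∘ σ = l').card =
      ∏ j, (occ l j).factorial := by
  obtain ⟨τ, rfl⟩ := exists_perm_of_occ_eq h
  have hs := DomMulAct.stabilizer_card l
  simp only [Fintype.card_subtype] at hs
  rw [show (∏ j, (occ l j).factorial) = _ from hs.symm]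
  refine Finset.card_bij' (fun σ _ => σ * τ⁻¹) (fun σ _ => σ * τ) ?_ ?_ ?_ ?_
  · intro σ hσ
    simp only [Finset.mem_filter, Finset.mem_univ, true_and] at hσ ⊢
    ext a
    have := congrFun hσ (τ⁻¹ a)
    simpa using congrArg Fin.val this
  · intro σ hσ
    simp only [Finset.mem_filter, Finset.mem_univ, true_and] at hσ ⊢
    ext a
    have := congrFun hσ (τ a)
    simpa using congrArg Fin.val this
  · intro σ _; simp
  · intro σ _; simp

/-- Every sequence with the occupation numbers of `l` arises from `∏ j, (occ l j)!` permutations. -/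
theorem sum_comp_perm {K M : ℕ} {R : Type*} [CommSemiring R] (l : Fin K → Fin M)
    (F : (Fin K → Fin M) → R) :
    ∑ σ : Equiv.Perm (Fin K), F (l ∘ σ) =
      (∏ j, ((occ l j).factorial : R)) *
        ∑ l' ∈ Finset.univ.filter (fun l' : Fin K → Fin M => occ l' = occ l), F l' := by
  rw [← Finset.sum_fiberwise_of_maps_to (s := Finset.univ)
    (t := Finset.univ.filter (fun l' : Fin K → Fin M => occ l' = occ l))
    (g := fun σ : Equiv.Perm (Fin K) => l ∘ σ) (fun σ _ => by simp [occ_comp_perm]), Finset.mul_sum]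
  refine Finset.sum_congr rfl fun l' hl' => ?_
  rw [Finset.sum_congr rfl fun σ hσ => by rw [(Finset.mem_filter.1 hσ).2], Finset.sum_const,
    card_perm_comp_eq (Finset.mem_filter.1 hl').2, nsmul_eq_mul]
  push_cast
  rfl

theorem card_occ_eq {K M : ℕ} (l : Fin K → Fin M) :
    (∏ j, (occ l j).factorial) *
      (Finset.univ.filter (fun l' : Fin K → Fin M => occ l' = occ l)).card = K.factorial := by
  have := sum_comp_perm (R := ℕ) l fun _ => 1
  simpa [Fintype.card_perm] using this.symm

theorem sum_snoc {K M : ℕ} {R : Type*} [AddCommMonoid R] (F : (Fin (K + 1) → Fin M) → R) :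
    ∑ l, F l = ∑ l : Fin K → Fin M, ∑ j, F (Fin.snoc (α := fun _ => Fin M) l j) := by
  rw [← (Fin.snocEquiv fun _ : Fin (K + 1) => Fin M).sum_comp, Fintype.sum_prod_type,
    Finset.sum_comm]
  rfl

/-! ### Permanents of selected columns -/

/-- The permanent of the matrix formed by the columns `l_1, …, l_K` of `B`. -/
def colPer {K M : ℕ} (B : Fin K → Fin M → ℂ) (l : Fin K → Fin M) : ℂ :=
  ∑ σ : Equiv.Perm (Fin K), ∏ i, B (σ i) (l i)

theorem permanent_submatrix_eq {K M : ℕ} (A : Matrix (Fin K) (Fin M) ℂ) (l : Fin K → Fin M) :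
    (A.submatrix id l).permanent = colPer A l := rfl

theorem colPer_eq_sum_rows {K M : ℕ} (B : Fin K → Fin M → ℂ) (l : Fin K → Fin M) :
    colPer B l = ∑ σ : Equiv.Perm (Fin K), ∏ i, B i (l (σ i)) := by
  rw [colPer, ← Equiv.sum_comp (Equiv.inv (Equiv.Perm (Fin K)))]
  refine Finset.sum_congr rfl fun σ _ => ?_
  rw [← Equiv.prod_comp σ]
  simp

theorem colPer_comp_cols {K M : ℕ} (B : Fin K → Fin M → ℂ) (l : Fin K → Fin M)
    (τ : Equiv.Perm (Fin K)) : colPer B (l ∘ τ) = colPer B l := by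
  rw [colPer_eq_sum_rows, colPer_eq_sum_rows]
  exact Equiv.sum_comp (Equiv.mulLeft τ) fun σ => ∏ i, B i (l (σ i))

theorem colPer_comp_rows {K M : ℕ} (B : Fin K → Fin M → ℂ) (l : Fin K → Fin M)
    (τ : Equiv.Perm (Fin K)) : colPer (B ∘ τ) l = colPer B l :=
  Equiv.sum_comp (Equiv.mulLeft τ) fun σ => ∏ i, B (σ i) (l i)

theorem colPer_eq_of_occ_eq {K M : ℕ} (B : Fin K → Fin M → ℂ) {l l' : Fin K → Fin M}
    (h : occ l' = occ l) : colPer B l' = colPer B l := by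
  obtain ⟨σ, rfl⟩ := exists_perm_of_occ_eq h
  exact colPer_comp_cols B l σ

theorem colPer_eq_factorial_mul {K M : ℕ} (B : Fin K → Fin M → ℂ) (l : Fin K → Fin M) :
    colPer B l = (∏ j, ((occ l j).factorial : ℂ)) *
      ∑ g ∈ Finset.univ.filter (fun g : Fin K → Fin M => occ g = occ l), ∏ b, B b (g b) := by
  rw [colPer_eq_sum_rows]
  exact sum_comp_perm l fun g => ∏ b, B b (g b)

/-- A permutation of `K + 1` elements is the value `a` at the last place together with a
permutation of `K` elements. -/
def permLast (K : ℕ) : Fin (K + 1) × Equiv.Perm (Fin K) ≃ Equiv.Perm (Fin (K + 1)) :=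
  Equiv.ofBijective
    (fun p => ((finSuccEquiv' (Fin.last K)).trans (Equiv.optionCongr p.2)).trans
      (finSuccEquiv' p.1).symm) <| by
    rw [Fintype.bijective_iff_injective_and_card]
    constructor
    · rintro ⟨a, σ⟩ ⟨b, τ⟩ h
      have ha : a = b := by simpa using congrArg (fun e => e (Fin.last K)) h
      subst ha
      congr 1
      ext i
      have := congrArg (fun e => e (Fin.castSucc i)) h
      simp only [Equiv.trans_apply, finSuccEquiv'_last_apply_castSucc, Equiv.optionCongr_apply,
        Option.map_some, finSuccEquiv'_symm_some] at this
      exact congrArg Fin.val (Fin.succAbove_right_injective this)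
    · simp [Fintype.card_perm, Nat.factorial_succ]

theorem permLast_last {K : ℕ} (a : Fin (K + 1)) (σ : Equiv.Perm (Fin K)) :
    permLast K (a, σ) (Fin.last K) = a := by
  simp [permLast]

theorem permLast_castSucc {K : ℕ} (a : Fin (K + 1)) (σ : Equiv.Perm (Fin K)) (i : Fin K) :
    permLast K (a, σ) (Fin.castSucc i) = a.succAbove (σ i) := by
  simp [permLast, finSuccEquiv'_last_apply_castSucc]

/-- Laplace expansion of the permanent along the last column. -/
theorem colPer_snoc {K M : ℕ} (B : Fin (K + 1) → Fin M → ℂ) (l : Fin K → Fin M) (j : Fin M) :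
    colPer B (Fin.snoc (α := fun _ => Fin M) l j) =
      ∑ a, B a j * colPer (B ∘ a.succAbove) l := by
  rw [colPer, ← (permLast K).sum_comp, Fintype.sum_prod_type]
  refine Finset.sum_congr rfl fun a _ => ?_
  rw [colPer, Finset.mul_sum]
  refine Finset.sum_congr rfl fun σ _ => ?_
  rw [Fin.prod_univ_castSucc, mul_comm]
  simp [permLast_last, permLast_castSucc]

/-- The rows of `B` are orthonormal. -/
def OrthonormalRows {K M : ℕ} (B : Fin K → Fin M → ℂ) : Prop :=
  ∀ a b, ∑ j, B a j * star (B b j) = if a = b then 1 else 0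

theorem OrthonormalRows.comp {K L M : ℕ} {B : Fin K → Fin M → ℂ} (h : OrthonormalRows B)
    {e : Fin L → Fin K} (he : Function.Injective e) : OrthonormalRows (B ∘ e) := by
  intro a b
  simpa [he.eq_iff] using h (e a) (e b)

theorem OrthonormalRows.sum_norm_sq {K M : ℕ} {B : Fin K → Fin M → ℂ} (h : OrthonormalRows B)
    (c : Fin K → ℂ) : ∑ j, ‖∑ a, B a j * c a‖ ^ 2 = ∑ a, ‖c a‖ ^ 2 := by
  have key : ∀ z : ℂ, ((‖z‖ ^ 2 : ℝ) : ℂ) = z * star z := fun z => by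
    rw [Complex.star_def, Complex.mul_conj, Complex.normSq_eq_norm_sq]
  apply Complex.ofReal_injective
  push_cast
  simp only [← Complex.ofReal_pow, key]
  calc ∑ j, (∑ a, B a j * c a) * star (∑ a, B a j * c a)
      = ∑ j, ∑ a, ∑ b, (c a * star (c b)) * (B a j * star (B b j)) := by
        refine Finset.sum_congr rfl fun j _ => ?_
        rw [star_sum, Finset.sum_mul_sum]
        refine Finset.sum_congr rfl fun a _ => Finset.sum_congr rfl fun b _ => ?_
        rw [star_mul']; ring
    _ = ∑ a, ∑ b, (c a * star (c b)) * ∑ j, (B a j * star (B b j)) := by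
        rw [Finset.sum_comm]
        refine Finset.sum_congr rfl fun a _ => ?_
        rw [Finset.sum_comm]
        simp only [Finset.mul_sum]
    _ = _ := by
        have h' : ∀ a b, ∑ j, B a j * star (B b j) = if a = b then 1 else 0 := h
        simp only [h']
        simp

theorem OrthonormalRows.sum_colPer_snoc {K M : ℕ} {B : Fin (K + 1) → Fin M → ℂ}
    (h : OrthonormalRows B) (l : Fin K → Fin M) :
    ∑ j, ‖colPer B (Fin.snoc (α := fun _ => Fin M) l j)‖ ^ 2 =
      ∑ a : Fin (K + 1), ‖colPer (B ∘ a.succAbove) l‖ ^ 2 := by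
  simp only [colPer_snoc]
  exact h.sum_norm_sq _

theorem OrthonormalRows.sum_colPer {K M : ℕ} {B : Fin K → Fin M → ℂ}
    (h : OrthonormalRows B) : ∑ l, ‖colPer B l‖ ^ 2 = K.factorial := by
  induction K with
  | zero => simp [colPer]
  | succ K ih =>
    rw [sum_snoc]
    simp only [h.sum_colPer_snoc]
    rw [Finset.sum_comm]
    simp only [ih (h.comp Fin.succAbove_right_injective)]
    simp [Nat.factorial_succ]

theorem orthonormalRows_inputRows {N M : ℕ} (h : N ≤ M) (U : Matrix.unitaryGroup (Fin M) ℂ) :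
    OrthonormalRows (inputRows h U) := by
  intro a b
  have hU := (Matrix.mem_unitaryGroup_iff).1 U.2
  have := congrFun (congrFun hU (Fin.castLE h a)) (Fin.castLE h b)
  rw [Matrix.mul_apply] at this
  simpa [inputRows, Matrix.one_apply, Matrix.star_apply] using this

/-! ### The modified Glynn formula -/

theorem exclAux_val_snd (p : ℂ) (ws : List ℂ) : (exclAux p ws).val.2 = ws.prod := by
  induction ws generalizing p with
  | nil => rfl
  | cons w ws ih =>
    change w * (exclAux (p * w) ws).val.2 = _
    rw [ih, List.prod_cons]

theorem exclAux_val_fst_cons (p w : ℂ) (ws : List ℂ) :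
    (exclAux p (w :: ws)).val.1 = (p * ws.prod) :: (exclAux (p * w) ws).val.1 := by
  change (p * (exclAux (p * w) ws).val.2) :: (exclAux (p * w) ws).val.1 = _
  rw [exclAux_val_snd]

theorem exclProds_val {K : ℕ} (y : ℂ) (w : Fin (K + 1) → ℂ) (a : Fin (K + 1)) :
    (exclProds y w).val a = y * ∏ b, w (a.succAbove b) := by
  change (exclAux y (List.ofFn w)).val.1.getD a 0 = _
  induction K generalizing y with
  | zero =>
    rw [List.ofFn_succ, exclAux_val_fst_cons]
    obtain rfl : a = 0 := Fin.fin_one_eq_zero a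
    simp
  | succ K ih =>
    rw [List.ofFn_succ, exclAux_val_fst_cons]
    refine Fin.cases ?_ (fun a => ?_) a
    · simp only [Fin.val_zero, List.getD_cons_zero, List.prod_ofFn, Fin.zero_succAbove]
    · have := ih (y * w 0) (fun i => w i.succ) a
      simp only [Fin.val_succ, List.getD_cons_succ]
      rw [this, Fin.prod_univ_succ]
      simp [mul_assoc]

theorem exclAux_ops (p : ℂ) (ws : List ℂ) : (exclAux p ws).ops = 3 * ws.length := by
  induction ws generalizing p with
  | nil => rfl
  | cons w ws ih =>
    change 1 + ((exclAux (p * w) ws).ops + (1 + (1 + 0))) = _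
    rw [ih, List.length_cons]
    ring

theorem exclProds_ops {k : ℕ} (y : ℂ) (w : Fin k → ℂ) : (exclProds y w).ops = 3 * k := by
  change (exclAux y (List.ofFn w)).ops + 0 = _
  rw [exclAux_ops, List.length_ofFn, add_zero]

theorem glynnLoop_cons_val {k M : ℕ} (m : Fin M → ℕ) (B : Fin k → Fin M → ℂ) (j : Fin M)
    (js : List (Fin M)) (w : Fin k → ℂ) (y : ℂ) (a : Fin k) :
    (glynnLoop m B (j :: js) w y).val a = ∑ i : Fin (m j + 1),
      (glynnLoop m B js (fun b => w b + (Counted.root (m j) i).val * B b j)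
        (y * (Counted.root (m j) i).val / (m j + 1))).val a := rfl

theorem sum_root_pow (m n : ℕ) :
    ∑ i : Fin (m + 1), (Counted.root m i).val ^ n = if m + 1 ∣ n then (m + 1 : ℂ) else 0 := by
  have hprim := Complex.isPrimitiveRoot_exp (m + 1) (Nat.succ_ne_zero m)
  set ζ := Complex.exp (2 * Real.pi * Complex.I / ((m + 1 : ℕ) : ℂ)) with hζ
  have hroot : ∀ i : Fin (m + 1), (Counted.root m i).val ^ n = (ζ ^ n) ^ (i : ℕ) := fun i => by
    have : (Counted.root m i).val = ζ ^ (i : ℕ) := by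
      change Complex.exp (2 * Real.pi * Complex.I * (i : ℕ) / (m + 1)) = _
      rw [hζ, ← Complex.exp_nat_mul]
      congr 1
      push_cast
      ring
    rw [this, ← pow_mul, ← pow_mul, mul_comm]
  simp only [hroot]
  rw [Fin.sum_univ_eq_sum_range (fun i => (ζ ^ n) ^ i)]
  split_ifs with h
  · rw [(hprim.pow_eq_one_iff_dvd n).2 h]
    simp
  · have h1 : ζ ^ n ≠ 1 := fun h' => h ((hprim.pow_eq_one_iff_dvd n).1 h')
    rw [geom_sum_eq h1, ← pow_mul, mul_comm, pow_mul, hprim.pow_eq_one]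
    simp

/-- The value of the loop over the auxiliary variables of the ports `js`, when the row sums carry
the fixed values `z` of the variables of the other ports.  After expanding the products into a sum
over all assignments `g` of ports to rows, averaging over the roots of unity keeps those `g` that
assign to every port `j` of `js` a number of rows congruent to `-1` modulo `m j + 1`. -/
theorem glynnLoop_val {K M : ℕ} (m : Fin M → ℕ) (B : Fin (K + 1) → Fin M → ℂ)
    (a : Fin (K + 1)) (js : List (Fin M)) (hjs : js.Nodup) (z : Fin M → ℂ) (y : ℂ) :
    (glynnLoop m B js (fun b => ∑ j ∈ Finset.univ.filter (· ∉ js), z j * B b j) y).val a =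
      y * ∑ g : Fin K → Fin M, (∏ b, B (a.succAbove b) (g b)) *
        ∏ j, (if j ∈ js then (if m j + 1 ∣ occ g j + 1 then 1 else 0) else z j ^ occ g j) := by
  induction js generalizing z y with
  | nil =>
    change (exclProds y _).val a = _
    rw [exclProds_val]
    congr 1
    simp only [List.not_mem_nil, not_false_eq_true, Finset.filter_true, if_false]
    rw [Finset.prod_univ_sum, Fintype.piFinset_univ]
    refine Finset.sum_congr rfl fun g _ => ?_
    rw [Finset.prod_mul_distrib, prod_comp_occ g z, mul_comm]
  | cons j js ih =>
    have hj : j ∉ js := (List.nodup_cons.1 hjs).1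
    have step : ∀ x : ℂ, (fun b => (∑ j' ∈ Finset.univ.filter (· ∉ j :: js), z j' * B b j') +
        x * B b j) = fun b => ∑ j' ∈ Finset.univ.filter (· ∉ js),
          Function.update z j x j' * B b j' := by
      intro x
      ext b
      have hmem : j ∈ Finset.univ.filter (· ∉ js) := by simp [hj]
      rw [← Finset.sum_erase_add _ _ hmem, Function.update_self]
      congr 1
      refine Finset.sum_congr ?_ fun j' hj' => ?_
      · ext j'
        simp [List.mem_cons, not_or]
      · have : j' ≠ j := by
          exact (Finset.mem_erase.1 hj').1
        rw [Function.update_of_ne this]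
    rw [glynnLoop_cons_val]
    simp_rw [step, ih (List.nodup_cons.1 hjs).2]
    rw [Finset.mul_sum]
    simp only [Finset.mul_sum]
    rw [Finset.sum_comm]
    refine Finset.sum_congr rfl fun g _ => ?_
    have split : ∀ x : ℂ, (∏ j', (if j' ∈ js then (if m j' + 1 ∣ occ g j' + 1 then (1 : ℂ) else 0)
        else Function.update z j x j' ^ occ g j')) =
        x ^ occ g j * ∏ j' ∈ Finset.univ.erase j, (if j' ∈ j :: js then
          (if m j' + 1 ∣ occ g j' + 1 then (1 : ℂ) else 0) else z j' ^ occ g j') := by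
      intro x
      rw [← Finset.mul_prod_erase _ _ (Finset.mem_univ j), if_neg hj, Function.update_self]
      congr 1
      refine Finset.prod_congr rfl fun j' hj' => ?_
      have hne : j' ≠ j := (Finset.mem_erase.1 hj').1
      simp [hne]
    simp only [split]
    rw [← Finset.mul_prod_erase _ _ (Finset.mem_univ j), if_pos List.mem_cons_self]
    set P := ∏ j' ∈ Finset.univ.erase j, (if j' ∈ j :: js then
          (if m j' + 1 ∣ occ g j' + 1 then (1 : ℂ) else 0) else z j' ^ occ g j')
    have hm : (m j + 1 : ℂ) ≠ 0 := by exact_mod_cast Nat.succ_ne_zero (m j)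
    calc ∑ i : Fin (m j + 1), y * (Counted.root (m j) i).val / (m j + 1) *
          ((∏ b, B (a.succAbove b) (g b)) * ((Counted.root (m j) i).val ^ occ g j * P))
        = (y * (∏ b, B (a.succAbove b) (g b)) * P / (m j + 1)) *
          ∑ i : Fin (m j + 1), (Counted.root (m j) i).val ^ (occ g j + 1) := by
          rw [Finset.mul_sum]
          refine Finset.sum_congr rfl fun i _ => ?_
          ring
      _ = _ := by
          rw [sum_root_pow]
          split_ifs
          · rw [div_mul_cancel₀ _ hm]
            ring
          · ring

theorem mem_occupied {K M : ℕ} {l : Fin K → Fin M} {j : Fin M} :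
    j ∈ occupied l ↔ 0 < occ l j := by
  simp [occupied]

theorem nodup_occupied {K M : ℕ} (l : Fin K → Fin M) : (occupied l).Nodup :=
  (List.nodup_finRange M).filter _

/-- The divisibility conditions of the modified Glynn formula single out the assignments with the
same occupations as `l`: a port with another admissible occupation would hold at least
`2 * occ l j + 1` bosons, which exceeds `occ l j + occ l j₀` because `occ l j₀` is the least
occupation. -/
theorem occ_eq_of_dvd {K M : ℕ} {l g : Fin K → Fin M} {j₀ : Fin M}
    (hmin : ∀ j, 0 < occ l j → occ l j₀ ≤ occ l j)
    (hdvd : ∀ j, 0 < occ l j → j ≠ j₀ → occ l j + 1 ∣ occ g j + 1)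
    (hzero : ∀ j, occ l j = 0 → j ≠ j₀ → occ g j = 0) : occ g = occ l := by
  have hsum : ∑ j, occ g j = ∑ j, occ l j := by rw [sum_occ, sum_occ]
  have hle : ∀ j, j ≠ j₀ → occ l j ≤ occ g j := fun j hj => by
    rcases Nat.eq_zero_or_pos (occ l j) with h | h
    · omega
    · have := Nat.le_of_dvd (Nat.succ_pos _) (hdvd j h hj)
      omega
  rw [← Finset.add_sum_erase _ _ (Finset.mem_univ j₀),
    ← Finset.add_sum_erase _ (occ l) (Finset.mem_univ j₀)] at hsum
  have heq : ∀ j, j ≠ j₀ → occ g j = occ l j := by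
    intro j hj
    rcases Nat.eq_zero_or_pos (occ l j) with h | h
    · rw [hzero j h hj, h]
    · by_contra hne
      obtain ⟨c, hc⟩ := hdvd j h hj
      have hc2 : 2 ≤ c := by
        rcases c with _ | _ | c
        · omega
        · omega
        · omega
      have hbig : 2 * occ l j + 1 ≤ occ g j := by nlinarith
      have hmem : j ∈ Finset.univ.erase j₀ := Finset.mem_erase.2 ⟨hj, Finset.mem_univ _⟩
      have h1 : ∑ j' ∈ (Finset.univ.erase j₀).erase j, occ l j' ≤
          ∑ j' ∈ (Finset.univ.erase j₀).erase j, occ g j' :=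
        Finset.sum_le_sum fun j' hj' =>
          hle j' (Finset.mem_erase.1 (Finset.mem_erase.1 hj').2).1
      rw [← Finset.add_sum_erase _ _ hmem, ← Finset.add_sum_erase _ (occ l) hmem] at hsum
      have := hmin j h
      omega
  have h0 : ∑ j ∈ Finset.univ.erase j₀, occ g j = ∑ j ∈ Finset.univ.erase j₀, occ l j :=
    Finset.sum_congr rfl fun j hj => heq j (Finset.mem_erase.1 hj).1
  ext j
  by_cases hj : j = j₀
  · subst hj; omega
  · exact heq j hj

theorem argmin_occupied_eq_none {K M : ℕ} {l : Fin K → Fin M}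
    (h : (occupied l).argmin (occ l) = none) : K = 0 := by
  rw [List.argmin_eq_none] at h
  rw [← sum_occ l]
  refine Finset.sum_eq_zero fun j _ => ?_
  have : j ∉ occupied l := by simp [h]
  rw [mem_occupied] at this
  omega

/-- The modified Glynn formula: by `glynnLoop_val` and `occ_eq_of_dvd`, only the assignments
of ports to rows with the occupation numbers of `l` contribute. -/
theorem factorial_mul_minors_val {K M : ℕ} (l : Fin K → Fin M) (B : Fin (K + 1) → Fin M → ℂ)
    (a : Fin (K + 1)) :
    (∏ j, ((occ l j).factorial : ℂ)) * (minors l B).val a = colPer (B ∘ a.succAbove) l := by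
  rw [minors]
  split
  · rename_i h
    have hK := argmin_occupied_eq_none h
    subst hK
    change _ * (1 : ℂ) = _
    simp [colPer, occ]
  · rename_i j₀ h
    have hj₀ : j₀ ∈ occupied l := List.argmin_mem h
    have hmin : ∀ j, 0 < occ l j → occ l j₀ ≤ occ l j := fun j hj =>
      List.le_of_mem_argmin (mem_occupied.2 hj) h
    have hnd := nodup_occupied l
    have hmem : ∀ j, j ∈ (occupied l).erase j₀ ↔ j ≠ j₀ ∧ 0 < occ l j := fun j => by
      rw [hnd.mem_erase_iff, mem_occupied]
    have hw : (fun b => B b j₀) = fun b => ∑ j ∈ Finset.univ.filter (· ∉ (occupied l).erase j₀),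
        (Pi.single j₀ 1 : Fin M → ℂ) j * B b j := by
      ext b
      rw [Finset.sum_eq_single j₀]
      · simp
      · intro j _ hj
        simp [hj]
      · intro hj
        simp [hmem] at hj
    rw [hw, glynnLoop_val _ _ _ _ (hnd.erase _), one_mul, colPer_eq_factorial_mul]
    congr 1
    rw [Finset.sum_filter]
    refine Finset.sum_congr rfl fun g _ => ?_
    split_ifs with hg
    · refine (congrArg _ (Finset.prod_eq_one ?_)).trans (mul_one _)
      · intro j _
        rw [hg]
        by_cases hj : j = j₀
        · subst hj
          simp [hmem]
        · by_cases hp : 0 < occ l j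
          · simp [hmem, hj, hp]
          · have : occ l j = 0 := by omega
            simp [hmem, this]
    · refine mul_eq_zero_of_right _ ?_
      by_contra hne
      refine hg (occ_eq_of_dvd hmin (fun j hp hj => ?_) fun j hz hj => ?_)
      · have := (Finset.prod_ne_zero_iff.1 hne) j (Finset.mem_univ j)
        by_contra hd
        simp [hmem, hj, hp, hd] at this
      · have := (Finset.prod_ne_zero_iff.1 hne) j (Finset.mem_univ j)
        by_contra hd
        simp [hmem, hz, hj, hd] at this

theorem stepWeights_val {K M : ℕ} (l : Fin K → Fin M) (B : Fin (K + 1) → Fin M → ℂ) (j : Fin M) :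
    (stepWeights l B).val j =
      ‖colPer B (Fin.snoc (α := fun _ => Fin M) l j)‖ ^ 2 /
        (∏ j, ((occ l j).factorial : ℝ)) ^ 2 := by
  change Complex.normSq (∑ a, B a j * (minors l B).val a) = _
  have hne : (∏ j, ((occ l j).factorial : ℂ)) ≠ 0 :=
    Finset.prod_ne_zero_iff.2 fun j _ => by exact_mod_cast (Nat.factorial_ne_zero _)
  have h : ∑ a, B a j * (minors l B).val a =
      colPer B (Fin.snoc (α := fun _ => Fin M) l j) / ∏ j, ((occ l j).factorial : ℂ) := by
    rw [eq_div_iff hne, colPer_snoc, Finset.sum_mul]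
    refine Finset.sum_congr rfl fun a _ => ?_
    rw [← factorial_mul_minors_val]
    ring
  rw [h, Complex.normSq_eq_norm_sq, norm_div, div_pow, norm_prod]
  simp

/-! ### The operation count as a function of the sampled ports -/

/-- The number of operations of `glynnLoop` on `k` rows, for the ports `js` with occupations `m`. -/
def glynnCost {M : ℕ} (k : ℕ) (m : Fin M → ℕ) : List (Fin M) → ℕ
  | [] => 3 * k
  | j :: js => (m j + 1) * (3 + 3 * k + glynnCost k m js)

theorem glynnLoop_ops {k M : ℕ} (m : Fin M → ℕ) (B : Fin k → Fin M → ℂ) (js : List (Fin M))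
    (w : Fin k → ℂ) (y : ℂ) : (glynnLoop m B js w y).ops = glynnCost k m js := by
  induction js generalizing w y with
  | nil => exact exclProds_ops y w
  | cons j js ih =>
    change ∑ i : Fin (m j + 1), (1 + (1 + (1 + ((∑ _b : Fin k, (1 + 1)) +
      (glynnLoop m B js (fun b => w b + (Counted.root (m j) i).val * B b j)
        (y * (Counted.root (m j) i).val / (m j + 1))).ops)))) + ∑ _a : Fin k, (m j + 1) = _
    simp only [ih, Finset.sum_const, Finset.card_univ, Fintype.card_fin, smul_eq_mul, glynnCost]
    ring

/-- The number of operations used for the permanents in one round of the sampler. -/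
def minorsCost {K M : ℕ} (l : Fin K → Fin M) : ℕ :=
  match (occupied l).argmin (occ l) with
  | none => 0
  | some j₀ => glynnCost (K + 1) (occ l) ((occupied l).erase j₀)

theorem minors_ops {K M : ℕ} (l : Fin K → Fin M) (B : Fin (K + 1) → Fin M → ℂ) :
    (minors l B).ops = minorsCost l := by
  rw [minors, minorsCost]
  generalize (occupied l).argmin (occ l) = o
  cases o with
  | none => rfl
  | some j₀ => exact glynnLoop_ops _ _ _ _ _

theorem stepWeights_ops {K M : ℕ} (l : Fin K → Fin M) (B : Fin (K + 1) → Fin M → ℂ) :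
    (stepWeights l B).ops = minorsCost l + M * (2 * K + 4) := by
  change M + ((minors l B).ops + ∑ _j : Fin M, ((∑ _a : Fin (K + 1), 1) + ((K + 1) + 1))) = _
  rw [minors_ops]
  simp only [Finset.sum_const, Finset.card_univ, Fintype.card_fin, smul_eq_mul]
  ring

/-- The number of operations used in the rounds that draw the sequence `l` of ports: it depends
only on the ports, not on the entries of the matrix. -/
def runCost {M : ℕ} : (K : ℕ) → (Fin K → Fin M) → ℕ
  | 0, _ => 0
  | K + 1, l => runCost K (Fin.init l) + minorsCost (Fin.init l) + M * (2 * K + 6)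

/-- The law of the first `K` ports drawn, for a fixed order of the bosons. -/
def portLaw {M : ℕ} [NeZero M] (row : ℕ → Fin M → ℂ) : (K : ℕ) → PMF (Fin K → Fin M)
  | 0 => PMF.pure Fin.elim0
  | K + 1 => (portLaw row K).bind fun l =>
      (draw (stepWeights l fun a => row a).val).map fun j => Fin.snoc (α := fun _ => Fin M) l j

theorem rounds_eq_map {M : ℕ} [NeZero M] (row : ℕ → Fin M → ℂ) (K : ℕ) :
    rounds row K = (portLaw row K).map fun l => (l, runCost K l) := by
  induction K with
  | zero => rw [rounds, portLaw, PMF.pure_map]; rfl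
  | succ K ih =>
    rw [rounds, portLaw, ih, PMF.bind_map, PMF.map_bind]
    congr 1
    funext l
    rw [Function.comp_apply, PMF.map_comp]
    congr 1
    funext j
    simp only [Function.comp_apply, runCost, Fin.init_snoc, stepWeights_ops]
    congr 1
    ring

/-- The law of the sequence of output ports. -/
def sampleLaw {N M : ℕ} [NeZero M] (A : Matrix (Fin N) (Fin M) ℂ) : PMF (Fin N → Fin M) :=
  (PMF.uniformOfFintype (Equiv.Perm (Fin N))).bind fun π => portLaw (permutedRows A π) N

theorem sampler_eq_map {N M : ℕ} [NeZero M] (A : Matrix (Fin N) (Fin M) ℂ) :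
    sampler A = (sampleLaw A).map fun l => (l, runCost N l + N ^ 2) := by
  rw [sampler, sampleLaw, PMF.map_bind]
  congr 1
  funext π
  rw [rounds_eq_map, PMF.map_comp]
  rfl

/-! ### The law of the sampled ports -/

theorem ofReal_mul_draw {M : ℕ} [NeZero M] (w : Fin M → ℝ) (hw : ∀ j, 0 ≤ w j) (j : Fin M) :
    ENNReal.ofReal (∑ j, w j) * draw w j = ENNReal.ofReal (w j) := by
  have hsum : (∑' j, ENNReal.ofReal (w j)) = ENNReal.ofReal (∑ j, w j) := by
    rw [tsum_fintype, ENNReal.ofReal_sum_of_nonneg fun j _ => hw j]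
  by_cases h : (∑' j, ENNReal.ofReal (w j)) = 0
  · have hj : ENNReal.ofReal (w j) = 0 := ENNReal.tsum_eq_zero.1 h j
    rw [← hsum, h, hj, zero_mul]
  · rw [draw, dif_pos h, PMF.normalize_apply, ← hsum, mul_left_comm, ENNReal.mul_inv_cancel h,
      mul_one]
    rw [hsum]
    exact ENNReal.ofReal_ne_top

theorem draw_mul_left {M : ℕ} [NeZero M] {c : ℝ} (hc : 0 < c) (w : Fin M → ℝ)
    (hw : ∀ j, 0 ≤ w j) (j : Fin M) :
    ENNReal.ofReal (∑ j, w j) * draw (fun j => w j / c) j = ENNReal.ofReal (w j) := by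
  have h := ofReal_mul_draw (fun j => w j / c) (fun j => div_nonneg (hw j) hc.le) j
  rw [← Finset.sum_div] at h
  have e : ∀ x : ℝ, 0 ≤ x → ENNReal.ofReal x = ENNReal.ofReal c * ENNReal.ofReal (x / c) :=
    fun x hx => by rw [← ENNReal.ofReal_mul hc.le, mul_div_cancel₀ _ hc.ne']
  rw [e _ (Finset.sum_nonneg fun j _ => hw j), mul_assoc, h, ← e _ (hw j)]

theorem permutedRows_of_lt {N M : ℕ} (A : Fin N → Fin M → ℂ) (π : Equiv.Perm (Fin N)) {k : ℕ}
    (h : k < N) : permutedRows A π k = A (π ⟨k, h⟩) := dif_pos h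

theorem portLaw_congr {M : ℕ} [NeZero M] {row row' : ℕ → Fin M → ℂ} {K : ℕ}
    (h : ∀ k < K, row k = row' k) : portLaw row K = portLaw row' K := by
  induction K with
  | zero => rfl
  | succ K ih =>
    rw [portLaw, portLaw, ih fun k hk => h k (hk.trans (Nat.lt_succ_self K))]
    congr 1
    funext l
    rw [show (fun a : Fin (K + 1) => row a) = fun a : Fin (K + 1) => row' a from
      funext fun a => h a a.2]

theorem portLaw_snoc {M : ℕ} [NeZero M] (row : ℕ → Fin M → ℂ) {K : ℕ} (l : Fin K → Fin M)
    (j : Fin M) : portLaw row (K + 1) (Fin.snoc (α := fun _ => Fin M) l j) =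
      portLaw row K l * draw (stepWeights l fun a => row a).val j := by
  rw [portLaw, PMF.bind_apply, tsum_eq_single l]
  · congr 1
    rw [PMF.map_apply, tsum_eq_single j]
    · simp
    · intro j' hj'
      rw [if_neg]
      intro h
      have := congrFun h (Fin.last K)
      simp only [Fin.snoc_last] at this
      exact hj' this.symm
  · intro l' hl'
    refine mul_eq_zero_of_right _ ?_
    rw [PMF.map_apply]
    refine ENNReal.tsum_eq_zero.2 fun j' => if_neg fun h => hl' ?_
    have := congrArg Fin.init h
    simpa using this.symm

/-- The average over the order of the bosons of the conditional laws of the chain rule.  For a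
fixed order the law of the ports is not proportional to a squared permanent, but the weights in the
last round do not depend on the order, and the sum of the laws of the previous rounds is the sum of
the squared minors, which is the normalization in the last round. -/
theorem sum_perm_portLaw {M : ℕ} [NeZero M] {K : ℕ} (A : Fin K → Fin M → ℂ)
    (hA : OrthonormalRows A) (l : Fin K → Fin M) :
    ∑ π : Equiv.Perm (Fin K), portLaw (permutedRows A π) K l =
      ENNReal.ofReal (‖colPer A l‖ ^ 2) := by
  induction K with
  | zero =>
    simp only [portLaw, colPer]
    have : l = Fin.elim0 := Subsingleton.elim _ _
    simp [this]
  | succ K ih =>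
    obtain ⟨l, j, rfl⟩ : ∃ (l' : Fin K → Fin M) (j : Fin M),
        l = Fin.snoc (α := fun _ => Fin M) l' j := ⟨Fin.init l, l (Fin.last K), by simp⟩
    have hrow : ∀ π : Equiv.Perm (Fin (K + 1)),
        (fun a : Fin (K + 1) => permutedRows A π a) = A ∘ π := fun π => by
      funext a
      exact permutedRows_of_lt A π a.2
    have hdraw : ∀ π : Equiv.Perm (Fin (K + 1)),
        (stepWeights l fun a : Fin (K + 1) => permutedRows A π a).val =
        fun j => ‖colPer A (Fin.snoc (α := fun _ => Fin M) l j)‖ ^ 2 /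
          (∏ j, ((occ l j).factorial : ℝ)) ^ 2 := fun π => by
      funext j
      rw [hrow, stepWeights_val, colPer_comp_rows]
    simp only [portLaw_snoc, hdraw]
    rw [← Finset.sum_mul, ← (permLast K).sum_comp, Fintype.sum_prod_type]
    have hprev : ∀ a : Fin (K + 1), ∑ σ : Equiv.Perm (Fin K),
        portLaw (permutedRows A (permLast K (a, σ))) K l =
        ENNReal.ofReal (‖colPer (A ∘ a.succAbove) l‖ ^ 2) := fun a => by
      rw [← ih _ (hA.comp Fin.succAbove_right_injective)]
      refine Finset.sum_congr rfl fun σ _ => ?_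
      rw [portLaw_congr (row' := permutedRows (A ∘ a.succAbove) σ)]
      intro k hk
      rw [permutedRows_of_lt A _ (hk.trans (Nat.lt_succ_self K)),
        permutedRows_of_lt (A ∘ a.succAbove) _ hk, Function.comp_apply, ← permLast_castSucc]
      rfl
    simp only [hprev]
    rw [← ENNReal.ofReal_sum_of_nonneg fun _ _ => by positivity, ← hA.sum_colPer_snoc]
    refine draw_mul_left ?_ _ (fun _ => by positivity) j
    have : 0 < ∏ j, ((occ l j).factorial : ℝ) :=
      Finset.prod_pos fun j _ => by exact_mod_cast Nat.factorial_pos _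
    positivity

/-- The probability of the sequence `l` of output ports. -/
def seqProb {N M : ℕ} (A : Fin N → Fin M → ℂ) (l : Fin N → Fin M) : ℝ :=
  ‖colPer A l‖ ^ 2 / N.factorial

theorem seqProb_def {N M : ℕ} (A : Fin N → Fin M → ℂ) (l : Fin N → Fin M) :
    seqProb A l = ‖colPer A l‖ ^ 2 / N.factorial := rfl

theorem seqProb_nonneg {N M : ℕ} (A : Fin N → Fin M → ℂ) (l : Fin N → Fin M) :
    0 ≤ seqProb A l := by
  unfold seqProb; positivity

theorem sampleLaw_apply {N M : ℕ} [NeZero M] (A : Matrix (Fin N) (Fin M) ℂ)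
    (hA : OrthonormalRows A) (l : Fin N → Fin M) :
    sampleLaw A l = ENNReal.ofReal (seqProb A l) := by
  have h0 : (0 : ℝ) < N.factorial := by exact_mod_cast Nat.factorial_pos N
  rw [sampleLaw, PMF.bind_apply, tsum_fintype]
  simp only [PMF.uniformOfFintype_apply]
  rw [← Finset.mul_sum, sum_perm_portLaw A hA, seqProb_def A, ENNReal.ofReal_div_of_pos h0,
    Fintype.card_perm, Fintype.card_fin, ENNReal.ofReal_natCast, ENNReal.div_eq_inv_mul]

theorem sampler_toOuterMeasure {N M : ℕ} [NeZero M] (A : Matrix (Fin N) (Fin M) ℂ)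
    (hA : OrthonormalRows A) (S : Set ((Fin N → Fin M) × ℕ))
    [DecidablePred fun l : Fin N → Fin M => (l, runCost N l + N ^ 2) ∈ S] :
    (sampler A).toOuterMeasure S =
      ENNReal.ofReal (∑ l ∈ Finset.univ.filter (fun l => (l, runCost N l + N ^ 2) ∈ S),
        seqProb A l) := by
  rw [sampler_eq_map, PMF.toOuterMeasure_map_apply, PMF.toOuterMeasure_apply_fintype,
    ENNReal.ofReal_sum_of_nonneg fun l _ => seqProb_nonneg A l, Finset.sum_filter]
  refine Finset.sum_congr rfl fun l _ => ?_
  by_cases h : (l, runCost N l + N ^ 2) ∈ S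
  · rw [if_pos h, ← sampleLaw_apply A hA]
    exact Set.indicator_of_mem (s := (fun l => (l, runCost N l + N ^ 2)) ⁻¹' S) h _
  · rw [if_neg h]
    exact Set.indicator_of_notMem (s := (fun l => (l, runCost N l + N ^ 2)) ⁻¹' S) h _

theorem meanOps_eq {N M : ℕ} [NeZero M] (A : Matrix (Fin N) (Fin M) ℂ)
    (hA : OrthonormalRows A) :
    meanOps A = ENNReal.ofReal (∑ l, seqProb A l * ((runCost N l + N ^ 2 : ℕ) : ℝ)) := by
  rw [meanOps, sampler_eq_map]
  simp only [PMF.map_apply, ← ENNReal.tsum_mul_right]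
  rw [ENNReal.tsum_comm, tsum_fintype,
    ENNReal.ofReal_sum_of_nonneg fun l _ => mul_nonneg (seqProb_nonneg A l) (Nat.cast_nonneg _)]
  refine Finset.sum_congr rfl fun l _ => ?_
  rw [tsum_eq_single (l, runCost N l + N ^ 2)]
  · rw [if_pos rfl, sampleLaw_apply A hA, ENNReal.ofReal_mul (seqProb_nonneg A l),
      ENNReal.ofReal_natCast]
  · intro s hs
    rw [if_neg hs, zero_mul]

theorem sum_seqProb {N M : ℕ} {A : Fin N → Fin M → ℂ} (hA : OrthonormalRows A) :
    ∑ l, seqProb A l = 1 := by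
  simp only [seqProb]
  rw [← Finset.sum_div, hA.sum_colPer, div_self]
  exact_mod_cast Nat.factorial_ne_zero N

/-- The sampler outputs every configuration with the probability given by the permanent. -/
theorem sampler_occ {N M : ℕ} [NeZero M] (A : Matrix (Fin N) (Fin M) ℂ)
    (hA : OrthonormalRows A) (l : Fin N → Fin M) :
    (sampler A).toOuterMeasure {s | occ s.1 = occ l} = ENNReal.ofReal (outputProb A l) := by
  classical
  rw [sampler_toOuterMeasure A hA]
  congr 1
  simp only [Set.mem_ofPred_eq]
  rw [Finset.sum_congr rfl fun l' hl' => by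
    rw [seqProb_def A, colPer_eq_of_occ_eq A (Finset.mem_filter.1 hl').2], Finset.sum_const,
    nsmul_eq_mul, outputProb, permanent_submatrix_eq]
  have h := congrArg (Nat.cast (R := ℝ)) (card_occ_eq l)
  push_cast at h
  have h1 : (0 : ℝ) < ∏ j, ((occ l j).factorial : ℝ) :=
    Finset.prod_pos fun j _ => by exact_mod_cast Nat.factorial_pos _
  have h2 : (0 : ℝ) < N.factorial := by exact_mod_cast Nat.factorial_pos N
  rw [mul_div_assoc', div_eq_div_iff h2.ne' h1.ne', ← h]
  simp only [occ]
  ring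

/-! ### Haar averages of squared permanents -/

/-- On a compact group the Haar probability measure is also invariant under right translations. -/
instance instRightInvariantHaarU (M : ℕ) : (haarU M).IsMulRightInvariant := by
  refine ⟨fun V => ?_⟩
  have : IsProbabilityMeasure (Measure.map (fun U => U * V) (haarU M)) :=
    Measure.isProbabilityMeasure_map (measurable_mul_const V).aemeasurable
  have : (Measure.map (fun U => U * V) (haarU M)).IsMulLeftInvariant := by
    refine ⟨fun W => ?_⟩
    rw [Measure.map_map (measurable_const_mul W) (measurable_mul_const V)]
    have : (fun U => W * U) ∘ (fun U : Matrix.unitaryGroup (Fin M) ℂ => U * V) =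
        (fun U => U * V) ∘ fun U => W * U := by
      ext1 U
      exact (mul_assoc W U V).symm
    rw [this, ← Measure.map_map (measurable_mul_const V) (measurable_const_mul W),
      map_mul_left_eq_self]
  have h := Measure.isMulInvariant_eq_smul_of_compactSpace
    (Measure.map (fun U => U * V) (haarU M)) (haarU M)
  have h1 := congrArg (fun μ => μ Set.univ) h
  simp only [measure_univ, Measure.smul_apply] at h1
  rw [h]
  rw [ENNReal.smul_def, smul_eq_mul, mul_one] at h1
  rw [ENNReal.coe_eq_one.1 h1.symm, one_smul]

/-- The rows `R 0, R 1, …` of a multiport. -/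
def rowsOf {N M : ℕ} (R : Fin N → Fin M) (U : Matrix.unitaryGroup (Fin M) ℂ) :
    Fin N → Fin M → ℂ :=
  fun k j => (U : Matrix (Fin M) (Fin M) ℂ) (R k) j

theorem continuous_entry {M : ℕ} (i j : Fin M) :
    Continuous fun U : Matrix.unitaryGroup (Fin M) ℂ => (U : Matrix (Fin M) (Fin M) ℂ) i j :=
  continuous_subtype_val.matrix_elem i j

theorem continuous_colPer {N M : ℕ} (R : Fin N → Fin M) (l : Fin N → Fin M) :
    Continuous fun U => colPer (rowsOf R U) l :=
  continuous_finsetSum _ fun _ _ => continuous_finsetProd _ fun _ _ => continuous_entry _ _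

theorem integrable_haarU {M : ℕ} {E : Type*} [NormedAddCommGroup E]
    {f : Matrix.unitaryGroup (Fin M) ℂ → E} (hf : Continuous f) : Integrable f (haarU M) :=
  hf.integrable_of_hasCompactSupport (HasCompactSupport.of_compactSpace f)

/-- The product of the linear forms given by the rows of `B`, at the point `x`. -/
def formProd {N M : ℕ} (B : Fin N → Fin M → ℂ) (x : Fin M → ℂ) : ℂ := ∏ k, ∑ j, B k j * x j

theorem factorial_mul_formProd {N M : ℕ} (B : Fin N → Fin M → ℂ) (x : Fin M → ℂ) :
    (N.factorial : ℂ) * formProd B x = ∑ l, colPer B l * ∏ k, x (l k) := by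
  have h : ∀ σ : Equiv.Perm (Fin N),
      ∑ l : Fin N → Fin M, (∏ i, B i (l (σ i))) * ∏ k, x (l k) = formProd B x := fun σ => by
    rw [formProd, Finset.prod_univ_sum, Fintype.piFinset_univ,
      ← Equiv.sum_comp (Equiv.arrowCongr σ (Equiv.refl (Fin M)))]
    refine Finset.sum_congr rfl fun l _ => ?_
    rw [Finset.prod_mul_distrib, ← Equiv.prod_comp σ.symm fun k => x (l k)]
    simp
  simp only [colPer_eq_sum_rows, Finset.sum_mul]
  rw [Finset.sum_comm]
  simp only [h, Finset.sum_const, Finset.card_univ, Fintype.card_perm, Fintype.card_fin,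
    nsmul_eq_mul]

theorem formProd_mul {N M : ℕ} (R : Fin N → Fin M) (U V : Matrix.unitaryGroup (Fin M) ℂ)
    (x : Fin M → ℂ) : formProd (rowsOf R (U * V)) x =
      formProd (rowsOf R U) ((V : Matrix (Fin M) (Fin M) ℂ).mulVec x) := by
  unfold formProd
  refine Finset.prod_congr rfl fun k _ => ?_
  have := congrFun (Matrix.mulVec_mulVec x (U : Matrix (Fin M) (Fin M) ℂ) V) (R k)
  exact this.symm

/-- A Householder reflection: any two real vectors of the same length are related by a unitary
matrix. -/
theorem exists_unitary_mulVec {M : ℕ} (x y : Fin M → ℝ) (h : ∑ j, x j ^ 2 = ∑ j, y j ^ 2) :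
    ∃ V : Matrix.unitaryGroup (Fin M) ℂ,
      (V : Matrix (Fin M) (Fin M) ℂ).mulVec (fun j => (x j : ℂ)) = fun j => (y j : ℂ) := by
  set q : ℝ := ∑ j, (y j - x j) ^ 2 with hq
  by_cases hq0 : q = 0
  · refine ⟨1, ?_⟩
    have : ∀ j, y j - x j = 0 := fun j => by
      have := (Finset.sum_eq_zero_iff_of_nonneg fun j _ => sq_nonneg (y j - x j)).1
        (hq ▸ hq0) j (Finset.mem_univ j)
      exact pow_eq_zero_iff (two_ne_zero) |>.1 this
    funext j
    simp [sub_eq_zero.1 (this j)]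
  · set w : Fin M → ℂ := fun j => ((y j - x j : ℝ) : ℂ) with hw
    have hqC : (q : ℂ) ≠ 0 := by exact_mod_cast hq0
    have hww : w ⬝ᵥ w = q := by
      simp only [dotProduct, hw, hq]
      push_cast
      exact Finset.sum_congr rfl fun j _ => by ring
    have hwx : w ⬝ᵥ (fun j => (x j : ℂ)) = -(q / 2) := by
      have : ∑ j, (y j - x j) * x j = -(q / 2) := by
        have e : q = ∑ j, y j ^ 2 + ∑ j, x j ^ 2 - 2 * ∑ j, y j * x j := by
          rw [hq, Finset.mul_sum, ← Finset.sum_add_distrib, ← Finset.sum_sub_distrib]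
          exact Finset.sum_congr rfl fun j _ => by ring
        have e2 : ∑ j, (y j - x j) * x j = ∑ j, y j * x j - ∑ j, x j ^ 2 := by
          rw [← Finset.sum_sub_distrib]
          exact Finset.sum_congr rfl fun j _ => by ring
        rw [e2, e]
        linarith
      simp only [dotProduct, hw]
      exact_mod_cast this
    have hsq : Matrix.vecMulVec w w * Matrix.vecMulVec w w = (q : ℂ) • Matrix.vecMulVec w w := by
      ext i k
      simp only [Matrix.mul_apply, Matrix.vecMulVec_apply, Matrix.smul_apply, smul_eq_mul, ← hww,
        dotProduct, Finset.sum_mul]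
      exact Finset.sum_congr rfl fun j _ => by ring
    set H : Matrix (Fin M) (Fin M) ℂ := 1 - (2 / q : ℂ) • Matrix.vecMulVec w w with hH
    have hstar : star H = H := by
      ext i k
      simp only [hH, hw, Matrix.star_apply, Matrix.sub_apply, Matrix.smul_apply,
        Matrix.vecMulVec_apply, Matrix.one_apply, star_sub, smul_eq_mul, star_mul', star_div₀,
        Complex.star_def, Complex.conj_ofReal, apply_ite (starRingEnd ℂ), map_one, map_zero,
        Complex.conj_ofNat]
      rw [mul_comm ((y k - x k : ℝ) : ℂ)]
      congr 1
      simp only [eq_comm]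
    have hU : H ∈ Matrix.unitaryGroup (Fin M) ℂ := by
      rw [Matrix.mem_unitaryGroup_iff, hstar, hH]
      simp only [sub_mul, mul_sub, one_mul, mul_one, smul_mul_assoc, mul_smul_comm, hsq, smul_smul]
      rw [div_mul_cancel₀ _ hqC, two_smul, sub_add_cancel_left, smul_neg, sub_neg_eq_add,
        sub_add_cancel]
    refine ⟨⟨H, hU⟩, ?_⟩
    funext i
    have : (H.mulVec fun j => (x j : ℂ)) i =
        x i - (2 / q) * (w i * (w ⬝ᵥ fun j => (x j : ℂ))) := by
      rw [hH, Matrix.sub_mulVec, Matrix.one_mulVec, Matrix.smul_mulVec, Pi.sub_apply,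
        Pi.smul_apply, smul_eq_mul]
      congr 2
      simp only [Matrix.mulVec, dotProduct, Matrix.vecMulVec_apply, Finset.mul_sum]
      exact Finset.sum_congr rfl fun j _ => by ring
    change (H.mulVec fun j => (x j : ℂ)) i = _
    rw [this, hwx, hw]
    push_cast
    field_simp
    ring

theorem integral_formProd_eq {N M : ℕ} (R : Fin N → Fin M) (x y : Fin M → ℝ)
    (h : ∑ j, x j ^ 2 = ∑ j, y j ^ 2) :
    ∫ U, ‖formProd (rowsOf R U) (fun j => (x j : ℂ))‖ ^ 2 ∂haarU M =
      ∫ U, ‖formProd (rowsOf R U) (fun j => (y j : ℂ))‖ ^ 2 ∂haarU M := by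
  obtain ⟨V, hV⟩ := exists_unitary_mulVec x y h
  rw [← integral_mul_right_eq_self _ V]
  simp only [formProd_mul, hV]

/-- Permanents of different output configurations are orthogonal: the phase of a port with
different occupations can be chosen such that the product changes its sign. -/
theorem integral_colPer_mul_star_eq_zero {N M : ℕ} (R l l' : Fin N → Fin M)
    (h : occ l ≠ occ l') :
    ∫ U, colPer (rowsOf R U) l * star (colPer (rowsOf R U) l') ∂haarU M = 0 := by
  obtain ⟨j, hj⟩ := Function.ne_iff.1 h
  set θ : ℝ := Real.pi / ((occ l j : ℝ) - occ l' j) with hθ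
  have hd : ((occ l j : ℝ) - occ l' j) ≠ 0 := sub_ne_zero.2 (by exact_mod_cast hj)
  set ω : ℂ := Complex.exp (θ * Complex.I) with hω
  have hω1 : ω * star ω = 1 := by
    rw [Complex.star_def, Complex.mul_conj, Complex.normSq_eq_norm_sq, hω,
      Complex.norm_exp_ofReal_mul_I]
    simp
  set d : Fin M → ℂ := Function.update 1 j ω with hdd
  have hV : Matrix.diagonal d ∈ Matrix.unitaryGroup (Fin M) ℂ := by
    rw [Matrix.mem_unitaryGroup_iff, Matrix.star_eq_conjTranspose, Matrix.diagonal_conjTranspose,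
      Matrix.diagonal_mul_diagonal, ← Matrix.diagonal_one]
    congr 1
    funext i
    by_cases hi : i = j
    · subst hi
      simpa [hdd] using hω1
    · simp [hdd, hi]
  have hmul : ∀ U : Matrix.unitaryGroup (Fin M) ℂ, ∀ l : Fin N → Fin M,
      colPer (rowsOf R (U * ⟨_, hV⟩)) l = ω ^ occ l j * colPer (rowsOf R U) l := fun U l => by
    have e : ω ^ occ l j = ∏ k, d (l k) := by
      rw [prod_comp_occ l d, Finset.prod_eq_single j]
      · simp [hdd]
      · intro i _ hi
        simp [hdd, hi]
      · simp
    rw [e, colPer, colPer, Finset.mul_sum]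
    refine Finset.sum_congr rfl fun σ _ => ?_
    rw [← Finset.prod_mul_distrib]
    refine Finset.prod_congr rfl fun i _ => ?_
    have : ((U : Matrix (Fin M) (Fin M) ℂ) * Matrix.diagonal d) (R (σ i)) (l i) =
        (U : Matrix (Fin M) (Fin M) ℂ) (R (σ i)) (l i) * d (l i) := Matrix.mul_diagonal _ _ _ _
    rw [mul_comm (d (l i))]
    exact this
  refine integral_eq_zero_of_mul_right_eq_neg (g := ⟨_, hV⟩) fun U => ?_
  rw [hmul, hmul]
  have hphase : ω ^ occ l j * star (ω ^ occ l' j) = -1 := by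
    rw [star_pow, hω, Complex.star_def, ← Complex.exp_conj, ← Complex.exp_nat_mul,
      ← Complex.exp_nat_mul, ← Complex.exp_add, ← Complex.exp_pi_mul_I]
    congr 1
    have : (Real.pi : ℂ) = (((occ l j : ℝ) - occ l' j) * θ : ℝ) := by
      rw [hθ, mul_div_cancel₀ _ hd]
    rw [this]
    push_cast
    simp only [map_mul, Complex.conj_ofReal, Complex.conj_I]
    ring
  rw [star_mul', mul_mul_mul_comm, hphase]
  ring

theorem integral_norm_sq_formProd {N M : ℕ} (R : Fin N → Fin M) (x : Fin M → ℝ) :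
    ∫ U, ‖formProd (rowsOf R U) (fun j => (x j : ℂ))‖ ^ 2 ∂haarU M =
      ∑ l : Fin N → Fin M, (∫ U, ‖colPer (rowsOf R U) l‖ ^ 2 ∂haarU M) /
        ((N.factorial : ℝ) * ∏ j, ((occ l j).factorial : ℝ)) * ∏ k, x (l k) ^ 2 := by
  have key : ∀ z : ℂ, ((‖z‖ ^ 2 : ℝ) : ℂ) = z * star z := fun z => by
    rw [Complex.star_def, Complex.mul_conj, Complex.normSq_eq_norm_sq]
  have hN : (N.factorial : ℂ) ≠ 0 := by exact_mod_cast Nat.factorial_ne_zero N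
  apply Complex.ofReal_injective
  have hof : ∀ f : Matrix.unitaryGroup (Fin M) ℂ → ℝ,
      ((∫ U, f U ∂haarU M : ℝ) : ℂ) = ∫ U, (f U : ℂ) ∂haarU M := fun f => integral_ofReal.symm
  simp only [Complex.ofReal_sum, Complex.ofReal_mul, Complex.ofReal_div, hof, key]
  have hexp : ∀ U : Matrix.unitaryGroup (Fin M) ℂ,
      formProd (rowsOf R U) (fun j => (x j : ℂ)) * star (formProd (rowsOf R U) fun j => (x j : ℂ)) =
      ∑ l : Fin N → Fin M, ∑ l' : Fin N → Fin M,
        ((∏ k, (x (l k) : ℂ)) * (∏ k, (x (l' k) : ℂ)) / (N.factorial : ℂ) ^ 2) *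
        (colPer (rowsOf R U) l * star (colPer (rowsOf R U) l')) := fun U => by
    have h := factorial_mul_formProd (rowsOf R U) fun j => (x j : ℂ)
    rw [mul_comm, ← eq_div_iff hN] at h
    rw [h, star_div₀, star_sum, div_mul_div_comm, Finset.sum_mul_sum, Finset.sum_div]
    refine Finset.sum_congr rfl fun l _ => ?_
    rw [Finset.sum_div]
    refine Finset.sum_congr rfl fun l' _ => ?_
    simp only [star_mul', star_prod, star_natCast, Complex.star_def, Complex.conj_ofReal]
    ring
  simp only [hexp]
  have hcont : ∀ l l' : Fin N → Fin M, Integrable (fun U =>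
      ((∏ k, (x (l k) : ℂ)) * (∏ k, (x (l' k) : ℂ)) / (N.factorial : ℂ) ^ 2) *
        (colPer (rowsOf R U) l * star (colPer (rowsOf R U) l'))) (haarU M) := fun l l' =>
    integrable_haarU (continuous_const.mul ((continuous_colPer R l).mul
      (continuous_colPer R l').star))
  rw [integral_finsetSum _ fun l _ => integrable_finsetSum _ fun l' _ => hcont l l']
  refine Finset.sum_congr rfl fun l _ => ?_
  rw [integral_finsetSum _ fun l' _ => hcont l l']
  simp only [integral_const_mul]
  rw [← Finset.sum_filter_add_sum_filter_not Finset.univ (fun l' => occ l' = occ l),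
    Finset.sum_eq_zero (s := Finset.univ.filter fun l' => ¬occ l' = occ l) fun l' hl' => by
      rw [integral_colPer_mul_star_eq_zero R l l' (Ne.symm (Finset.mem_filter.1 hl').2), mul_zero],
    add_zero]
  have hsame : ∀ l' ∈ Finset.univ.filter (fun l' => occ l' = occ l),
      (∏ k, (x (l k) : ℂ)) * (∏ k, (x (l' k) : ℂ)) / (N.factorial : ℂ) ^ 2 *
        ∫ U, colPer (rowsOf R U) l * star (colPer (rowsOf R U) l') ∂haarU M =
      (∏ k, (x (l k) : ℂ)) * (∏ k, (x (l k) : ℂ)) / (N.factorial : ℂ) ^ 2 *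
        ∫ U, colPer (rowsOf R U) l * star (colPer (rowsOf R U) l) ∂haarU M := fun l' hl' => by
    have ho : occ l' = occ l := (Finset.mem_filter.1 hl').2
    rw [prod_comp_occ l' fun j => (x j : ℂ), ho, ← prod_comp_occ l fun j => (x j : ℂ)]
    simp only [colPer_eq_of_occ_eq _ ho]
  rw [Finset.sum_congr rfl hsame, Finset.sum_const, nsmul_eq_mul]
  have hcard := congrArg (Nat.cast (R := ℂ)) (card_occ_eq l)
  push_cast at hcard
  have hm : (∏ j, ((occ l j).factorial : ℂ)) ≠ 0 :=
    Finset.prod_ne_zero_iff.2 fun j _ => by exact_mod_cast (Nat.factorial_ne_zero _)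
  have hc : ((Finset.univ.filter fun l' : Fin N → Fin M => occ l' = occ l).card : ℂ) =
      N.factorial / ∏ j, ((occ l j).factorial : ℂ) := by
    rw [eq_div_iff hm, ← hcard, mul_comm]
  rw [hc]
  push_cast
  rw [Finset.prod_pow]
  field_simp

/-- A symmetric function `a` of sequences whose generating polynomial vanishes on the positive
orthant is zero. -/
theorem eq_zero_of_sum_prod_eq_zero {N M : ℕ} (a : (Fin N → Fin M) → ℝ)
    (hsymm : ∀ l l', occ l' = occ l → a l' = a l)
    (h : ∀ y : Fin M → ℝ, (∀ j, 0 ≤ y j) → ∑ l, a l * ∏ k, y (l k) = 0)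
    (l : Fin N → Fin M) : a l = 0 := by
  set p : MvPolynomial (Fin M) ℝ :=
    ∑ l, MvPolynomial.monomial (Finsupp.equivFunOnFinite.symm (occ l)) (a l) with hp
  have hp0 : p = 0 := by
    refine MvPolynomial.funext_set (fun _ => Set.Ici (0 : ℝ)) (fun _ => Set.Ici_infinite 0) ?_
    intro y hy
    rw [map_zero, hp, map_sum, ← h y fun j => hy j (Set.mem_univ j)]
    refine Finset.sum_congr rfl fun l _ => ?_
    rw [MvPolynomial.eval_monomial, prod_comp_occ, Finsupp.prod_fintype _ _ fun j => pow_zero _]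
    rfl
  have hc := congrArg (MvPolynomial.coeff (Finsupp.equivFunOnFinite.symm (occ l))) hp0
  rw [hp, MvPolynomial.coeff_sum, MvPolynomial.coeff_zero] at hc
  simp only [MvPolynomial.coeff_monomial, EmbeddingLike.apply_eq_iff_eq] at hc
  rw [← Finset.sum_filter, Finset.sum_congr rfl fun l' hl' => hsymm l l'
    (Finset.mem_filter.1 hl').2, Finset.sum_const, nsmul_eq_mul] at hc
  rcases mul_eq_zero.1 hc with h0 | h0
  · have := card_occ_eq l
    rw [Nat.cast_eq_zero.1 h0, mul_zero] at this
    exact absurd this.symm (Nat.factorial_ne_zero N)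
  · exact h0

/-- The Haar average of the squared permanent is proportional to `∏ j, (occ l j)!`: all output
configurations of `N` bosons are equally probable on average. -/
theorem exists_integral_colPer {N M : ℕ} [NeZero M] (R : Fin N → Fin M) :
    ∃ c : ℝ, ∀ l : Fin N → Fin M, ∫ U, ‖colPer (rowsOf R U) l‖ ^ 2 ∂haarU M =
      c * ∏ j, ((occ l j).factorial : ℝ) := by
  set I : ℝ := ∫ U, ‖formProd (rowsOf R U) (fun j => ((Pi.single 0 1 : Fin M → ℝ) j : ℂ))‖ ^ 2
    ∂haarU M with hI
  have hN : (0 : ℝ) < N.factorial := by exact_mod_cast Nat.factorial_pos N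
  refine ⟨N.factorial * I, fun l => ?_⟩
  have hm : ∀ l : Fin N → Fin M, (0 : ℝ) < ∏ j, ((occ l j).factorial : ℝ) := fun l =>
    Finset.prod_pos fun j _ => by exact_mod_cast Nat.factorial_pos _
  have h := eq_zero_of_sum_prod_eq_zero (N := N) (M := M)
    (fun l => (∫ U, ‖colPer (rowsOf R U) l‖ ^ 2 ∂haarU M) /
        ((N.factorial : ℝ) * ∏ j, ((occ l j).factorial : ℝ)) - I) ?_ ?_ l
  · rw [sub_eq_zero, div_eq_iff (mul_pos hN (hm l)).ne'] at h
    rw [h]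
    ring
  · intro l l' ho
    simp only [colPer_eq_of_occ_eq _ ho, ho]
  · intro y hy
    have hs : ∀ j, √(y j) ^ 2 = y j := fun j => Real.sq_sqrt (hy j)
    have h1 := integral_norm_sq_formProd R fun j => √(y j)
    simp only [hs] at h1
    have h2 := integral_formProd_eq R (fun j => √(y j))
      (fun j => √(∑ j, y j) * (Pi.single 0 1 : Fin M → ℝ) j) (by
        simp only [mul_pow, hs, Real.sq_sqrt (Finset.sum_nonneg fun j _ => hy j)]
        rw [← Finset.mul_sum,
          Finset.sum_eq_single (f := fun j => (Pi.single 0 1 : Fin M → ℝ) j ^ 2) 0]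
        · simp
        · intro j _ hj
          simp [hj]
        · simp)
    have h3 : ∀ U : Matrix.unitaryGroup (Fin M) ℂ, ‖formProd (rowsOf R U) (fun j =>
        ((√(∑ j, y j) * (Pi.single 0 1 : Fin M → ℝ) j : ℝ) : ℂ))‖ ^ 2 = (∑ j, y j) ^ N *
        ‖formProd (rowsOf R U) (fun j => ((Pi.single 0 1 : Fin M → ℝ) j : ℂ))‖ ^ 2 := fun U => by
      have : formProd (rowsOf R U) (fun j =>
          ((√(∑ j, y j) * (Pi.single 0 1 : Fin M → ℝ) j : ℝ) : ℂ)) = (√(∑ j, y j) : ℂ) ^ N *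
          formProd (rowsOf R U) (fun j => ((Pi.single 0 1 : Fin M → ℝ) j : ℂ)) := by
        unfold formProd
        rw [← Fin.prod_const N, ← Finset.prod_mul_distrib]
        refine Finset.prod_congr rfl fun k _ => ?_
        rw [Finset.mul_sum]
        refine Finset.sum_congr rfl fun j _ => ?_
        push_cast
        ring
      rw [this, norm_mul, mul_pow, norm_pow, ← pow_mul, mul_comm N 2, pow_mul]
      rw [Complex.norm_real, Real.norm_eq_abs, sq_abs,
        Real.sq_sqrt (Finset.sum_nonneg fun j _ => hy j)]
    simp only [h3, integral_const_mul] at h2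
    rw [h1, ← hI] at h2
    simp only [sub_mul, Finset.sum_sub_distrib]
    rw [h2, ← Finset.mul_sum, sub_eq_zero, mul_comm]
    congr 1
    rw [← Fin.prod_const N, Finset.prod_univ_sum, Fintype.piFinset_univ]

/-! ### The Haar-averaged law of the ports is a Pólya urn -/

/-- The Haar average of the probability of the sequence `l` of output ports: the law of the colours
drawn from a Pólya urn with `M` colours. -/
def urnProb {K M : ℕ} (l : Fin K → Fin M) : ℝ :=
  (∏ j, ((occ l j).factorial : ℝ)) / M.ascFactorial K

theorem urnProb_nonneg {K M : ℕ} (l : Fin K → Fin M) : 0 ≤ urnProb l := by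
  unfold urnProb; positivity

/-- The mean of `f` over the sequences of `K` ports in the Haar-averaged law. -/
def urnMean {M : ℕ} (K : ℕ) (f : (Fin K → Fin M) → ℝ) : ℝ := ∑ l, urnProb l * f l

theorem prod_factorial_snoc {K M : ℕ} (l : Fin K → Fin M) (j : Fin M) :
    ∏ i, ((occ (Fin.snoc (α := fun _ => Fin M) l j) i).factorial : ℝ) =
      (occ l j + 1) * ∏ i, ((occ l i).factorial : ℝ) := by
  rw [← Finset.mul_prod_erase _ _ (Finset.mem_univ j),
    ← Finset.mul_prod_erase _ (fun i => ((occ l i).factorial : ℝ)) (Finset.mem_univ j), ← mul_assoc]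
  congr 1
  · simp [occ_snoc, Nat.factorial_succ]
  · refine Finset.prod_congr rfl fun i hi => ?_
    rw [occ_snoc, if_neg (Finset.mem_erase.1 hi).1, add_zero]

theorem urnProb_snoc {K M : ℕ} (l : Fin K → Fin M) (j : Fin M) :
    urnProb (Fin.snoc (α := fun _ => Fin M) l j) = urnProb l * ((occ l j + 1) / (M + K)) := by
  rw [urnProb, urnProb, prod_factorial_snoc, Nat.ascFactorial_succ]
  push_cast
  rw [div_mul_div_comm, mul_comm]
  congr 1
  ring

theorem urnMean_succ {K M : ℕ} (f : (Fin (K + 1) → Fin M) → ℝ) :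
    urnMean (K + 1) f = urnMean K fun l => ∑ j, (occ l j + 1) / (M + K) *
      f (Fin.snoc (α := fun _ => Fin M) l j) := by
  rw [urnMean, urnMean, sum_snoc]
  refine Finset.sum_congr rfl fun l _ => ?_
  rw [Finset.mul_sum]
  refine Finset.sum_congr rfl fun j _ => ?_
  rw [urnProb_snoc, mul_assoc]

theorem sum_occ_add_one {K M : ℕ} (l : Fin K → Fin M) :
    ∑ j, ((occ l j : ℝ) + 1) = M + K := by
  have := congrArg (Nat.cast (R := ℝ)) (sum_occ l)
  push_cast at this
  rw [Finset.sum_add_distrib, this]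
  simp [add_comm]

theorem sum_occ_add_one_div {K M : ℕ} [NeZero M] (l : Fin K → Fin M) :
    ∑ j, ((occ l j : ℝ) + 1) / (M + K) = 1 := by
  rw [← Finset.sum_div, sum_occ_add_one, div_self]
  have : (0 : ℝ) < M := by exact_mod_cast NeZero.pos M
  positivity

theorem urnMean_mono {K M : ℕ} {f g : (Fin K → Fin M) → ℝ} (h : ∀ l, f l ≤ g l) :
    urnMean K f ≤ urnMean K g :=
  Finset.sum_le_sum fun l _ => mul_le_mul_of_nonneg_left (h l) (urnProb_nonneg l)

theorem urnMean_const_mul {K M : ℕ} (c : ℝ) (f : (Fin K → Fin M) → ℝ) :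
    urnMean K (fun l => c * f l) = c * urnMean K f := by
  rw [urnMean, urnMean, Finset.mul_sum]
  exact Finset.sum_congr rfl fun l _ => by ring

theorem urnMean_add {K M : ℕ} (f g : (Fin K → Fin M) → ℝ) :
    urnMean K (fun l => f l + g l) = urnMean K f + urnMean K g := by
  simp only [urnMean, mul_add, Finset.sum_add_distrib]

theorem urnMean_one {K M : ℕ} [NeZero M] : urnMean K (fun _ : Fin K → Fin M => 1) = 1 := by
  induction K with
  | zero => simp [urnMean, urnProb, occ]
  | succ K ih =>
    rw [urnMean_succ]
    simp only [mul_one, sum_occ_add_one_div, ih]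

theorem urnMean_sum {K M : ℕ} {ι : Type*} (s : Finset ι) (f : ι → (Fin K → Fin M) → ℝ) :
    urnMean K (fun l => ∑ i ∈ s, f i l) = ∑ i ∈ s, urnMean K (f i) := by
  simp only [urnMean, Finset.mul_sum]
  exact Finset.sum_comm

theorem ascFactorial_pos (M K : ℕ) [NeZero M] : (0 : ℝ) < M.ascFactorial K := by
  exact_mod_cast (pow_pos (NeZero.pos M) K).trans_le (Nat.pow_succ_le_ascFactorial M K)

theorem sum_prod_factorial {K M : ℕ} [NeZero M] :
    ∑ l : Fin K → Fin M, ∏ j, ((occ l j).factorial : ℝ) = M.ascFactorial K := by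
  have h := urnMean_one (K := K) (M := M)
  simp only [urnMean, mul_one, urnProb] at h
  rwa [← Finset.sum_div, div_eq_one_iff_eq (ascFactorial_pos M K).ne'] at h

theorem integral_colPer_of_sum {N M : ℕ} [NeZero M] (R : Fin N → Fin M) (S : ℝ)
    (hS : ∀ U : Matrix.unitaryGroup (Fin M) ℂ, ∑ l, ‖colPer (rowsOf R U) l‖ ^ 2 = S)
    (l : Fin N → Fin M) :
    ∫ U, ‖colPer (rowsOf R U) l‖ ^ 2 ∂haarU M = S * urnProb l := by
  obtain ⟨c, hc⟩ := exists_integral_colPer R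
  have h0 := (ascFactorial_pos M N).ne'
  have hint : ∀ l : Fin N → Fin M,
      Integrable (fun U => ‖colPer (rowsOf R U) l‖ ^ 2) (haarU M) := fun l =>
    integrable_haarU ((continuous_colPer R l).norm.pow 2)
  have hsum : ∑ l : Fin N → Fin M, ∫ U, ‖colPer (rowsOf R U) l‖ ^ 2 ∂haarU M = S := by
    rw [← integral_finsetSum _ fun l _ => hint l]
    simp [hS]
  simp only [hc] at hsum
  rw [← Finset.mul_sum, sum_prod_factorial] at hsum
  rw [hc, urnProb, ← hsum]
  field_simp

theorem orthonormalRows_rowsOf {N M : ℕ} {R : Fin N → Fin M} (hR : Function.Injective R)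
    (U : Matrix.unitaryGroup (Fin M) ℂ) : OrthonormalRows (rowsOf R U) :=
  (orthonormalRows_inputRows (le_refl M) U).comp hR

theorem continuous_seqProb {N M : ℕ} (R : Fin N → Fin M) (l : Fin N → Fin M) :
    Continuous fun U => seqProb (rowsOf R U) l :=
  ((continuous_colPer R l).norm.pow 2).div_const _

theorem integral_seqProb {N M : ℕ} [NeZero M] {R : Fin N → Fin M} (hR : Function.Injective R)
    (l : Fin N → Fin M) : ∫ U, seqProb (rowsOf R U) l ∂haarU M = urnProb l := by
  have h0 : (N.factorial : ℝ) ≠ 0 := by exact_mod_cast Nat.factorial_ne_zero N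
  have h1 := integral_colPer_of_sum R N.factorial
    (fun U => (orthonormalRows_rowsOf hR U).sum_colPer) l
  simp only [seqProb]
  rw [integral_div, h1, mul_div_cancel_left₀ _ h0]

theorem integral_sum_seqProb {N M : ℕ} [NeZero M] {R : Fin N → Fin M}
    (hR : Function.Injective R) (f : (Fin N → Fin M) → ℝ) :
    ∫ U, ∑ l, seqProb (rowsOf R U) l * f l ∂haarU M = urnMean N f := by
  have hint : ∀ l : Fin N → Fin M,
      Integrable (fun U => seqProb (rowsOf R U) l * f l) (haarU M) := fun l =>
    integrable_haarU ((continuous_seqProb R l).mul continuous_const)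
  rw [integral_finsetSum _ fun l _ => hint l]
  simp only [integral_mul_const, integral_seqProb hR, urnMean]

/-- The fourth moments of the entries in one column, obtained from the average for two bosons. -/
theorem integral_entry_mul_entry {M : ℕ} [NeZero M] (i i' j : Fin M) :
    ∫ U, ‖(U : Matrix (Fin M) (Fin M) ℂ) i j‖ ^ 2 * ‖(U : Matrix (Fin M) (Fin M) ℂ) i' j‖ ^ 2
      ∂haarU M = (1 + if i = i' then 1 else 0) / (M * (M + 1)) := by
  have hper : ∀ (U : Matrix.unitaryGroup (Fin M) ℂ) (l : Fin 2 → Fin M),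
      colPer (rowsOf ![i, i'] U) l =
      (U : Matrix (Fin M) (Fin M) ℂ) i (l 0) * (U : Matrix (Fin M) (Fin M) ℂ) i' (l 1) +
      (U : Matrix (Fin M) (Fin M) ℂ) i' (l 0) * (U : Matrix (Fin M) (Fin M) ℂ) i (l 1) :=
    fun U l => by
      rw [colPer, ← (Equiv.Perm.decomposeFin).symm.sum_comp, Fintype.sum_prod_type]
      simp [Fin.sum_univ_two, Fin.prod_univ_two, rowsOf]
  have hS : ∀ U : Matrix.unitaryGroup (Fin M) ℂ,
      ∑ l, ‖colPer (rowsOf ![i, i'] U) l‖ ^ 2 = 2 * (1 + if i = i' then 1 else 0) := fun U => by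
    by_cases hi : i = i'
    · subst hi
      have h1 : ∑ j, ‖(U : Matrix (Fin M) (Fin M) ℂ) i j‖ ^ 2 = 1 := by
        have := (orthonormalRows_rowsOf (R := fun _ : Fin 1 => i)
          (fun _ _ _ => Subsingleton.elim _ _) U).sum_colPer
        rw [← (Equiv.funUnique (Fin 1) (Fin M)).symm.sum_comp] at this
        simpa [colPer, rowsOf] using this
      have h2 : ∀ l : Fin 2 → Fin M, ‖colPer (rowsOf ![i, i] U) l‖ ^ 2 =
          4 * ∏ k, ‖(U : Matrix (Fin M) (Fin M) ℂ) i (l k)‖ ^ 2 := fun l => by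
        rw [hper, ← two_mul, norm_mul, norm_mul, Fin.prod_univ_two]
        norm_num
        ring
      simp only [h2]
      rw [← Finset.mul_sum, ← Fintype.piFinset_univ,
        ← Finset.prod_univ_sum (fun _ => Finset.univ)
          fun _ j => ‖(U : Matrix (Fin M) (Fin M) ℂ) i j‖ ^ 2]
      simp [h1]
      norm_num
    · have hinj : Function.Injective ![i, i'] := by
        intro a b
        fin_cases a <;> fin_cases b <;> simp [hi, Ne.symm hi]
      rw [(orthonormalRows_rowsOf hinj U).sum_colPer]
      simp [hi]
  have h := integral_colPer_of_sum ![i, i'] _ hS fun _ => j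
  have hsq : ∀ U : Matrix.unitaryGroup (Fin M) ℂ,
      ‖colPer (rowsOf ![i, i'] U) fun _ => j‖ ^ 2 = 4 *
        (‖(U : Matrix (Fin M) (Fin M) ℂ) i j‖ ^ 2 * ‖(U : Matrix (Fin M) (Fin M) ℂ) i' j‖ ^ 2) :=
    fun U => by
      rw [hper, mul_comm ((U : Matrix (Fin M) (Fin M) ℂ) i' j), ← two_mul, norm_mul, norm_mul]
      norm_num
      ring
  have hurn : urnProb (fun _ : Fin 2 => j) = 2 / (M * (M + 1)) := by
    rw [urnProb, Finset.prod_eq_single j]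
    · simp [occ, Nat.ascFactorial_succ]
      ring
    · intro j' _ hj'
      simp [occ, Ne.symm hj']
    · simp
  simp only [hsq, integral_const_mul, hurn] at h
  linear_combination h / 4

/-! ### Tail bounds for the urn -/

theorem pow_succ_add_mul_le (x d : ℝ) (hx : 0 ≤ x) (hd : 0 ≤ d) (k : ℕ) :
    x ^ (k + 1) + (k + 1) * x ^ k * d ≤ (x + d) ^ (k + 1) := by
  induction k with
  | zero => simp
  | succ k ih =>
    have h1 : 0 ≤ x + d := by positivity
    have h2 := mul_le_mul_of_nonneg_right ih h1
    have h3 : 0 ≤ (k + 1) * x ^ k * d ^ 2 := by positivity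
    calc x ^ (k + 1 + 1) + (((k + 1 : ℕ) : ℝ) + 1) * x ^ (k + 1) * d
        ≤ (x ^ (k + 1) + (k + 1) * x ^ k * d) * (x + d) := by
          push_cast
          have : (x ^ (k + 1) + (k + 1) * x ^ k * d) * (x + d) =
            x ^ (k + 1 + 1) + (((k : ℝ) + 1) + 1) * x ^ (k + 1) * d +
              (k + 1) * x ^ k * d ^ 2 := by ring
          rw [this]
          linarith
      _ ≤ _ := by rw [pow_succ (x + d) (k + 1)]; exact h2

/-- The probability that port `j` holds at least `k` bosons is at most `(K / (M + K - 1)) ^ k`.  The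
induction over the number of draws closes because of Bernoulli's inequality. -/
theorem urnMean_le_occ {M : ℕ} (hM : 2 ≤ M) (j : Fin M) (K k : ℕ) :
    urnMean K (fun l => if k ≤ occ l j then (1 : ℝ) else 0) ≤ ((K : ℝ) / (M + K - 1)) ^ k := by
  have : NeZero M := ⟨by omega⟩
  induction K generalizing k with
  | zero =>
    cases k with
    | zero => simp [urnMean_one]
    | succ k => simp [urnMean, occ]
  | succ K ih =>
    cases k with
    | zero => simp [urnMean_one]
    | succ k =>
      have hM' : (2 : ℝ) ≤ M := by exact_mod_cast hM
      have hK : (0 : ℝ) ≤ K := Nat.cast_nonneg K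
      have hMK : (0 : ℝ) < M + K := by linarith
      have hMK1 : (0 : ℝ) < M + K - 1 := by linarith
      set x : ℝ := K / (M + K - 1) with hx
      have hx0 : 0 ≤ x := div_nonneg hK hMK1.le
      have hx1 : x ≤ 1 := by rw [hx, div_le_one hMK1]; linarith
      have hd : 0 ≤ (1 - x) / (M + K) := div_nonneg (by linarith) hMK.le
      have hnext : ((K + 1 : ℕ) : ℝ) / (M + (K + 1 : ℕ) - 1) = x + (1 - x) / (M + K) := by
        have h3 : (M : ℝ) + (K + 1 : ℕ) - 1 = M + K := by push_cast; ring
        rw [h3, hx]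
        push_cast
        field_simp
        ring
      rw [hnext]
      rcases le_or_gt (k + 1) (K + 1) with hkK | hkK
      · have hstep : ∀ l : Fin K → Fin M, ∑ i, ((occ l i : ℝ) + 1) / (M + K) *
            (if k + 1 ≤ occ (Fin.snoc (α := fun _ => Fin M) l i) j then (1 : ℝ) else 0) =
            (1 - (k + 1) / (M + K)) * (if k + 1 ≤ occ l j then 1 else 0) +
              (k + 1) / (M + K) * (if k ≤ occ l j then 1 else 0) := by
          intro l
          have hsum := sum_occ_add_one_div l
          rw [← Finset.add_sum_erase _ _ (Finset.mem_univ j)] at hsum ⊢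
          have hrest : ∑ i ∈ Finset.univ.erase j, ((occ l i : ℝ) + 1) / (M + K) *
              (if k + 1 ≤ occ (Fin.snoc (α := fun _ => Fin M) l i) j then (1 : ℝ) else 0) =
              (∑ i ∈ Finset.univ.erase j, ((occ l i : ℝ) + 1) / (M + K)) *
                (if k + 1 ≤ occ l j then 1 else 0) := by
            rw [Finset.sum_mul]
            refine Finset.sum_congr rfl fun i hi => ?_
            rw [occ_snoc, if_neg (Ne.symm (Finset.mem_erase.1 hi).1), add_zero]
          rw [hrest, occ_snoc, if_pos rfl]
          rcases lt_trichotomy (occ l j) k with h | h | h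
          · rw [if_neg (by omega), if_neg (by omega), if_neg (by omega)]
            ring
          · rw [if_pos (by omega), if_neg (by omega), if_pos (by omega), h]
            ring
          · rw [if_pos (by omega), if_pos (by omega), if_pos (by omega)]
            linarith
        rw [urnMean_succ]
        simp only [hstep]
        rw [urnMean_add, urnMean_const_mul, urnMean_const_mul]
        have hk : (k : ℝ) + 1 ≤ M + K := by
          have : (k : ℝ) + 1 ≤ K + 1 := by exact_mod_cast hkK
          linarith
        have hc1 : 0 ≤ 1 - ((k : ℝ) + 1) / (M + K) := by
          rw [sub_nonneg, div_le_one hMK]; exact hk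
        have hc2 : 0 ≤ ((k : ℝ) + 1) / (M + K) := by positivity
        calc _ ≤ (1 - ((k : ℝ) + 1) / (M + K)) * x ^ (k + 1) + (k + 1) / (M + K) * x ^ k :=
              add_le_add (mul_le_mul_of_nonneg_left (ih (k + 1)) hc1)
                (mul_le_mul_of_nonneg_left (ih k) hc2)
          _ = x ^ (k + 1) + (k + 1) * x ^ k * ((1 - x) / (M + K)) := by ring
          _ ≤ _ := pow_succ_add_mul_le x _ hx0 hd k
      · have hzero : ∀ l : Fin (K + 1) → Fin M, ¬ k + 1 ≤ occ l j := fun l h => by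
          have h1 : occ l j ≤ ∑ i, occ l i :=
            Finset.single_le_sum (fun i _ => Nat.zero_le _) (Finset.mem_univ j)
          rw [sum_occ] at h1
          omega
        simp only [hzero, if_false, urnMean, mul_zero, Finset.sum_const_zero]
        positivity

/-- Hoeffding's lemma for a random variable with two values. -/
theorem two_point_hoeffding {p : ℝ} (hp0 : 0 ≤ p) (hp1 : p ≤ 1) (a : ℝ) :
    p * Real.exp (-(a * (1 - p))) + (1 - p) * Real.exp (a * p) ≤ Real.exp (a ^ 2 / 8) := by
  set μ : Measure ℝ := ENNReal.ofReal p • Measure.dirac 0 + ENNReal.ofReal (1 - p) • Measure.dirac 1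
    with hμ
  have hprob : IsProbabilityMeasure μ := ⟨by
    rw [hμ, Measure.add_apply, Measure.smul_apply, Measure.smul_apply, measure_univ, measure_univ,
      smul_eq_mul, smul_eq_mul, mul_one, mul_one, ← ENNReal.ofReal_add hp0 (by linarith)]
    simp⟩
  have hint : ∀ f : ℝ → ℝ, ∫ x, f x ∂μ = p * f 0 + (1 - p) * f 1 := fun f => by
    rw [hμ, integral_add_measure, integral_smul_measure, integral_smul_measure, integral_dirac,
      integral_dirac, ENNReal.toReal_ofReal hp0, ENNReal.toReal_ofReal (by linarith)]
    · rfl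
    · exact (integrable_dirac (by simp)).smul_measure ENNReal.ofReal_ne_top
    · exact (integrable_dirac (by simp)).smul_measure ENNReal.ofReal_ne_top
  have hb : ∀ᵐ x ∂μ, id x ∈ Set.Icc (0 : ℝ) 1 := by
    rw [hμ, ae_add_measure_iff]
    constructor
    · exact Measure.ae_smul_measure (by
        rw [ae_dirac_iff (by exact measurableSet_Icc)]; simp) _
    · exact Measure.ae_smul_measure (by
        rw [ae_dirac_iff (by exact measurableSet_Icc)]; simp) _
  have h := (ProbabilityTheory.hasSubgaussianMGF_of_mem_Icc (μ := μ) aemeasurable_id hb).mgf_le a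
  rw [ProbabilityTheory.mgf, hint, hint] at h
  simp only [id] at h
  refine le_trans (le_of_eq ?_) (h.trans (le_of_eq ?_))
  · congr 2
    · congr 1; ring
    · congr 1; ring
  · congr 1
    push_cast
    norm_num
    ring

/-- The number of ports without bosons. -/
def emptyPorts {K M : ℕ} (l : Fin K → Fin M) : ℕ := (Finset.univ.filter fun j => occ l j = 0).card

theorem emptyPorts_snoc {K M : ℕ} (l : Fin K → Fin M) (j : Fin M) :
    (emptyPorts (Fin.snoc (α := fun _ => Fin M) l j) : ℝ) =
      emptyPorts l - if occ l j = 0 then 1 else 0 := by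
  have h : ∀ {L : ℕ} (l' : Fin L → Fin M),
      (emptyPorts l' : ℝ) = ∑ i, if occ l' i = 0 then (1 : ℝ) else 0 := fun l' => by
    simp [emptyPorts]
  rw [h, h, ← Finset.add_sum_erase _ _ (Finset.mem_univ j),
    ← Finset.add_sum_erase Finset.univ (fun i => if occ l i = 0 then (1 : ℝ) else 0)
      (Finset.mem_univ j), add_sub_cancel_left]
  rw [occ_snoc, if_pos rfl, if_neg (by omega), zero_add]
  refine Finset.sum_congr rfl fun i hi => ?_
  rw [occ_snoc, if_neg (Finset.mem_erase.1 hi).1, add_zero]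

/-- The number of empty ports after `K` draws, multiplied by `M + K - 1`, is a martingale; its
increments take two values at distance `M + K`. -/
theorem urnMean_exp_emptyPorts {M : ℕ} [NeZero M] (K : ℕ) (θ : ℝ) :
    urnMean K (fun l : Fin K → Fin M =>
      Real.exp (θ * (emptyPorts l * ((M : ℝ) + K - 1) - M * (M - 1)))) ≤
      Real.exp (θ ^ 2 * (∑ i ∈ Finset.range K, ((M : ℝ) + i) ^ 2) / 8) := by
  induction K with
  | zero => simp [urnMean, urnProb, emptyPorts, occ]
  | succ K ih =>
    have hM : (0 : ℝ) < M := by exact_mod_cast NeZero.pos M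
    have hMK : (0 : ℝ) < M + K := by positivity
    have hstep : ∀ l : Fin K → Fin M, ∑ j, ((occ l j : ℝ) + 1) / (M + K) *
        Real.exp (θ * (emptyPorts (Fin.snoc (α := fun _ => Fin M) l j) *
          ((M : ℝ) + (K + 1 : ℕ) - 1) - M * (M - 1))) ≤
        Real.exp ((θ * (M + K)) ^ 2 / 8) *
          Real.exp (θ * (emptyPorts l * ((M : ℝ) + K - 1) - M * (M - 1))) := by
      intro l
      set e : ℝ := (emptyPorts l : ℝ) with he
      set p : ℝ := e / (M + K) with hp
      have hp0 : 0 ≤ p := by positivity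
      have hp1 : p ≤ 1 := by
        rw [hp, div_le_one hMK]
        have : emptyPorts l ≤ M := (Finset.card_le_univ _).trans (by simp)
        have h2 : e ≤ M := by rw [he]; exact_mod_cast this
        have h3 : (0 : ℝ) ≤ K := Nat.cast_nonneg K
        linarith
      have hpe : p * (M + K) = e := div_mul_cancel₀ _ hMK.ne'
      have hempty : ∑ j ∈ Finset.univ.filter (fun j => occ l j = 0),
          ((occ l j : ℝ) + 1) / (M + K) = p := by
        rw [Finset.sum_congr rfl fun j hj => by rw [(Finset.mem_filter.1 hj).2], Finset.sum_const,
          nsmul_eq_mul, hp, he, emptyPorts]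
        push_cast
        ring
      have hfull : ∑ j ∈ Finset.univ.filter (fun j => ¬occ l j = 0),
          ((occ l j : ℝ) + 1) / (M + K) = 1 - p := by
        have := sum_occ_add_one_div l
        rw [← Finset.sum_filter_add_sum_filter_not Finset.univ (fun j => occ l j = 0), hempty] at this
        linarith
      rw [← Finset.sum_filter_add_sum_filter_not Finset.univ (fun j => occ l j = 0)]
      rw [Finset.sum_congr (s₂ := Finset.univ.filter fun j => occ l j = 0) rfl fun j hj => by
        rw [emptyPorts_snoc, if_pos (Finset.mem_filter.1 hj).2],
        Finset.sum_congr (s₂ := Finset.univ.filter fun j => ¬occ l j = 0) rfl fun j hj => by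
        rw [emptyPorts_snoc, if_neg (Finset.mem_filter.1 hj).2]]
      rw [← Finset.sum_mul, ← Finset.sum_mul, hempty, hfull, ← he]
      have h1 : θ * ((e - 1) * ((M : ℝ) + (K + 1 : ℕ) - 1) - M * (M - 1)) =
          -((θ * (M + K)) * (1 - p)) + θ * (e * ((M : ℝ) + K - 1) - M * (M - 1)) := by
        push_cast
        linear_combination (-θ) * hpe
      have h2 : θ * ((e - 0) * ((M : ℝ) + (K + 1 : ℕ) - 1) - M * (M - 1)) =
          (θ * (M + K)) * p + θ * (e * ((M : ℝ) + K - 1) - M * (M - 1)) := by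
        push_cast
        linear_combination (-θ) * hpe
      rw [h1, h2, Real.exp_add, Real.exp_add, ← mul_assoc, ← mul_assoc, ← add_mul]
      exact mul_le_mul_of_nonneg_right (two_point_hoeffding hp0 hp1 _) (Real.exp_pos _).le
    rw [urnMean_succ]
    refine (urnMean_mono hstep).trans ?_
    rw [urnMean_const_mul]
    refine (mul_le_mul_of_nonneg_left ih (Real.exp_pos _).le).trans (le_of_eq ?_)
    rw [← Real.exp_add, Finset.sum_range_succ]
    congr 1
    ring

/-- Hoeffding's inequality for the number of empty ports, in both directions (`σ = 1` and
`σ = -1`). -/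
theorem urnMean_emptyPorts_tail {M N : ℕ} [NeZero M] (hN : 1 ≤ N) (hM : 2 ≤ M) {σ : ℝ}
    (hσ : σ ^ 2 = 1) {t : ℝ} (ht : 0 ≤ t) :
    urnMean N (fun l : Fin N → Fin M =>
      if t ≤ σ * (emptyPorts l - M * (M - 1) / ((M : ℝ) + N - 1)) then (1 : ℝ) else 0) ≤
      Real.exp (-(2 * t ^ 2 / N)) := by
  have hN' : (1 : ℝ) ≤ N := by exact_mod_cast hN
  have hM' : (2 : ℝ) ≤ M := by exact_mod_cast hM
  set D : ℝ := (M : ℝ) + N - 1 with hD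
  have hD0 : 0 < D := by rw [hD]; linarith
  set θ : ℝ := 4 * t / (N * D) with hθ
  have hθ0 : 0 ≤ θ := by positivity
  have hV : ∑ i ∈ Finset.range N, ((M : ℝ) + i) ^ 2 ≤ N * D ^ 2 := by
    calc ∑ i ∈ Finset.range N, ((M : ℝ) + i) ^ 2 ≤ ∑ _i ∈ Finset.range N, D ^ 2 := by
          refine Finset.sum_le_sum fun i hi => ?_
          have hi' : (i : ℝ) + 1 ≤ N := by exact_mod_cast Finset.mem_range.1 hi
          have : (M : ℝ) + i ≤ D := by rw [hD]; linarith
          gcongr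
      _ = _ := by simp
  have hmgf := urnMean_exp_emptyPorts (M := M) N (σ * θ)
  have hpt : ∀ l : Fin N → Fin M,
      (if t ≤ σ * (emptyPorts l - M * (M - 1) / D) then (1 : ℝ) else 0) ≤
      Real.exp (-(θ * (t * D))) *
        Real.exp (σ * θ * (emptyPorts l * ((M : ℝ) + N - 1) - M * (M - 1))) := by
    intro l
    rw [← Real.exp_add]
    split_ifs with h
    · rw [Real.one_le_exp_iff, ← hD]
      have h1 : t * D ≤ σ * (emptyPorts l - M * (M - 1) / D) * D :=
        mul_le_mul_of_nonneg_right h hD0.le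
      have h2 : σ * (emptyPorts l - M * (M - 1) / D) * D = σ * (emptyPorts l * D - M * (M - 1)) := by
        field_simp
      rw [h2] at h1
      have := mul_le_mul_of_nonneg_left h1 hθ0
      linarith
    · exact (Real.exp_pos _).le
  refine (urnMean_mono hpt).trans ?_
  rw [urnMean_const_mul]
  refine (mul_le_mul_of_nonneg_left hmgf (Real.exp_pos _).le).trans ?_
  rw [← Real.exp_add, Real.exp_le_exp, mul_pow, hσ, one_mul]
  have h1 : θ ^ 2 * (∑ i ∈ Finset.range N, ((M : ℝ) + i) ^ 2) / 8 ≤ θ ^ 2 * (N * D ^ 2) / 8 := by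
    gcongr
  have h2 : -(θ * (t * D)) + θ ^ 2 * (N * D ^ 2) / 8 = -(2 * t ^ 2 / N) := by
    rw [hθ]
    field_simp
    ring
  linarith

/-! ### Bounds for the operation count -/

theorem glynnCost_le {M k : ℕ} (m : Fin M → ℕ) (js : List (Fin M)) (hjs : ∀ j ∈ js, 0 < m j) :
    glynnCost k m js + (6 + 6 * k) ≤ (js.map fun j => m j + 1).prod * (9 * k + 6) := by
  induction js with
  | nil => simp only [glynnCost, List.map_nil, List.prod_nil]; omega
  | cons j js ih =>
    have h1 := ih fun i hi => hjs i (List.mem_cons_of_mem _ hi)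
    have h2 := hjs j List.mem_cons_self
    simp only [glynnCost, List.map_cons, List.prod_cons]
    calc (m j + 1) * (3 + 3 * k + glynnCost k m js) + (6 + 6 * k)
        ≤ (m j + 1) * (3 + 3 * k + glynnCost k m js) + (m j + 1) * (3 + 3 * k) := by
          have : 2 * (3 + 3 * k) ≤ (m j + 1) * (3 + 3 * k) := Nat.mul_le_mul_right _ (by omega)
          omega
      _ = (m j + 1) * (glynnCost k m js + (6 + 6 * k)) := by ring
      _ ≤ (m j + 1) * ((js.map fun j => m j + 1).prod * (9 * k + 6)) := Nat.mul_le_mul_left _ h1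
      _ = _ := by ring

theorem le_glynnCost {M k : ℕ} (m : Fin M → ℕ) (js : List (Fin M)) :
    (js.map fun j => m j + 1).prod * (3 * k) ≤ glynnCost k m js := by
  induction js with
  | nil => simp [glynnCost]
  | cons j js ih =>
    simp only [glynnCost, List.map_cons, List.prod_cons, mul_assoc]
    exact Nat.mul_le_mul_left _ (ih.trans (Nat.le_add_left _ _))

theorem prod_occupied_erase {K M : ℕ} (l : Fin K → Fin M) (j₀ : Fin M) :
    (((occupied l).erase j₀).map fun j => occ l j + 1).prod =
      ∏ j ∈ Finset.univ.erase j₀, (occ l j + 1) := by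
  rw [← List.prod_toFinset _ ((nodup_occupied l).erase _)]
  refine Finset.prod_subset (fun j hj => ?_) fun j hj hj' => ?_
  · rw [List.mem_toFinset, (nodup_occupied l).mem_erase_iff] at hj
    exact Finset.mem_erase.2 ⟨hj.1, Finset.mem_univ _⟩
  · rw [List.mem_toFinset, (nodup_occupied l).mem_erase_iff, mem_occupied] at hj'
    have := (Finset.mem_erase.1 hj).1
    have h0 : occ l j = 0 := by
      by_contra h
      exact hj' ⟨this, Nat.pos_of_ne_zero h⟩
    rw [h0, zero_add]

/-- The number of operations for the permanents is of order `K + 1` times the number of terms in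
the sum over the auxiliary variables. -/
theorem exists_minorsCost {K M : ℕ} (l : Fin (K + 1) → Fin M) :
    ∃ j₀, 3 * (K + 2) * ∏ j ∈ Finset.univ.erase j₀, (occ l j + 1) ≤ minorsCost l ∧
      minorsCost l ≤ 15 * (K + 2) * ∏ j ∈ Finset.univ.erase j₀, (occ l j + 1) := by
  rw [minorsCost]
  cases h : (occupied l).argmin (occ l) with
  | none => exact absurd (argmin_occupied_eq_none h) (Nat.succ_ne_zero K)
  | some j₀ =>
    refine ⟨j₀, ?_, ?_⟩
    · have := le_glynnCost (k := K + 1 + 1) (occ l) ((occupied l).erase j₀)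
      rw [prod_occupied_erase] at this
      refine le_trans (le_of_eq ?_) this
      ring
    · have := glynnCost_le (k := K + 1 + 1) (occ l) ((occupied l).erase j₀) fun j hj =>
        mem_occupied.1 (List.mem_of_mem_erase hj)
      rw [prod_occupied_erase] at this
      have h2 : (∏ j ∈ Finset.univ.erase j₀, (occ l j + 1)) * (9 * (K + 1 + 1) + 6) ≤
          (∏ j ∈ Finset.univ.erase j₀, (occ l j + 1)) * (15 * (K + 2)) :=
        Nat.mul_le_mul_left _ (by omega)
      rw [mul_comm (15 * (K + 2))]
      exact (Nat.le_add_right _ _).trans (this.trans h2)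

/-- The number of terms in a Glynn sum over the variables of all ports. -/
def occProd {K M : ℕ} (l : Fin K → Fin M) : ℕ := ∏ j, (occ l j + 1)

theorem minorsCost_le {K M : ℕ} (l : Fin K → Fin M) :
    minorsCost l ≤ 15 * (K + 1) * occProd l := by
  cases K with
  | zero =>
    rw [minorsCost]
    cases h : (occupied l).argmin (occ l) with
    | none => exact Nat.zero_le _
    | some j₀ =>
      have := mem_occupied.1 (List.argmin_mem h)
      simp [occ] at this
  | succ K =>
    obtain ⟨j₀, -, h⟩ := exists_minorsCost l
    refine h.trans (Nat.mul_le_mul_left _ ?_)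
    rw [occProd, ← Finset.mul_prod_erase _ _ (Finset.mem_univ j₀)]
    exact Nat.le_mul_of_pos_left _ (Nat.succ_pos _)

/-- The sum of `occProd` over the proper initial segments of `l`. -/
def prefixSum {M : ℕ} : (K : ℕ) → (Fin K → Fin M) → ℕ
  | 0, _ => 0
  | K + 1, l => prefixSum K (Fin.init l) + occProd (Fin.init l)

theorem runCost_le {M : ℕ} (K : ℕ) (l : Fin K → Fin M) :
    runCost K l ≤ 15 * K * prefixSum K l + M * (K ^ 2 + 5 * K) := by
  induction K with
  | zero => simp [runCost]
  | succ K ih =>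
    rw [runCost, prefixSum]
    have h1 := ih (Fin.init l)
    have h2 := minorsCost_le (Fin.init l)
    have h3 : 15 * K * prefixSum K (Fin.init l) ≤ 15 * (K + 1) * prefixSum K (Fin.init l) :=
      Nat.mul_le_mul_right _ (by omega)
    calc _ ≤ (15 * (K + 1) * prefixSum K (Fin.init l) + M * (K ^ 2 + 5 * K)) +
          15 * (K + 1) * occProd (Fin.init l) + M * (2 * K + 6) := by omega
      _ = _ := by ring

theorem le_runCost {M : ℕ} (K : ℕ) (l : Fin K → Fin M) : M * (K ^ 2 + 5 * K) ≤ runCost K l := by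
  induction K with
  | zero => simp
  | succ K ih =>
    rw [runCost]
    calc M * ((K + 1) ^ 2 + 5 * (K + 1)) = M * (K ^ 2 + 5 * K) + M * (2 * K + 6) := by ring
      _ ≤ _ := by have := ih (Fin.init l); omega

theorem minorsCost_le_runCost {M : ℕ} (K : ℕ) (l : Fin (K + 1) → Fin M) :
    M * (K + 1) ^ 2 + minorsCost (Fin.init l) ≤ runCost (K + 1) l := by
  rw [runCost]
  have := le_runCost K (Fin.init l)
  calc M * (K + 1) ^ 2 + minorsCost (Fin.init l)
      ≤ M * (K ^ 2 + 5 * K) + minorsCost (Fin.init l) + M * (2 * K + 6) := by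
        have : M * (K ^ 2 + 5 * K) + M * (2 * K + 6) = M * (K + 1) ^ 2 + M * (5 * K + 5) := by ring
        omega
    _ ≤ _ := by omega

theorem occProd_snoc {K M : ℕ} (l : Fin K → Fin M) (j : Fin M) :
    occProd (Fin.snoc (α := fun _ => Fin M) l j) * (occ l j + 1) = occProd l * (occ l j + 2) := by
  rw [occProd, occProd, ← Finset.mul_prod_erase _ _ (Finset.mem_univ j),
    ← Finset.mul_prod_erase _ (fun i => occ l i + 1) (Finset.mem_univ j), occ_snoc, if_pos rfl,
    Finset.prod_congr rfl fun i hi => by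
      rw [occ_snoc, if_neg (Finset.mem_erase.1 hi).1, add_zero]]
  ring

theorem occ_le_maxBunch {K M : ℕ} (l : Fin K → Fin M) (j : Fin M) : occ l j ≤ maxBunch l :=
  Finset.le_sup (f := occ l) (Finset.mem_univ j)

/-- Every further boson multiplies `occProd` by at least `(m + 1) / m`, where `m` is the maximal
bunching, so that the sum over the initial segments is dominated by a geometric series. -/
theorem prefixSum_le_mul {M : ℕ} (m : ℕ) (K : ℕ) (l : Fin K → Fin M) (hm : ∀ j, occ l j ≤ m) :
    prefixSum K l ≤ m * occProd l := by
  induction K with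
  | zero => simp [prefixSum]
  | succ K ih =>
    obtain ⟨l, j, rfl⟩ : ∃ (l' : Fin K → Fin M) (j : Fin M),
        l = Fin.snoc (α := fun _ => Fin M) l' j := ⟨Fin.init l, l (Fin.last K), by simp⟩
    rw [prefixSum, Fin.init_snoc]
    have hj := hm j
    rw [occ_snoc, if_pos rfl] at hj
    have h1 := ih l fun i => by
      have := hm i
      rw [occ_snoc] at this
      omega
    have h2 := occProd_snoc l j
    set P := occProd l
    set Q := occProd (Fin.snoc (α := fun _ => Fin M) l j)
    set c := occ l j
    have h3 : (m + 1) * P ≤ m * Q := by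
      have h4 : (c + 1) * ((m + 1) * P) ≤ (c + 1) * (m * Q) := by
        calc (c + 1) * ((m + 1) * P) ≤ m * (P * (c + 2)) := by
              have : (c + 1) * (m + 1) ≤ m * (c + 2) := by nlinarith
              calc (c + 1) * ((m + 1) * P) = ((c + 1) * (m + 1)) * P := by ring
                _ ≤ (m * (c + 2)) * P := Nat.mul_le_mul_right _ this
                _ = _ := by ring
          _ = (c + 1) * (m * Q) := by rw [← h2]; ring
      exact Nat.le_of_mul_le_mul_left h4 (Nat.succ_pos c)
    calc _ ≤ m * P + P := by omega
      _ = (m + 1) * P := by ring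
      _ ≤ _ := h3

theorem prefixSum_le_maxBunch_mul {K M : ℕ} (l : Fin K → Fin M) :
    prefixSum K l ≤ maxBunch l * occProd l :=
  prefixSum_le_mul _ K l (occ_le_maxBunch l)

theorem occProd_le_two_pow {K M : ℕ} (l : Fin K → Fin M) : occProd l ≤ 2 ^ K := by
  calc occProd l ≤ ∏ j, 2 ^ occ l j := Finset.prod_le_prod' fun j _ => Nat.lt_two_pow_self
    _ = 2 ^ K := by rw [Finset.prod_pow_eq_pow_sum, sum_occ]

theorem prefixSum_le_two_pow {M : ℕ} (K : ℕ) (l : Fin K → Fin M) : prefixSum K l ≤ 2 ^ K := by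
  induction K with
  | zero => simp [prefixSum]
  | succ K ih =>
    rw [prefixSum, pow_succ]
    have := ih (Fin.init l)
    have := occProd_le_two_pow (Fin.init l)
    omega

/-- The number of occupied ports. -/
def occPorts {K M : ℕ} (l : Fin K → Fin M) : ℕ := (Finset.univ.filter fun j => occ l j ≠ 0).card

theorem occPorts_add_emptyPorts {K M : ℕ} (l : Fin K → Fin M) :
    occPorts l + emptyPorts l = M := by
  rw [occPorts, emptyPorts, add_comm,
    Finset.card_filter_add_card_filter_not fun j => occ l j = 0, Finset.card_univ,
    Fintype.card_fin]

theorem occPorts_pos {K M : ℕ} (l : Fin (K + 1) → Fin M) : 0 < occPorts l := by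
  have h : (Finset.univ.filter fun k => l k = l 0).card ≠ 0 :=
    (Finset.card_pos.2 ⟨0, by simp⟩).ne'
  exact Finset.card_pos.2 ⟨l 0, Finset.mem_filter.2 ⟨Finset.mem_univ _, h⟩⟩

theorem occPorts_le {K M : ℕ} (l : Fin K → Fin M) : occPorts l ≤ K := by
  have h : occPorts l ≤ ∑ j, occ l j := by
    rw [occPorts, Finset.card_eq_sum_ones, Finset.sum_filter]
    refine Finset.sum_le_sum fun j _ => ?_
    split_ifs with h
    · omega
    · omega
  rwa [sum_occ] at h

/-- The inequality of the arithmetic and the geometric mean for the occupied ports. -/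
theorem occProd_le_rpow {K M : ℕ} (l : Fin (K + 1) → Fin M) :
    (occProd l : ℝ) ≤ (1 + ((K + 1 : ℕ) : ℝ) / occPorts l) ^ (occPorts l : ℝ) := by
  set N : ℝ := ((K + 1 : ℕ) : ℝ) with hN
  set s : ℝ := (occPorts l : ℝ) with hs
  have hs0 : 0 < s := by rw [hs]; exact_mod_cast occPorts_pos l
  have hN0 : 0 ≤ N := Nat.cast_nonneg _
  set a : ℝ := 1 + N / s with ha
  have ha0 : 0 < a := by positivity
  have hfac : ∀ j, ((occ l j + 1 : ℕ) : ℝ) ≤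
      if occ l j ≠ 0 then a * Real.exp (((occ l j + 1 : ℕ) : ℝ) / a - 1) else 1 := by
    intro j
    split_ifs with h
    · have h1 := Real.add_one_le_exp (((occ l j + 1 : ℕ) : ℝ) / a - 1)
      rw [sub_add_cancel, div_le_iff₀ ha0] at h1
      linarith
    · have : occ l j = 0 := by omega
      simp [this]
  have hsum : ∑ j ∈ Finset.univ.filter (fun j => occ l j ≠ 0),
      (((occ l j + 1 : ℕ) : ℝ) / a - 1) = 0 := by
    have h1 : ∑ j ∈ Finset.univ.filter (fun j => occ l j ≠ 0), (occ l j : ℝ) = N := by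
      have := congrArg (Nat.cast (R := ℝ)) (sum_occ l)
      push_cast at this
      rw [hN, Finset.sum_filter_of_ne fun j _ hj => by exact_mod_cast hj, this]
      push_cast
      ring
    push_cast
    rw [Finset.sum_sub_distrib, ← Finset.sum_div, Finset.sum_add_distrib, h1]
    simp only [Finset.sum_const, nsmul_eq_mul, mul_one]
    rw [show ((Finset.univ.filter fun j => occ l j ≠ 0).card : ℝ) = s from rfl, ha]
    field_simp
    ring
  calc (occProd l : ℝ) = ∏ j, ((occ l j + 1 : ℕ) : ℝ) := by rw [occProd]; push_cast; rfl
    _ ≤ ∏ j, if occ l j ≠ 0 then a * Real.exp (((occ l j + 1 : ℕ) : ℝ) / a - 1) else 1 :=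
      Finset.prod_le_prod (fun _ _ => Nat.cast_nonneg _) fun j _ => hfac j
    _ = a ^ occPorts l := by
      rw [← Finset.prod_filter, Finset.prod_mul_distrib, Finset.prod_const, ← Real.exp_sum, hsum,
        Real.exp_zero, mul_one]
      rfl
    _ = _ := (Real.rpow_natCast _ _).symm

theorem two_pow_le_prod_erase {K M : ℕ} (l : Fin K → Fin M) (j₀ : Fin M) :
    2 ^ occPorts l ≤ 2 * ∏ j ∈ Finset.univ.erase j₀, (occ l j + 1) := by
  have h : ∀ j, (if occ l j ≠ 0 then 2 else 1) ≤ occ l j + 1 := fun j => by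
    split_ifs with h
    · omega
    · omega
  calc 2 ^ occPorts l = ∏ j, if occ l j ≠ 0 then 2 else 1 := by
        rw [← Finset.prod_filter, Finset.prod_const]; rfl
    _ = (if occ l j₀ ≠ 0 then 2 else 1) *
        ∏ j ∈ Finset.univ.erase j₀, (if occ l j ≠ 0 then 2 else 1) :=
      (Finset.mul_prod_erase _ _ (Finset.mem_univ j₀)).symm
    _ ≤ _ := Nat.mul_le_mul (by split_ifs <;> omega) (Finset.prod_le_prod' fun j _ => h j)

/-- A quadratic lower bound for the binary logarithm of `m + 1`; its mean over the output
configurations is determined by two-boson probabilities. -/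
theorem two_rpow_quadratic_le (m : ℕ) :
    (2 : ℝ) ^ ((m : ℝ) - m * (m - 1) / 4) ≤ m + 1 := by
  have h32 : (2 : ℝ) ^ (3 / 2 : ℝ) ≤ 3 := by
    have h : ((2 : ℝ) ^ (3 / 2 : ℝ)) ^ 2 = 8 := by
      rw [← Real.rpow_natCast, ← Real.rpow_mul (by norm_num)]
      norm_num
    nlinarith [Real.rpow_pos_of_pos (show (0 : ℝ) < 2 by norm_num) (3 / 2)]
  rcases Nat.lt_or_ge m 4 with h | h
  · interval_cases m
    · norm_num
    · norm_num
    · norm_num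
      exact h32
    · have : ((3 : ℕ) : ℝ) - (3 : ℕ) * ((3 : ℕ) - 1) / 4 = 3 / 2 := by norm_num
      rw [this]
      norm_num
      linarith
  · have hm : (4 : ℝ) ≤ m := by exact_mod_cast h
    have h1 : (m : ℝ) - m * (m - 1) / 4 ≤ 1 := by nlinarith
    calc (2 : ℝ) ^ ((m : ℝ) - m * (m - 1) / 4) ≤ 2 ^ (1 : ℝ) :=
          Real.rpow_le_rpow_of_exponent_le (by norm_num) h1
      _ ≤ m + 1 := by rw [Real.rpow_one]; linarith

theorem quadratic_le (m : ℕ) : (m : ℝ) - m * (m - 1) / 4 ≤ 3 / 2 := by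
  rcases le_or_gt m 2 with h | h
  · interval_cases m <;> norm_num
  · have : (3 : ℝ) ≤ m := by exact_mod_cast h
    nlinarith

/-- The quadratic lower bound for the binary logarithm of `occProd`. -/
def logOcc {K M : ℕ} (l : Fin K → Fin M) : ℝ :=
  ∑ j, ((occ l j : ℝ) - occ l j * (occ l j - 1) / 4)

theorem two_rpow_logOcc_le {K M : ℕ} (l : Fin K → Fin M) (j₀ : Fin M) :
    (2 : ℝ) ^ (logOcc l - 3 / 2) ≤ ((∏ j ∈ Finset.univ.erase j₀, (occ l j + 1) : ℕ) : ℝ) := by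
  have h1 : logOcc l - 3 / 2 ≤
      ∑ j ∈ Finset.univ.erase j₀, ((occ l j : ℝ) - occ l j * (occ l j - 1) / 4) := by
    rw [logOcc, ← Finset.add_sum_erase _ _ (Finset.mem_univ j₀)]
    have := quadratic_le (occ l j₀)
    linarith
  refine (Real.rpow_le_rpow_of_exponent_le (by norm_num) h1).trans ?_
  rw [Real.rpow_sum_of_pos (by norm_num)]
  push_cast
  exact Finset.prod_le_prod (fun _ _ => (Real.rpow_pos_of_pos (by norm_num) _).le)
    fun j _ => two_rpow_quadratic_le _

theorem logOcc_snoc {K M : ℕ} (l : Fin K → Fin M) (j : Fin M) :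
    logOcc (Fin.snoc (α := fun _ => Fin M) l j) ≤ logOcc l + 1 := by
  rw [logOcc, logOcc, ← Finset.add_sum_erase _ _ (Finset.mem_univ j),
    ← Finset.add_sum_erase Finset.univ (fun i => ((occ l i : ℝ) - occ l i * (occ l i - 1) / 4))
      (Finset.mem_univ j), occ_snoc, if_pos rfl, Finset.sum_congr rfl fun i hi => by
      rw [occ_snoc, if_neg (Finset.mem_erase.1 hi).1, add_zero]]
  push_cast
  have : (0 : ℝ) ≤ occ l j := Nat.cast_nonneg _
  nlinarith

theorem occPorts_snoc_le {K M : ℕ} (l : Fin K → Fin M) (j : Fin M) :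
    occPorts (Fin.snoc (α := fun _ => Fin M) l j) ≤ occPorts l + 1 := by
  refine (Finset.card_le_card (t := insert j (Finset.univ.filter fun i => occ l i ≠ 0))
    fun i hi => ?_).trans (Finset.card_insert_le _ _)
  simp only [Finset.mem_insert, Finset.mem_filter, Finset.mem_univ, true_and, occ_snoc] at hi ⊢
  by_cases h : i = j
  · exact Or.inl h
  · rw [if_neg h, add_zero] at hi
    exact Or.inr hi

theorem exists_eq_snoc {K M : ℕ} (l : Fin (K + 1) → Fin M) :
    l = Fin.snoc (α := fun _ => Fin M) (Fin.init l) (l (Fin.last K)) := by simp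

/-- The lower bounds for the number of operations in a run, by its last round. -/
theorem le_runCost_of_two_le {N M : ℕ} (hN : 2 ≤ N) (l : Fin N → Fin M) :
    (M : ℝ) * N ^ 2 + N * 2 ^ ((occPorts l : ℝ) - 2) ≤ runCost N l ∧
      (N : ℝ) * 2 ^ (logOcc l - 5 / 2) ≤ runCost N l := by
  obtain ⟨K, rfl⟩ : ∃ K, N = K + 2 := ⟨N - 2, by omega⟩
  obtain ⟨j₀, h1, -⟩ := exists_minorsCost (Fin.init l)
  have h2 := minorsCost_le_runCost (K + 1) l
  set P := ∏ j ∈ Finset.univ.erase j₀, (occ (Fin.init l) j + 1) with hP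
  have h3 : (M : ℝ) * ((K + 2 : ℕ) : ℝ) ^ 2 + 3 * ((K + 2 : ℕ) : ℝ) * P ≤ runCost (K + 2) l := by
    have : M * (K + 2) ^ 2 + 3 * (K + 2) * P ≤ runCost (K + 2) l :=
      (Nat.add_le_add_left h1 _).trans h2
    exact_mod_cast this
  have hN0 : (0 : ℝ) ≤ ((K + 2 : ℕ) : ℝ) := Nat.cast_nonneg _
  have hM0 : (0 : ℝ) ≤ M * ((K + 2 : ℕ) : ℝ) ^ 2 := by positivity
  have hP0 : (0 : ℝ) ≤ P := Nat.cast_nonneg _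
  constructor
  · have h4 : (2 : ℝ) ^ ((occPorts l : ℝ) - 2) ≤ P := by
      have h5 : 2 ^ occPorts l ≤ 2 * (2 * P) := by
        calc 2 ^ occPorts l ≤ 2 ^ (occPorts (Fin.init l) + 1) := by
              refine Nat.pow_le_pow_right (by norm_num) ?_
              conv_lhs => rw [exists_eq_snoc l]
              exact occPorts_snoc_le _ _
          _ = 2 * 2 ^ occPorts (Fin.init l) := by ring
          _ ≤ _ := Nat.mul_le_mul_left _ (two_pow_le_prod_erase _ j₀)
      have h6 : (2 : ℝ) ^ occPorts l ≤ 2 * (2 * P) := by exact_mod_cast h5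
      rw [Real.rpow_sub (by norm_num), Real.rpow_natCast]
      norm_num
      linarith
    have := mul_le_mul_of_nonneg_left h4 hN0
    nlinarith
  · have h4 : (2 : ℝ) ^ (logOcc l - 5 / 2) ≤ P := by
      refine le_trans (Real.rpow_le_rpow_of_exponent_le (by norm_num) ?_)
        (two_rpow_logOcc_le (Fin.init l) j₀)
      have := logOcc_snoc (Fin.init l) (l (Fin.last (K + 1)))
      rw [← exists_eq_snoc l] at this
      linarith
    have := mul_le_mul_of_nonneg_left h4 hN0
    nlinarith

/-! ### The mean number of terms in the urn -/

theorem urnMean_occProd {M : ℕ} [NeZero M] (K : ℕ) :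
    urnMean K (fun l : Fin K → Fin M => (occProd l : ℝ)) =
      ∏ i ∈ Finset.range K, ((2 * M + i : ℝ) / (M + i)) := by
  have hM : (0 : ℝ) < M := by exact_mod_cast NeZero.pos M
  induction K with
  | zero => simp [urnMean, urnProb, occ, occProd]
  | succ K ih =>
    rw [urnMean_succ, Finset.prod_range_succ, ← ih, mul_comm, ← urnMean_const_mul]
    congr 1
    funext l
    have h : ∀ j, ((occ l j : ℝ) + 1) / (M + K) * (occProd (Fin.snoc (α := fun _ => Fin M) l j) : ℝ)
        = (occProd l : ℝ) / (M + K) * ((occ l j + 1) + 1) := fun j => by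
      have := congrArg (Nat.cast (R := ℝ)) (occProd_snoc l j)
      push_cast at this
      rw [div_mul_eq_mul_div, mul_comm, this]
      ring
    simp only [h]
    rw [← Finset.mul_sum, Finset.sum_add_distrib, sum_occ_add_one]
    simp only [Finset.sum_const, Finset.card_univ, Fintype.card_fin, nsmul_eq_mul, mul_one]
    ring

theorem urnMean_comp_init {K M : ℕ} [NeZero M] (f : (Fin K → Fin M) → ℝ) :
    urnMean (K + 1) (fun l => f (Fin.init l)) = urnMean K f := by
  rw [urnMean_succ]
  simp only [Fin.init_snoc, ← Finset.sum_mul, sum_occ_add_one_div, one_mul]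

theorem urnMean_prefixSum_le {M : ℕ} [NeZero M] (K : ℕ) (hK : K ≤ M) :
    urnMean K (fun l : Fin K → Fin M => (prefixSum K l : ℝ)) ≤
      2 * ∏ i ∈ Finset.range K, ((2 * M + i : ℝ) / (M + i)) := by
  have hM : (0 : ℝ) < M := by exact_mod_cast NeZero.pos M
  induction K with
  | zero => simp [urnMean, prefixSum]
  | succ K ih =>
    simp only [prefixSum, Nat.cast_add]
    rw [urnMean_add, urnMean_comp_init fun l => (prefixSum K l : ℝ),
      urnMean_comp_init fun l => (occProd l : ℝ), urnMean_occProd, Finset.prod_range_succ]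
    have h1 := ih (by omega)
    set R := ∏ i ∈ Finset.range K, ((2 * M + i : ℝ) / (M + i)) with hR
    have hR0 : 0 ≤ R := Finset.prod_nonneg fun i _ => by positivity
    have hKM : (K : ℝ) ≤ M := by exact_mod_cast (show K ≤ M by omega)
    have h2 : (3 / 2 : ℝ) ≤ (2 * M + K) / (M + K) := by
      rw [le_div_iff₀ (by positivity)]
      linarith
    have := mul_le_mul_of_nonneg_left h2 hR0
    linarith

/-! ### Coincidences of two bosons -/

theorem sum_comp_occ {K M : ℕ} (l : Fin K → Fin M) (f : Fin M → ℝ) :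
    ∑ a, f (l a) = ∑ j, occ l j * f j := by
  rw [← Finset.sum_fiberwise Finset.univ l fun a => f (l a)]
  refine Finset.sum_congr rfl fun j _ => ?_
  rw [Finset.sum_congr rfl fun a ha => by rw [(Finset.mem_filter.1 ha).2]]
  simp [occ]

theorem sum_occ_mul_pred {K M : ℕ} (l : Fin K → Fin M) :
    ∑ j, (occ l j : ℝ) * (occ l j - 1) =
      ∑ a, ∑ b, if a = b then 0 else if l a = l b then (1 : ℝ) else 0 := by
  have h1 : ∀ a, ∑ b, (if l a = l b then (1 : ℝ) else 0) = occ l (l a) := fun a => by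
    simp [occ, eq_comm]
  have h2 : ∀ a, (∑ b, if a = b then 0 else if l a = l b then (1 : ℝ) else 0) =
      occ l (l a) - 1 := fun a => by
    rw [← h1, ← Finset.add_sum_erase _ _ (Finset.mem_univ a),
      ← Finset.add_sum_erase Finset.univ (fun b => if l a = l b then (1 : ℝ) else 0)
        (Finset.mem_univ a), if_pos rfl, if_pos rfl, zero_add, add_sub_cancel_left]
    exact Finset.sum_congr rfl fun b hb => if_neg (Ne.symm (Finset.mem_erase.1 hb).1)
  simp only [h2]
  exact (sum_comp_occ l fun j => (occ l j : ℝ) - 1).symm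

theorem sum_occ_real {K M : ℕ} (l : Fin K → Fin M) : ∑ j, (occ l j : ℝ) = K := by
  exact_mod_cast congrArg (Nat.cast (R := ℝ)) (sum_occ l)

theorem logOcc_eq {K M : ℕ} (l : Fin K → Fin M) :
    logOcc l = K - (∑ a, ∑ b, if a = b then 0 else if l a = l b then (1 : ℝ) else 0) / 4 := by
  rw [← sum_occ_mul_pred, logOcc, Finset.sum_sub_distrib, sum_occ_real, Finset.sum_div]

/-- The sum over pairs of different rows of the overlaps of their squared entries. -/
def rowOverlap {K M : ℕ} (B : Fin K → Fin M → ℂ) : ℝ :=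
  ∑ i, ∑ i', if i = i' then 0 else ∑ j, ‖B i j‖ ^ 2 * ‖B i' j‖ ^ 2

theorem sum_succAbove_pairs {n : ℕ} (w : Fin (n + 1) → Fin (n + 1) → ℝ) (hw : ∀ a, w a a = 0) :
    ∑ a : Fin (n + 1), ∑ x, ∑ y, w (a.succAbove x) (a.succAbove y) =
      ((n : ℝ) - 1) * ∑ i, ∑ i', w i i' := by
  have h : ∀ a : Fin (n + 1), ∑ x, ∑ y, w (a.succAbove x) (a.succAbove y) =
      ∑ i, ∑ i', w i i' - ∑ i', w a i' - ∑ i, w i a := fun a => by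
    have h1 : ∀ i, ∑ i', w i i' = w i a + ∑ y, w i (a.succAbove y) := fun i =>
      Fin.sum_univ_succAbove _ a
    rw [Fin.sum_univ_succAbove (fun i => ∑ i', w i i') a,
      Fin.sum_univ_succAbove (fun i => w i a) a, hw]
    simp only [h1 (a.succAbove _), Finset.sum_add_distrib]
    ring
  simp only [h, Finset.sum_sub_distrib]
  rw [Finset.sum_comm (f := fun a i => w i a)]
  simp only [Finset.sum_const, Finset.card_univ, Fintype.card_fin, nsmul_eq_mul]
  push_cast
  ring

theorem sum_rowOverlap_comp {n M : ℕ} (B : Fin (n + 1) → Fin M → ℂ) :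
    ∑ a : Fin (n + 1), rowOverlap (B ∘ a.succAbove) = ((n : ℝ) - 1) * rowOverlap B := by
  rw [rowOverlap, ← sum_succAbove_pairs _ fun a => if_pos rfl]
  simp only [rowOverlap, Function.comp_apply, Fin.succAbove_right_inj]

theorem sum_colPer_coincidence_zero_one {K M : ℕ} (B : Fin (K + 2) → Fin M → ℂ)
    (hB : OrthonormalRows B) :
    ∑ l : Fin (K + 2) → Fin M, ‖colPer B l‖ ^ 2 * (if l 0 = l 1 then 1 else 0) =
      2 * K.factorial * rowOverlap B := by
  induction K with
  | zero =>
    have hper : ∀ l : Fin 2 → Fin M,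
        colPer B l = B 0 (l 0) * B 1 (l 1) + B 1 (l 0) * B 0 (l 1) := fun l => by
      rw [colPer, ← (Equiv.Perm.decomposeFin).symm.sum_comp, Fintype.sum_prod_type]
      simp [Fin.sum_univ_two, Fin.prod_univ_two]
    change ∑ l : Fin 2 → Fin M, ‖colPer B l‖ ^ 2 * (if l 0 = l 1 then 1 else 0) = _
    rw [← (finTwoArrowEquiv (Fin M)).symm.sum_comp, Fintype.sum_prod_type]
    have h : ∀ x y : Fin M, ‖colPer B ((finTwoArrowEquiv (Fin M)).symm (x, y))‖ ^ 2 *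
        (if ((finTwoArrowEquiv (Fin M)).symm (x, y)) 0 =
          ((finTwoArrowEquiv (Fin M)).symm (x, y)) 1 then 1 else 0) =
        if x = y then 4 * (‖B 0 x‖ ^ 2 * ‖B 1 x‖ ^ 2) else 0 := fun x y => by
      by_cases hxy : x = y
      · subst hxy
        rw [hper]
        simp only [finTwoArrowEquiv_symm_apply, Matrix.cons_val_zero, Matrix.cons_val_one, if_true]
        rw [mul_comm (B 1 x), ← two_mul, norm_mul, norm_mul]
        norm_num
        ring
      · simp [hxy]
    simp only [h, Finset.sum_ite_eq, Finset.mem_univ, if_true]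
    have hov : rowOverlap B = 2 * ∑ j, ‖B 0 j‖ ^ 2 * ‖B 1 j‖ ^ 2 := by
      change (∑ i : Fin 2, ∑ i' : Fin 2, _) = _
      rw [Fin.sum_univ_two, Fin.sum_univ_two, Fin.sum_univ_two]
      simp only [if_true, zero_ne_one, one_ne_zero, if_false, zero_add, add_zero]
      simp only [mul_comm (‖B 1 _‖ ^ 2)]
      ring
    rw [hov, ← Finset.mul_sum]
    norm_num
    ring
  | succ K ih =>
    rw [sum_snoc]
    have h0 : ∀ (l : Fin (K + 2) → Fin M) (j : Fin M),
        (Fin.snoc (α := fun _ => Fin M) l j : Fin (K + 3) → Fin M) 0 = l 0 := fun l j =>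
      Fin.snoc_castSucc (α := fun _ => Fin M) j l 0
    have h1 : ∀ (l : Fin (K + 2) → Fin M) (j : Fin M),
        (Fin.snoc (α := fun _ => Fin M) l j : Fin (K + 3) → Fin M) 1 = l 1 := fun l j =>
      Fin.snoc_castSucc (α := fun _ => Fin M) j l 1
    simp only [h0, h1, ← Finset.sum_mul, hB.sum_colPer_snoc]
    simp only [Finset.sum_mul]
    rw [Finset.sum_comm]
    simp only [fun a : Fin (K + 3) => ih _ (hB.comp (Fin.succAbove_right_injective (p := a)))]
    rw [← Finset.mul_sum, sum_rowOverlap_comp, Nat.factorial_succ]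
    push_cast
    ring

theorem sum_colPer_coincidence {K M : ℕ} (B : Fin (K + 2) → Fin M → ℂ)
    (hB : OrthonormalRows B) {a b : Fin (K + 2)} (hab : a ≠ b) :
    ∑ l : Fin (K + 2) → Fin M, ‖colPer B l‖ ^ 2 * (if l a = l b then 1 else 0) =
      2 * K.factorial * rowOverlap B := by
  obtain ⟨σ, h0, h1⟩ : ∃ σ : Equiv.Perm (Fin (K + 2)), σ a = 0 ∧ σ b = 1 := by
    obtain ⟨σ, hσ⟩ := Equiv.Perm.exists_extending_pair ![a, b] ![(0 : Fin (K + 2)), 1]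
      (by intro i j; fin_cases i <;> fin_cases j <;> simp [hab, hab.symm])
      (by intro i j; fin_cases i <;> fin_cases j <;> simp)
    exact ⟨σ, hσ 0, hσ 1⟩
  rw [← sum_colPer_coincidence_zero_one B hB,
    ← Equiv.sum_comp (Equiv.arrowCongr σ.symm (Equiv.refl (Fin M)))]
  refine Finset.sum_congr rfl fun l _ => ?_
  have : (Equiv.arrowCongr σ.symm (Equiv.refl (Fin M))) l = l ∘ σ := by
    ext; simp
  rw [this, colPer_comp_cols, Function.comp_apply, Function.comp_apply, h0, h1]

/-- The squared norm of column `j` of `B`, the mean number of bosons in port `j`. -/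
def colSq {K M : ℕ} (B : Fin K → Fin M → ℂ) (j : Fin M) : ℝ := ∑ i, ‖B i j‖ ^ 2

theorem rowOverlap_le {K M : ℕ} (B : Fin K → Fin M → ℂ) : rowOverlap B ≤ ∑ j, colSq B j ^ 2 := by
  have h : ∑ j, colSq B j ^ 2 = ∑ i, ∑ i', ∑ j, ‖B i j‖ ^ 2 * ‖B i' j‖ ^ 2 := by
    simp only [colSq, sq (∑ i, _), Finset.sum_mul_sum]
    rw [Finset.sum_comm]
    exact Finset.sum_congr rfl fun i _ => Finset.sum_comm
  rw [h, rowOverlap]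
  refine Finset.sum_le_sum fun i _ => Finset.sum_le_sum fun i' _ => ?_
  split_ifs
  · positivity
  · exact le_rfl

/-- The mean of the quadratic lower bound over the output of the sampler. -/
theorem le_sum_seqProb_logOcc {N M : ℕ} (hN : 2 ≤ N) (B : Fin N → Fin M → ℂ)
    (hB : OrthonormalRows B) :
    N - (∑ j, colSq B j ^ 2) / 2 ≤ ∑ l, seqProb B l * logOcc l := by
  obtain ⟨K, rfl⟩ : ∃ K, N = K + 2 := ⟨N - 2, by omega⟩
  have hK : (K.factorial : ℝ) ≠ 0 := by exact_mod_cast Nat.factorial_ne_zero K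
  have hpair : ∀ a b : Fin (K + 2), ∑ l, seqProb B l * (if a = b then 0 else
      if l a = l b then (1 : ℝ) else 0) =
      if a = b then 0 else 2 * rowOverlap B / ((K + 1) * (K + 2)) := fun a b => by
    by_cases hab : a = b
    · simp [hab]
    · simp only [if_neg hab, seqProb, div_mul_eq_mul_div]
      rw [← Finset.sum_div, sum_colPer_coincidence B hB hab, Nat.factorial_succ, Nat.factorial_succ]
      push_cast
      field_simp
      ring
  have hcount : ∑ a : Fin (K + 2), ∑ b : Fin (K + 2),
      (if a = b then 0 else 2 * rowOverlap B / ((K + 1) * (K + 2))) = 2 * rowOverlap B := by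
    have : ∀ a : Fin (K + 2), ∑ b : Fin (K + 2),
        (if a = b then 0 else 2 * rowOverlap B / ((K + 1) * (K + 2))) =
        2 * rowOverlap B / (K + 2) := fun a => by
      rw [← Finset.add_sum_erase _ _ (Finset.mem_univ a), if_pos rfl, zero_add,
        Finset.sum_congr rfl fun b hb => if_neg (Ne.symm (Finset.mem_erase.1 hb).1)]
      simp only [Finset.sum_const, Finset.card_erase_of_mem (Finset.mem_univ a), Finset.card_univ,
        Fintype.card_fin, nsmul_eq_mul]
      push_cast [show K + 2 - 1 = K + 1 by omega]
      field_simp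
    simp only [this, Finset.sum_const, Finset.card_univ, Fintype.card_fin, nsmul_eq_mul]
    push_cast
    field_simp
  have hmain : ∑ l, seqProb B l * logOcc l = ((K + 2 : ℕ) : ℝ) - rowOverlap B / 2 := by
    simp only [logOcc_eq, mul_sub, Finset.sum_sub_distrib]
    rw [← Finset.sum_mul, sum_seqProb hB, one_mul]
    congr 1
    simp only [← mul_div_assoc, Finset.mul_sum]
    rw [← Finset.sum_div, Finset.sum_comm]
    simp only [fun a : Fin (K + 2) => Finset.sum_comm (s := Finset.univ) (t := Finset.univ)
      (f := fun (l : Fin (K + 2) → Fin M) b => seqProb B l * (if a = b then 0 else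
        if l a = l b then (1 : ℝ) else 0)), hpair]
    rw [hcount]
    ring
  rw [hmain]
  have := rowOverlap_le B
  linarith

/-- Jensen's inequality for `2 ^ x`. -/
theorem two_rpow_le_sum {ι : Type*} [Fintype ι] (p X : ι → ℝ) (hp : ∀ i, 0 ≤ p i)
    (hp1 : ∑ i, p i = 1) {a : ℝ} (ha : a ≤ ∑ i, p i * X i) :
    (2 : ℝ) ^ a ≤ ∑ i, p i * 2 ^ X i := by
  have hlog : 0 < Real.log 2 := Real.log_pos (by norm_num)
  have h2a : (0 : ℝ) < 2 ^ a := Real.rpow_pos_of_pos (by norm_num) a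
  have h : ∀ i, p i * (2 ^ a * (1 + (X i - a) * Real.log 2)) ≤ p i * 2 ^ X i := fun i => by
    refine mul_le_mul_of_nonneg_left ?_ (hp i)
    have h1 : (2 : ℝ) ^ X i = 2 ^ a * 2 ^ (X i - a) := by
      rw [← Real.rpow_add (by norm_num)]
      congr 1
      ring
    rw [h1]
    refine mul_le_mul_of_nonneg_left ?_ h2a.le
    rw [Real.rpow_def_of_pos (by norm_num)]
    have := Real.add_one_le_exp (Real.log 2 * (X i - a))
    linarith
  refine le_trans ?_ (Finset.sum_le_sum fun i _ => h i)
  have h3 : ∑ i, p i * (2 ^ a * (1 + (X i - a) * Real.log 2)) =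
      2 ^ a * (∑ i, p i) + 2 ^ a * Real.log 2 * (∑ i, p i * X i - a * ∑ i, p i) := by
    rw [Finset.mul_sum, Finset.mul_sum, ← Finset.sum_sub_distrib, Finset.mul_sum,
      ← Finset.sum_add_distrib]
    exact Finset.sum_congr rfl fun i _ => by ring
  rw [h3, hp1]
  have := mul_nonneg (mul_nonneg h2a.le hlog.le) (sub_nonneg.2 ha)
  nlinarith

theorem sum_colSq {K M : ℕ} {B : Fin K → Fin M → ℂ} (hB : OrthonormalRows B) :
    ∑ j, colSq B j = K := by
  simp only [colSq]
  rw [Finset.sum_comm]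
  have h : ∀ i, ∑ j, ‖B i j‖ ^ 2 = 1 := fun i => by
    have h1 := hB.sum_norm_sq (Pi.single i 1)
    simpa [Pi.single_apply, apply_ite] using h1
  simp [h]

/-- The deviation of the squared column norms from the density of bosons. -/
def colDeviation {K M : ℕ} (B : Fin K → Fin M → ℂ) : ℝ := ∑ j, (colSq B j - rho K M) ^ 2

theorem colDeviation_nonneg {K M : ℕ} (B : Fin K → Fin M → ℂ) : 0 ≤ colDeviation B :=
  Finset.sum_nonneg fun _ _ => sq_nonneg _

theorem sum_colSq_sq {K M : ℕ} [NeZero M] {B : Fin K → Fin M → ℂ} (hB : OrthonormalRows B) :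
    ∑ j, colSq B j ^ 2 = colDeviation B + rho K M * K := by
  have hM : (M : ℝ) ≠ 0 := by exact_mod_cast NeZero.ne M
  have h : ∀ j, (colSq B j - rho K M) ^ 2 =
      colSq B j ^ 2 - 2 * rho K M * colSq B j + rho K M ^ 2 := fun j => by ring
  rw [colDeviation]
  simp only [h, Finset.sum_add_distrib, Finset.sum_sub_distrib, ← Finset.mul_sum, sum_colSq hB]
  simp only [Finset.sum_const, Finset.card_univ, Fintype.card_fin, nsmul_eq_mul, rho]
  field_simp
  ring

theorem continuous_colSq {K M : ℕ} (R : Fin K → Fin M) (j : Fin M) :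
    Continuous fun U => colSq (rowsOf R U) j :=
  continuous_finsetSum _ fun _ _ => (continuous_entry _ _).norm.pow 2

theorem continuous_colDeviation {K M : ℕ} (R : Fin K → Fin M) :
    Continuous fun U => colDeviation (rowsOf R U) :=
  continuous_finsetSum _ fun _ _ => ((continuous_colSq R _).sub continuous_const).pow 2

theorem integral_colDeviation_le {N M : ℕ} [NeZero M] (hNM : N ≤ M) {R : Fin N → Fin M}
    (hR : Function.Injective R) : ∫ U, colDeviation (rowsOf R U) ∂haarU M ≤ 1 := by
  have hM : (0 : ℝ) < M := by exact_mod_cast NeZero.pos M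
  have h1 : ∀ U : Matrix.unitaryGroup (Fin M) ℂ, colDeviation (rowsOf R U) =
      (∑ j, ∑ i, ∑ i', ‖(U : Matrix (Fin M) (Fin M) ℂ) (R i) j‖ ^ 2 *
        ‖(U : Matrix (Fin M) (Fin M) ℂ) (R i') j‖ ^ 2) - rho N M * N := fun U => by
    rw [eq_sub_iff_add_eq, ← sum_colSq_sq (orthonormalRows_rowsOf hR U)]
    simp only [colSq, sq (∑ i, _), Finset.sum_mul_sum]
    rfl
  have hc : ∀ j i i', Integrable (fun U : Matrix.unitaryGroup (Fin M) ℂ =>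
      ‖(U : Matrix (Fin M) (Fin M) ℂ) (R i) j‖ ^ 2 *
        ‖(U : Matrix (Fin M) (Fin M) ℂ) (R i') j‖ ^ 2) (haarU M) := fun j i i' =>
    integrable_haarU (((continuous_entry _ _).norm.pow 2).mul ((continuous_entry _ _).norm.pow 2))
  simp only [h1]
  rw [integral_sub (integrable_finsetSum _ fun j _ => integrable_finsetSum _ fun i _ =>
      integrable_finsetSum _ fun i' _ => hc j i i') (integrable_const _),
    integral_finsetSum _ fun j _ => integrable_finsetSum _ fun i _ =>
      integrable_finsetSum _ fun i' _ => hc j i i']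
  simp only [integral_finsetSum _ fun i (_ : i ∈ Finset.univ) => integrable_finsetSum _
      fun i' (_ : i' ∈ Finset.univ) => hc _ i i',
    integral_finsetSum _ fun i' (_ : i' ∈ Finset.univ) => hc _ _ i', integral_entry_mul_entry,
    hR.eq_iff, ← Finset.sum_div, Finset.sum_add_distrib, Finset.sum_ite_eq, Finset.mem_univ,
    if_true, integral_const, probReal_univ, Finset.sum_const, Finset.card_univ, Fintype.card_fin,
    nsmul_eq_mul, smul_eq_mul, one_mul, mul_one]
  have hN : (N : ℝ) ≤ M := by exact_mod_cast hNM
  have hN0 : (0 : ℝ) ≤ N := Nat.cast_nonneg N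
  have e : (M : ℝ) * (N * N + N) / (M * (M + 1)) - rho N M * N =
      N * (M - N) / (M * (M + 1)) := by
    rw [rho]
    field_simp
    ring
  refine le_trans (le_of_eq ?_) (show N * (M - N) / (M * (M + 1) : ℝ) ≤ 1 from ?_)
  · rw [← e]; ring
  · rw [div_le_one (by positivity)]
    nlinarith

/-! ### Real inequalities -/

theorem log_two_sub_half_le {r : ℝ} (hr : 1 ≤ r) :
    Real.log 2 - 1 / 2 ≤ Real.log (1 + r) - r / (1 + r) := by
  have h1 : 0 < 1 + r := by linarith
  have h2 := Real.one_sub_inv_le_log_of_pos (show 0 < (1 + r) / 2 by positivity)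
  rw [Real.log_div h1.ne' two_ne_zero, inv_div] at h2
  have h3 : r / (1 + r) = 1 - 1 / (1 + r) := by field_simp; ring
  have h4 : 2 / (1 + r) = 2 * (1 / (1 + r)) := by ring
  have h5 : 1 / (1 + r) ≤ 1 / 2 := one_div_le_one_div_of_le (by norm_num) (by linarith)
  rw [h3]
  rw [h4] at h2
  linarith

/-- The function `s ↦ (1 + N / s) ^ s` is increasing, and grows at least exponentially with rate
`log 2 - 1 / 2` up to `s = N`: its logarithm lies below its tangent at `s₂`. -/
theorem rpow_mul_exp_le {N s₁ s₂ : ℝ} (h1 : 0 < s₁) (h12 : s₁ ≤ s₂) (h2 : s₂ ≤ N) :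
    (1 + N / s₁) ^ s₁ * Real.exp ((Real.log 2 - 1 / 2) * (s₂ - s₁)) ≤ (1 + N / s₂) ^ s₂ := by
  have hs2 : 0 < s₂ := h1.trans_le h12
  have hN : 0 < N := hs2.trans_le h2
  have ha : 0 < 1 + N / s₁ := by positivity
  have hb : 0 < 1 + N / s₂ := by positivity
  rw [Real.rpow_def_of_pos ha, Real.rpow_def_of_pos hb, ← Real.exp_add, Real.exp_le_exp]
  have hr : 1 ≤ N / s₂ := by rwa [one_le_div hs2]
  have h3 := log_two_sub_half_le hr
  have h4 := Real.log_le_sub_one_of_pos (show 0 < (1 + N / s₁) / (1 + N / s₂) by positivity)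
  rw [Real.log_div ha.ne' hb.ne'] at h4
  have h5 : s₁ * ((1 + N / s₁) / (1 + N / s₂) - 1) = (s₂ - s₁) * (N / s₂ / (1 + N / s₂)) := by
    field_simp
    ring
  have h6 := mul_le_mul_of_nonneg_left h4 h1.le
  rw [h5] at h6
  have h7 := mul_le_mul_of_nonneg_left h3 (sub_nonneg.2 h12)
  linarith

/-- The chord inequality for a convex function that vanishes at `0` and at `1`. -/
theorem log_chord_nonpos {x : ℝ} (hx0 : 0 ≤ x) (hx1 : x ≤ 1) :
    (1 + x) * Real.log 2 - (1 - x) * Real.log (2 + x) - (1 + x) * Real.log (1 + x) ≤ 0 := by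
  set H : ℝ → ℝ := fun x =>
    (1 + x) * Real.log 2 - (1 - x) * Real.log (2 + x) - (1 + x) * Real.log (1 + x) with hH
  have hd1 : ∀ x ∈ Set.Ioo (-1 : ℝ) 2, HasDerivAt H
      (Real.log 2 + Real.log (2 + x) - (1 - x) / (2 + x) - Real.log (1 + x) - 1) x := by
    intro x hx
    have h1 : (1 + x) ≠ 0 := by linarith [hx.1]
    have h2 : (2 + x) ≠ 0 := by linarith [hx.1]
    have e1 : HasDerivAt (fun x : ℝ => 1 + x) 1 x := (hasDerivAt_id x).const_add 1
    have e2 : HasDerivAt (fun x : ℝ => 2 + x) 1 x := (hasDerivAt_id x).const_add 2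
    have e3 : HasDerivAt (fun x : ℝ => 1 - x) (-1) x := (hasDerivAt_id x).const_sub 1
    have := ((e1.mul_const (Real.log 2)).sub (e3.mul (e2.log h2))).sub (e1.mul (e1.log h1))
    refine this.congr_deriv ?_
    field_simp
    ring
  have hd2 : ∀ x ∈ Set.Ioo (-1 : ℝ) 2, HasDerivAt
      (fun x => Real.log 2 + Real.log (2 + x) - (1 - x) / (2 + x) - Real.log (1 + x) - 1)
      ((1 + 2 * x) / ((2 + x) ^ 2 * (1 + x))) x := by
    intro x hx
    have h1 : (1 + x) ≠ 0 := by linarith [hx.1]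
    have h2 : (2 + x) ≠ 0 := by linarith [hx.1]
    have e1 : HasDerivAt (fun x : ℝ => 1 + x) 1 x := (hasDerivAt_id x).const_add 1
    have e2 : HasDerivAt (fun x : ℝ => 2 + x) 1 x := (hasDerivAt_id x).const_add 2
    have e3 : HasDerivAt (fun x : ℝ => 1 - x) (-1) x := (hasDerivAt_id x).const_sub 1
    have := ((((e2.log h2).const_add (Real.log 2)).sub (e3.div e2 h2)).sub (e1.log h1)).sub_const 1
    refine this.congr_deriv ?_
    field_simp
    ring
  have hsub : Set.Icc (0 : ℝ) 1 ⊆ Set.Ioo (-1 : ℝ) 2 := fun x hx =>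
    ⟨by linarith [hx.1], by linarith [hx.2]⟩
  have hconv : ConvexOn ℝ (Set.Icc 0 1) H := by
    refine convexOn_of_hasDerivWithinAt2_nonneg (convex_Icc 0 1)
      (f' := fun x => Real.log 2 + Real.log (2 + x) - (1 - x) / (2 + x) - Real.log (1 + x) - 1)
      (f'' := fun x => (1 + 2 * x) / ((2 + x) ^ 2 * (1 + x)))
      (fun x hx => (hd1 x (hsub hx)).continuousAt.continuousWithinAt)
      (fun x hx => (hd1 x (hsub (interior_subset hx))).hasDerivWithinAt)
      (fun x hx => (hd2 x (hsub (interior_subset hx))).hasDerivWithinAt) fun x hx => ?_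
    have := (interior_subset hx).1
    positivity
  have h := hconv.2 (Set.left_mem_Icc.2 zero_le_one) (Set.right_mem_Icc.2 zero_le_one)
    (sub_nonneg.2 hx1) hx0 (by ring)
  simp only [smul_eq_mul, mul_zero, mul_one, zero_add] at h
  have h0 : H 0 = 0 := by simp [hH]
  have h1 : H 1 = 0 := by
    simp only [hH]
    norm_num
  rw [h0, h1, mul_zero, mul_zero, add_zero] at h
  exact h

/-- The mean of `occProd` in the urn, estimated by pairing the factors `i` and `N - i`. -/
theorem prod_sq_le {M N : ℕ} (hN : 1 ≤ N) (hNM : N ≤ M) :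
    (∏ i ∈ Finset.range N, ((2 * M + i : ℝ) / (M + i))) ^ 2 ≤
      4 / 3 * (2 * ((2 * M + N : ℝ) / (M + N))) ^ N := by
  have hM : (0 : ℝ) < M := by exact_mod_cast (by omega : 0 < M)
  have hNM' : (N : ℝ) ≤ M := by exact_mod_cast hNM
  set u : ℕ → ℝ := fun i => (2 * M + i : ℝ) / (M + i) with hu
  have hu0 : ∀ i, 0 < u i := fun i => by simp only [hu]; positivity
  have hu2 : u 0 = 2 := by
    simp only [hu, Nat.cast_zero, add_zero]
    field_simp
  have huN : 3 / 2 ≤ u N := by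
    simp only [hu]
    rw [le_div_iff₀ (by positivity)]
    linarith
  have hshift : (∏ i ∈ Finset.range N, u i) * u N = (∏ i ∈ Finset.range N, u (i + 1)) * 2 := by
    rw [← Finset.prod_range_succ, Finset.prod_range_succ', hu2]
  have hrefl : ∏ i ∈ Finset.range N, u (i + 1) = ∏ i ∈ Finset.range N, u (N - i) := by
    rw [← Finset.prod_range_reflect]
    refine Finset.prod_congr rfl fun i hi => ?_
    have := Finset.mem_range.1 hi
    congr 1
    omega
  have hpair : (∏ i ∈ Finset.range N, u i) * ∏ i ∈ Finset.range N, u (N - i) ≤ (2 * u N) ^ N := by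
    rw [← Finset.prod_mul_distrib]
    calc ∏ i ∈ Finset.range N, u i * u (N - i) ≤ ∏ _i ∈ Finset.range N, (2 * u N) := by
          refine Finset.prod_le_prod (fun i _ => (mul_pos (hu0 _) (hu0 _)).le) fun i hi => ?_
          have hi' := Finset.mem_range.1 hi
          obtain ⟨j, hj⟩ : ∃ j, N = i + j := ⟨N - i, by omega⟩
          have hNi : N - i = j := by omega
          rw [hNi]
          simp only [hu, hj]
          push_cast
          rw [div_mul_div_comm, mul_div_assoc', div_le_div_iff₀ (by positivity) (by positivity)]
          have h1 : (0 : ℝ) ≤ i := Nat.cast_nonneg i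
          have h2 : (0 : ℝ) ≤ j := Nat.cast_nonneg j
          have : 0 ≤ (M : ℝ) * i * j * (2 * M + (i + j) + M) := by positivity
          nlinarith
      _ = _ := by simp
  set P := ∏ i ∈ Finset.range N, u i with hP
  have hP0 : 0 < P := Finset.prod_pos fun i _ => hu0 i
  rw [← hrefl] at hpair
  have h1 : P ^ 2 * u N ≤ 2 * (2 * u N) ^ N := by
    calc P ^ 2 * u N = P * (P * u N) := by ring
      _ = 2 * (P * ∏ i ∈ Finset.range N, u (i + 1)) := by rw [hshift]; ring
      _ ≤ _ := by linarith
  have h2 : P ^ 2 * (3 / 2) ≤ P ^ 2 * u N := mul_le_mul_of_nonneg_left huN (sq_nonneg P)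
  change P ^ 2 ≤ 4 / 3 * (2 * u N) ^ N
  linarith

section

variable {N M : ℕ}

theorem rho_pos (hN : 1 ≤ N) (hNM : N ≤ M) : 0 < rho N M := by
  have h1 : (0 : ℝ) < N := by exact_mod_cast hN
  have h2 : (0 : ℝ) < M := by exact_mod_cast hN.trans hNM
  exact div_pos h1 h2

theorem rho_le_one (hN : 1 ≤ N) (hNM : N ≤ M) : rho N M ≤ 1 := by
  have h2 : (0 : ℝ) < M := by exact_mod_cast hN.trans hNM
  rw [rho, div_le_one h2]
  exact_mod_cast hNM

theorem div_one_add_rho (hN : 1 ≤ N) (hNM : N ≤ M) :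
    (N : ℝ) / (1 + rho N M) = N * M / (N + M) := by
  have h1 : (0 : ℝ) < N := by exact_mod_cast hN
  have h2 : (0 : ℝ) < M := by exact_mod_cast hN.trans hNM
  rw [rho]
  field_simp
  ring

theorem prod_le_rpow (hN : 1 ≤ N) (hNM : N ≤ M) :
    ∏ i ∈ Finset.range N, ((2 * M + i : ℝ) / (M + i)) ≤
      2 * (2 + rho N M) ^ ((N : ℝ) / (1 + rho N M)) := by
  have hM : (0 : ℝ) < M := by exact_mod_cast (by omega : 0 < M)
  have hr0 := rho_pos hN hNM
  have hr1 := rho_le_one hN hNM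
  set x := rho N M with hx
  have hxM : (2 * M + N : ℝ) / (M + N) = (2 + x) / (1 + x) := by
    rw [hx, rho]
    field_simp
  have h1 := prod_sq_le hN hNM
  rw [hxM] at h1
  have h2 : 2 * ((2 + x) / (1 + x)) ≤ (2 + x) ^ (2 / (1 + x)) := by
    have h3 := log_chord_nonpos hr0.le hr1
    have hp : 0 < 2 * ((2 + x) / (1 + x)) := by positivity
    rw [← Real.log_le_log_iff hp (Real.rpow_pos_of_pos (by linarith) _),
      Real.log_rpow (by linarith), Real.log_mul (by norm_num) (by positivity),
      Real.log_div (by positivity) (by positivity), div_mul_eq_mul_div, le_div_iff₀ (by linarith)]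
    linarith
  have h3 : (2 * ((2 + x) / (1 + x))) ^ N ≤ ((2 + x) ^ ((N : ℝ) / (1 + x))) ^ 2 := by
    refine (pow_le_pow_left₀ (by positivity) h2 N).trans (le_of_eq ?_)
    rw [← Real.rpow_natCast, ← Real.rpow_natCast, ← Real.rpow_mul (by linarith),
      ← Real.rpow_mul (by linarith)]
    congr 1
    push_cast
    ring
  have hX : 0 < (2 + x) ^ ((N : ℝ) / (1 + x)) := Real.rpow_pos_of_pos (by linarith) _
  rw [← pow_le_pow_iff_left₀ (Finset.prod_nonneg fun i _ => by positivity) (by positivity)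
    two_ne_zero, mul_pow]
  linarith [sq_nonneg ((2 + x) ^ ((N : ℝ) / (1 + x)))]

/-- The standard deviation scale of the number of occupied ports. -/
theorem delta_mul_sq {ε : ℝ} (hN : 1 ≤ N) (hNM : N ≤ M) (hε0 : 0 < ε) (hε1 : ε < 1) :
    (delta N M ε / (1 + rho N M) * N) ^ 2 = 4 * N * Real.log (2 / ε) / (1 + rho N M) := by
  have hr0 := rho_pos hN hNM
  have hN' : (0 : ℝ) < N := by exact_mod_cast hN
  have hlog : 0 < Real.log (2 / ε) := Real.log_pos (by rw [lt_div_iff₀ hε0]; linarith)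
  rw [mul_pow, div_pow, delta, Real.sq_sqrt (by positivity)]
  field_simp

theorem delta_nonneg {ε : ℝ} : 0 ≤ delta N M ε := Real.sqrt_nonneg _

theorem sqrt_le_delta_mul {ε : ℝ} (hN : 1 ≤ N) (hNM : N ≤ M) (hε0 : 0 < ε) (hε1 : ε < 1) :
    √(N : ℝ) ≤ delta N M ε / (1 + rho N M) * N := by
  have hr0 := rho_pos hN hNM
  have hr1 := rho_le_one hN hNM
  have hN' : (0 : ℝ) < N := by exact_mod_cast hN
  have hlog : 1 / 2 ≤ Real.log (2 / ε) := by
    have h1 : Real.log 2 ≤ Real.log (2 / ε) :=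
      Real.log_le_log (by norm_num) (by rw [le_div_iff₀ hε0]; linarith)
    linarith [Real.log_two_gt_d9]
  rw [Real.sqrt_le_left (mul_nonneg (div_nonneg delta_nonneg (by linarith)) hN'.le),
    delta_mul_sq hN hNM hε0 hε1, le_div_iff₀ (by linarith)]
  nlinarith

theorem one_le_rPar {ε : ℝ} : 1 ≤ rPar N M ε := le_max_left _ _

theorem div_rPar_le {ε : ℝ} : (N : ℝ) / rPar N M ε ≤ N :=
  div_le_self (Nat.cast_nonneg N) one_le_rPar

theorem le_div_rPar {ε s : ℝ} (hN : 1 ≤ N) (hNM : N ≤ M) (h1 : s ≤ N)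
    (h2 : s ≤ (1 + delta N M ε) / (1 + rho N M) * N) : s ≤ N / rPar N M ε := by
  have hr0 := rho_pos hN hNM
  have hd := delta_nonneg (N := N) (M := M) (ε := ε)
  rw [rPar]
  rcases le_total 1 ((1 + rho N M) / (1 + delta N M ε)) with h | h
  · rw [max_eq_right h]
    refine h2.trans (le_of_eq ?_)
    field_simp
  · rw [max_eq_left h, div_one]
    exact h1

theorem rpow_le_rPar {ε s : ℝ} (hs : 0 < s) (h : s ≤ N / rPar N M ε) :
    (1 + N / s) ^ s ≤ (1 + rPar N M ε) ^ ((N : ℝ) / rPar N M ε) := by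
  have h1 := rpow_mul_exp_le hs h div_rPar_le
  have hr : 0 < rPar N M ε := zero_lt_one.trans_le one_le_rPar
  have hN : (0 : ℝ) < N := by
    have := hs.trans_le (h.trans div_rPar_le)
    exact this
  have h2 : (N : ℝ) / (N / rPar N M ε) = rPar N M ε := by field_simp
  rw [h2] at h1
  refine le_trans (le_mul_of_one_le_right (Real.rpow_pos_of_pos (by positivity) _).le ?_) h1
  rw [Real.one_le_exp_iff]
  exact mul_nonneg (by linarith [Real.log_two_gt_d9]) (sub_nonneg.2 h)

/-- If `r > 1`, the mean of `occProd` in the urn is smaller than the bound `(1 + r) ^ (N / r)` by a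
factor that is exponentially small in `√N`. -/
theorem prod_mul_exp_le {ε : ℝ} (hN : 1 ≤ N) (hNM : N ≤ M) (hε0 : 0 < ε) (hε1 : ε < 1)
    (hr : rPar N M ε ≠ 1) :
    (∏ i ∈ Finset.range N, ((2 * M + i : ℝ) / (M + i))) * Real.exp (√(N : ℝ) / 8) ≤
      2 * (1 + rPar N M ε) ^ ((N : ℝ) / rPar N M ε) := by
  have hr0 := rho_pos hN hNM
  have hN' : (0 : ℝ) < N := by exact_mod_cast hN
  have hd := delta_nonneg (N := N) (M := M) (ε := ε)
  have hrP : rPar N M ε = (1 + rho N M) / (1 + delta N M ε) := by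
    rcases max_choice 1 ((1 + rho N M) / (1 + delta N M ε)) with h | h
    · exact absurd h hr
    · exact h
  set s₁ : ℝ := N / (1 + rho N M) with hs1
  have hs2 : (N : ℝ) / rPar N M ε = s₁ + delta N M ε / (1 + rho N M) * N := by
    rw [hrP, hs1]
    field_simp
  have hs1p : 0 < s₁ := by positivity
  have hsq := sqrt_le_delta_mul hN hNM hε0 hε1
  have h12 : s₁ ≤ N / rPar N M ε := by
    rw [hs2]
    linarith [Real.sqrt_nonneg (N : ℝ)]
  have h := rpow_mul_exp_le hs1p h12 div_rPar_le
  have hrp : 0 < rPar N M ε := zero_lt_one.trans_le one_le_rPar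
  have e1 : (N : ℝ) / (N / rPar N M ε) = rPar N M ε := by field_simp
  have e2 : (1 : ℝ) + N / s₁ = 2 + rho N M := by
    rw [hs1]
    field_simp
    ring
  rw [e1, e2] at h
  have h3 : Real.exp (√(N : ℝ) / 8) ≤
      Real.exp ((Real.log 2 - 1 / 2) * (N / rPar N M ε - s₁)) := by
    rw [Real.exp_le_exp, hs2, add_sub_cancel_left]
    have hl : (1 / 8 : ℝ) ≤ Real.log 2 - 1 / 2 := by linarith [Real.log_two_gt_d9]
    nlinarith [Real.sqrt_nonneg (N : ℝ)]
  have hX : 0 < (2 + rho N M) ^ s₁ := Real.rpow_pos_of_pos (by linarith) _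
  calc _ ≤ (2 * (2 + rho N M) ^ s₁) * Real.exp (√(N : ℝ) / 8) :=
        mul_le_mul_of_nonneg_right (prod_le_rpow hN hNM) (Real.exp_pos _).le
    _ ≤ 2 * ((2 + rho N M) ^ s₁ * Real.exp ((Real.log 2 - 1 / 2) * (N / rPar N M ε - s₁))) := by
        rw [mul_assoc]
        gcongr
    _ ≤ _ := by linarith

theorem bunchScale_nonneg {ε : ℝ} (hN : 1 ≤ N) (hNM : N ≤ M) (hε0 : 0 < ε) (hε1 : ε < 1) :
    0 ≤ bunchScale N M ε := by
  have hr0 := rho_pos hN hNM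
  have hr1 := rho_le_one hN hNM
  have hN' : (1 : ℝ) ≤ N := by exact_mod_cast hN
  rw [bunchScale]
  refine div_nonneg (Real.log_nonneg ?_) (Real.log_nonneg ?_)
  · rw [one_le_div (by positivity)]
    nlinarith
  · rw [one_le_div hr0]
    linarith

/-- With `k` above `(1 + η)` times the bunching scale, the union bound for the event that some port
holds `k` bosons is of order `N ^ (-η)`. -/
theorem mul_pow_le_of_bunchScale_lt {ε η : ℝ} (hN : 1 ≤ N) (hNM : N ≤ M) (hM : 2 ≤ M)
    (hε0 : 0 < ε) (hε1 : ε < 1) (hη : 0 < η) {k : ℕ} (hk : (1 + η) * bunchScale N M ε ≤ k)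
    (hkN : k ≤ N) :
    M * ((N : ℝ) / (M + N - 1)) ^ k ≤ 3 * (N : ℝ) ^ (-η) := by
  have hr0 := rho_pos hN hNM
  have hN' : (1 : ℝ) ≤ N := by exact_mod_cast hN
  have hM' : (2 : ℝ) ≤ M := by exact_mod_cast hM
  have hNM' : (N : ℝ) ≤ M := by exact_mod_cast hNM
  set q : ℝ := N / (M + N) with hq
  have hq0 : 0 < q := by positivity
  have hbase : (N : ℝ) / (M + N - 1) = q * (1 + 1 / (M + N - 1)) := by
    have : (M : ℝ) + N - 1 ≠ 0 := by linarith
    rw [hq]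
    field_simp
    ring
  have hfac : (1 + 1 / ((M : ℝ) + N - 1)) ^ k ≤ 3 := by
    have hpos : (0 : ℝ) < M + N - 1 := by linarith
    have h1 : 1 + 1 / ((M : ℝ) + N - 1) ≤ Real.exp (1 / ((M : ℝ) + N - 1)) := by
      have := Real.add_one_le_exp (1 / ((M : ℝ) + N - 1))
      linarith
    calc (1 + 1 / ((M : ℝ) + N - 1)) ^ k ≤ Real.exp (1 / ((M : ℝ) + N - 1)) ^ k :=
          pow_le_pow_left₀ (by positivity) h1 k
      _ = Real.exp (k / ((M : ℝ) + N - 1)) := by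
          rw [← Real.exp_nat_mul]
          congr 1
          ring
      _ ≤ Real.exp 1 := by
          rw [Real.exp_le_exp, div_le_one hpos]
          have : (k : ℝ) ≤ N := by exact_mod_cast hkN
          linarith
      _ ≤ 3 := by linarith [Real.exp_one_lt_d9]
  have hq1 : (1 + rho N M) / rho N M = q⁻¹ := by
    rw [hq, rho]
    field_simp
  have hlogq : 0 < Real.log q⁻¹ := by
    refine Real.log_pos ?_
    rw [hq, inv_div, one_lt_div (by linarith)]
    linarith
  have hscale : bunchScale N M ε * Real.log q⁻¹ = Real.log (M / ε) := by
    rw [bunchScale, hq1, div_mul_cancel₀ _ hlogq.ne']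
    congr 1
    rw [rho]
    field_simp
  have hqk : q ^ k ≤ ((M : ℝ) / ε) ^ (-(1 + η)) := by
    have hMe : 0 < (M : ℝ) / ε := by positivity
    rw [← Real.log_le_log_iff (by positivity) (Real.rpow_pos_of_pos hMe _), Real.log_pow,
      Real.log_rpow hMe, ← hscale]
    have h1 : Real.log q = -Real.log q⁻¹ := by rw [Real.log_inv, neg_neg]
    rw [h1]
    have := mul_le_mul_of_nonneg_right hk hlogq.le
    linarith
  have hMN : ((M : ℝ) / ε) ^ (-(1 + η)) ≤ (M : ℝ)⁻¹ * (N : ℝ) ^ (-η) := by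
    have hM0 : (0 : ℝ) < M := by linarith
    have h1 : (M : ℝ) ≤ M / ε := by rw [le_div_iff₀ hε0]; nlinarith
    calc ((M : ℝ) / ε) ^ (-(1 + η)) ≤ (M : ℝ) ^ (-(1 + η)) :=
          Real.rpow_le_rpow_of_nonpos hM0 h1 (by linarith)
      _ = (M : ℝ)⁻¹ * (M : ℝ) ^ (-η) := by
          rw [show -(1 + η) = -1 + -η by ring, Real.rpow_add hM0, Real.rpow_neg_one]
      _ ≤ _ := by
          refine mul_le_mul_of_nonneg_left ?_ (by positivity)
          exact Real.rpow_le_rpow_of_nonpos (by linarith) hNM' (by linarith)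
  rw [hbase, mul_pow]
  have hM0 : (0 : ℝ) < M := by linarith
  calc M * (q ^ k * (1 + 1 / ((M : ℝ) + N - 1)) ^ k)
      ≤ M * (((M : ℝ)⁻¹ * (N : ℝ) ^ (-η)) * 3) := by
        refine mul_le_mul_of_nonneg_left ?_ hM0.le
        refine mul_le_mul (hqk.trans hMN) hfac ?_ (by positivity)
        have : (0 : ℝ) < M + N - 1 := by linarith
        positivity
    _ = _ := by
        field_simp

end

/-! ### Typical outputs -/

section

variable {N M : ℕ}

theorem one_add_rPar_rpow_pos {ε : ℝ} : 0 < (1 + rPar N M ε) ^ ((N : ℝ) / rPar N M ε) :=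
  Real.rpow_pos_of_pos (by linarith [one_le_rPar (N := N) (M := M) (ε := ε)]) _

/-- A typical output: the number of occupied ports lies within `δ N / (1 + ρ)` of `N / (1 + ρ)`, and
no port holds more than `(1 + η)` times the bunching scale. -/
def Typical (ε η : ℝ) (l : Fin N → Fin M) : Prop :=
  (1 - delta N M ε) / (1 + rho N M) * N ≤ occPorts l ∧
    (occPorts l : ℝ) ≤ (1 + delta N M ε) / (1 + rho N M) * N ∧
    (maxBunch l : ℝ) ≤ (1 + η) * bunchScale N M ε

open Classical in
/-- The indicator of the outputs that are not typical. -/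
def atypicalInd (ε η : ℝ) (l : Fin N → Fin M) : ℝ := if Typical ε η l then 0 else 1

/-- The choice of `δ`: a deviation of `δ N / (1 + ρ)` has a tail of order `(ε / 2) ^ 4`, and any fixed
fraction of it a corresponding power of `ε / 2`. -/
theorem exp_neg_delta_le {ε : ℝ} (hN : 16 ≤ N) (hNM : N ≤ M) (hε0 : 0 < ε) (hε1 : ε < 1) {k : ℕ}
    {t : ℝ} (ht : k * (delta N M ε / (1 + rho N M) * N) ^ 2 ≤ 4 * t ^ 2) :
    Real.exp (-(2 * t ^ 2 / N)) ≤ (ε / 2) ^ k := by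
  have hr0 := rho_pos (by omega) hNM
  have hr1 := rho_le_one (by omega) hNM
  have hN' : (0 : ℝ) < N := by exact_mod_cast (by omega : 0 < N)
  have hlog : 0 < Real.log (2 / ε) := Real.log_pos (by rw [lt_div_iff₀ hε0]; linarith)
  rw [delta_mul_sq (by omega) hNM hε0 hε1] at ht
  have h1 : k * Real.log (2 / ε) ≤ 2 * t ^ 2 / N := by
    rw [le_div_iff₀ hN']
    have h2 : 2 * (N * Real.log (2 / ε)) ≤ 4 * N * Real.log (2 / ε) / (1 + rho N M) := by
      rw [le_div_iff₀ (by linarith)]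
      nlinarith [mul_pos hN' hlog]
    have := mul_le_mul_of_nonneg_left h2 (Nat.cast_nonneg (α := ℝ) k)
    linarith
  calc Real.exp (-(2 * t ^ 2 / N)) ≤ Real.exp (-(k * Real.log (2 / ε))) := by
        rw [Real.exp_le_exp]; linarith
    _ = (ε / 2) ^ k := by
        rw [← mul_neg, ← Real.log_inv, inv_div, Real.exp_nat_mul, Real.exp_log (by positivity)]

/-- The mean number of occupied ports is `M N / (M + N - 1)`, which exceeds `N / (1 + ρ)` by at most
`1 / 2`. -/
theorem mean_occPorts_bounds (hN : 1 ≤ N) (hNM : N ≤ M) (hM : 2 ≤ M) :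
    (N : ℝ) / (1 + rho N M) ≤ M - M * (M - 1) / ((M : ℝ) + N - 1) ∧
      M - M * (M - 1) / ((M : ℝ) + N - 1) ≤ N / (1 + rho N M) + 1 / 2 := by
  have hN' : (1 : ℝ) ≤ N := by exact_mod_cast hN
  have hM' : (2 : ℝ) ≤ M := by exact_mod_cast hM
  have hNM' : (N : ℝ) ≤ M := by exact_mod_cast hNM
  have hD : (0 : ℝ) < M + N - 1 := by linarith
  have hS : (0 : ℝ) < N + M := by linarith
  have h1 : (M : ℝ) - M * (M - 1) / ((M : ℝ) + N - 1) = N * M / (M + N - 1) := by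
    field_simp
    ring
  have h2 : (N : ℝ) * M / (M + N - 1) - N * M / (N + M) = N * M / ((M + N - 1) * (N + M)) := by
    field_simp
    ring
  rw [h1, div_one_add_rho hN hNM]
  constructor
  · have : 0 ≤ (N : ℝ) * M / ((M + N - 1) * (N + M)) := by positivity
    linarith
  · have : (N : ℝ) * M / ((M + N - 1) * (N + M)) ≤ 1 / 2 := by
      rw [div_le_div_iff₀ (by positivity) (by norm_num)]
      nlinarith
    linarith

/-- In the Haar-averaged law atypical outputs are rare: by the Hoeffding-type tail bound for the
number of empty ports, and the union bound over the ports for the maximal bunching. -/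
theorem urnMean_atypicalInd_le [NeZero M] {ε η : ℝ} (hN : 16 ≤ N) (hNM : N ≤ M) (hε0 : 0 < ε)
    (hε1 : ε < 1) (hη : 0 < η) (hsmall : 3 * (N : ℝ) ^ (-η) ≤ ε ^ 2 / 16) :
    urnMean N (atypicalInd (N := N) (M := M) ε η) ≤ ε ^ 2 / 4 := by
  have hM : 2 ≤ M := by omega
  have hN1 : 1 ≤ N := by omega
  have hb := bunchScale_nonneg hN1 hNM hε0 hε1
  obtain ⟨hmean1, hmean2⟩ := mean_occPorts_bounds hN1 hNM hM
  set e : ℝ := M * (M - 1) / ((M : ℝ) + N - 1) with he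
  set τ : ℝ := delta N M ε / (1 + rho N M) * N with hτ
  have hτ4 : 4 ≤ τ := by
    refine le_trans ?_ (sqrt_le_delta_mul hN1 hNM hε0 hε1)
    rw [Real.le_sqrt' (by norm_num)]
    have : (16 : ℝ) ≤ N := by exact_mod_cast hN
    linarith
  have hlow : (1 - delta N M ε) / (1 + rho N M) * N = N / (1 + rho N M) - τ := by rw [hτ]; ring
  have hhigh : (1 + delta N M ε) / (1 + rho N M) * N = N / (1 + rho N M) + τ := by rw [hτ]; ring
  set k : ℕ := ⌊(1 + η) * bunchScale N M ε⌋₊ + 1 with hk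
  have hpt : ∀ l : Fin N → Fin M, atypicalInd ε η l ≤
      ((if τ ≤ 1 * (emptyPorts l - e) then (1 : ℝ) else 0) +
        (if τ - 1 / 2 ≤ -1 * (emptyPorts l - e) then (1 : ℝ) else 0)) +
        ∑ j, if k ≤ occ l j then (1 : ℝ) else 0 := fun l => by
    have hoe : (occPorts l : ℝ) + emptyPorts l = M := by exact_mod_cast occPorts_add_emptyPorts l
    have h0 : ∀ j, (0 : ℝ) ≤ if k ≤ occ l j then 1 else 0 := fun j => by split_ifs <;> norm_num
    have hs0 : 0 ≤ ∑ j, if k ≤ occ l j then (1 : ℝ) else 0 := Finset.sum_nonneg fun j _ => h0 j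
    have ha : (0 : ℝ) ≤ if τ ≤ 1 * (emptyPorts l - e) then 1 else 0 := by split_ifs <;> norm_num
    have hb : (0 : ℝ) ≤ if τ - 1 / 2 ≤ -1 * (emptyPorts l - e) then 1 else 0 := by
      split_ifs <;> norm_num
    rw [atypicalInd]
    by_cases h : Typical ε η l
    · rw [if_pos h]
      positivity
    rw [if_neg h]
    rw [Typical, hlow, hhigh] at h
    by_cases h1 : N / (1 + rho N M) - τ ≤ occPorts l
    · by_cases h2 : (occPorts l : ℝ) ≤ N / (1 + rho N M) + τ
      · obtain ⟨j, hj⟩ : ∃ j, k ≤ occ l j := by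
          by_contra hcon
          push Not at hcon
          refine h ⟨h1, h2, ?_⟩
          have h3 : maxBunch l ≤ ⌊(1 + η) * bunchScale N M ε⌋₊ :=
            Finset.sup_le fun j _ => Nat.lt_succ_iff.1 (hcon j)
          exact (Nat.cast_le.2 h3).trans (Nat.floor_le (by positivity))
        have h4 := Finset.single_le_sum (fun j _ => h0 j) (Finset.mem_univ j)
        rw [if_pos hj] at h4
        linarith
      · rw [if_pos (show τ - 1 / 2 ≤ -1 * (emptyPorts l - e) by linarith)]
        linarith
    · rw [if_pos (show τ ≤ 1 * (emptyPorts l - e) by linarith)]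
      linarith
  refine (urnMean_mono hpt).trans ?_
  rw [urnMean_add, urnMean_add, urnMean_sum]
  have h1 := (urnMean_emptyPorts_tail (M := M) (N := N) hN1 hM (one_pow 2)
    (show 0 ≤ τ by linarith)).trans (exp_neg_delta_le (k := 4) hN hNM hε0 hε1 (t := τ)
      (by rw [← hτ]; norm_num))
  have h2 := (urnMean_emptyPorts_tail (M := M) (N := N) hN1 hM (by norm_num : (-1 : ℝ) ^ 2 = 1)
    (show 0 ≤ τ - 1 / 2 by linarith)).trans (exp_neg_delta_le (k := 3) hN hNM hε0 hε1
      (t := τ - 1 / 2) (by rw [← hτ]; push_cast; nlinarith))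
  have h3 : ∑ j : Fin M, urnMean N (fun l : Fin N → Fin M => if k ≤ occ l j then (1 : ℝ) else 0) ≤
      3 * (N : ℝ) ^ (-η) := by
    by_cases hkN : k ≤ N
    · refine (Finset.sum_le_sum fun j _ => urnMean_le_occ hM j N k).trans ?_
      rw [Finset.sum_const, Finset.card_univ, Fintype.card_fin, nsmul_eq_mul]
      refine mul_pow_le_of_bunchScale_lt hN1 hNM hM hε0 hε1 hη ?_ hkN
      rw [hk]
      push_cast
      exact (Nat.lt_floor_add_one _).le
    · refine le_trans (le_of_eq ?_) (by positivity : (0 : ℝ) ≤ 3 * (N : ℝ) ^ (-η))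
      refine Finset.sum_eq_zero fun j _ => Finset.sum_eq_zero fun l _ => ?_
      have : occ l j ≤ N := (Finset.card_filter_le _ _).trans (by simp)
      simp only
      rw [if_neg (by omega), mul_zero]
  have h4 : (ε / 2) ^ 4 + (ε / 2) ^ 3 ≤ 3 * ε ^ 2 / 16 := by
    have h5 : ε ^ 3 ≤ ε ^ 2 := pow_le_pow_of_le_one hε0.le hε1.le (by norm_num)
    have h6 : ε ^ 4 ≤ ε ^ 2 := pow_le_pow_of_le_one hε0.le hε1.le (by norm_num)
    nlinarith
  linarith

/-! ### Typical multiports -/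

theorem measureReal_lt_le_of_integral_le [NeZero M] {f : Matrix.unitaryGroup (Fin M) ℂ → ℝ}
    (hf : Continuous f) (h0 : ∀ U, 0 ≤ f U) {a b : ℝ} (ha : 0 < a)
    (h : ∫ U, f U ∂haarU M ≤ a * b) : (haarU M).real {U | a < f U} ≤ b := by
  have h1 := mul_meas_ge_le_integral_of_nonneg (μ := haarU M) (Filter.Eventually.of_forall h0)
    (integrable_haarU hf) a
  have h2 : (haarU M).real {U | a < f U} ≤ (haarU M).real {U | a ≤ f U} :=
    by
    refine measureReal_mono fun U hU => ?_
    rw [Set.mem_ofPred_eq] at hU ⊢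
    exact hU.le
  exact h2.trans (le_of_mul_le_mul_left (h1.trans h) ha)

/-- The multiports on which atypical outputs are rare, the mean of `prefixSum` is at most its upper
bound, and the total weights of the columns of the input rows are close to their mean. -/
def goodSet (R : Fin N → Fin M) (ε η : ℝ) : Set (Matrix.unitaryGroup (Fin M) ℂ) :=
  {U | ∑ l, seqProb (rowsOf R U) l * atypicalInd ε η l ≤ ε / 2} ∩
    {U | ∑ l, seqProb (rowsOf R U) l * (prefixSum N l : ℝ) ≤
      (1 + rPar N M ε) ^ ((N : ℝ) / rPar N M ε)} ∩ {U | colDeviation (rowsOf R U) ≤ 4 / ε}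

theorem continuous_sum_seqProb (R : Fin N → Fin M) (f : (Fin N → Fin M) → ℝ) :
    Continuous fun U => ∑ l, seqProb (rowsOf R U) l * f l :=
  continuous_finsetSum _ fun l _ => (continuous_seqProb R l).mul continuous_const

theorem measurableSet_goodSet (R : Fin N → Fin M) (ε η : ℝ) : MeasurableSet (goodSet R ε η) :=
  (((isClosed_le (continuous_sum_seqProb R _) continuous_const).inter
    (isClosed_le (continuous_sum_seqProb R _) continuous_const)).inter
    (isClosed_le (continuous_colDeviation R) continuous_const)).measurableSet

theorem atypicalInd_nonneg (ε η : ℝ) (l : Fin N → Fin M) : 0 ≤ atypicalInd ε η l := by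
  rw [atypicalInd]; split_ifs <;> norm_num

theorem le_haarU_goodSet [NeZero M] {ε η : ℝ} (hN : 16 ≤ N) (hNM : N ≤ M) (hε0 : 0 < ε)
    (hε1 : ε < 1) (hη : 0 < η) (hsmall : 3 * (N : ℝ) ^ (-η) ≤ ε ^ 2 / 16)
    (hexp : 16 / ε ≤ Real.exp (√(N : ℝ) / 8)) {R : Fin N → Fin M} (hR : Function.Injective R) :
    ENNReal.ofReal (1 - ε) ≤ haarU M (goodSet R ε η) := by
  have hN1 : 1 ≤ N := by omega
  set T : ℝ := (1 + rPar N M ε) ^ ((N : ℝ) / rPar N M ε) with hT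
  have hT0 : 0 < T := one_add_rPar_rpow_pos
  have hnonneg : ∀ f : (Fin N → Fin M) → ℝ, (∀ l, 0 ≤ f l) →
      ∀ U, 0 ≤ ∑ l, seqProb (rowsOf R U) l * f l := fun f hf U =>
    Finset.sum_nonneg fun l _ => mul_nonneg (seqProb_nonneg _ l) (hf l)
  have h1 : (haarU M).real {U | ε / 2 < ∑ l, seqProb (rowsOf R U) l * atypicalInd ε η l} ≤
      ε / 2 := by
    refine measureReal_lt_le_of_integral_le (continuous_sum_seqProb R _)
      (hnonneg _ (atypicalInd_nonneg ε η)) (by positivity) ?_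
    rw [integral_sum_seqProb hR]
    refine (urnMean_atypicalInd_le hN hNM hε0 hε1 hη hsmall).trans (le_of_eq ?_)
    ring
  have h2 : (haarU M).real {U | T < ∑ l, seqProb (rowsOf R U) l * (prefixSum N l : ℝ)} ≤
      ε / 4 := by
    by_cases hr : rPar N M ε = 1
    -- for `r = 1` the bound `2 ^ N` holds for every output
    · have hempty : {U | T < ∑ l, seqProb (rowsOf R U) l * (prefixSum N l : ℝ)} = ∅ := by
        refine Set.eq_empty_of_forall_notMem fun U hU => ?_
        rw [Set.mem_ofPred_eq] at hU
        refine hU.not_ge ?_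
        calc ∑ l, seqProb (rowsOf R U) l * (prefixSum N l : ℝ)
            ≤ ∑ l, seqProb (rowsOf R U) l * T := by
              refine Finset.sum_le_sum fun l _ =>
                mul_le_mul_of_nonneg_left ?_ (seqProb_nonneg _ l)
              rw [hT, hr, div_one, one_add_one_eq_two, Real.rpow_natCast]
              exact_mod_cast prefixSum_le_two_pow N l
          _ = T := by rw [← Finset.sum_mul, sum_seqProb (orthonormalRows_rowsOf hR U), one_mul]
      rw [hempty, measureReal_empty]
      positivity
    · refine measureReal_lt_le_of_integral_le (continuous_sum_seqProb R _)
        (hnonneg _ fun l => Nat.cast_nonneg _) hT0 ?_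
      rw [integral_sum_seqProb hR]
      refine (urnMean_prefixSum_le N hNM).trans ?_
      have h3 := prod_mul_exp_le hN1 hNM hε0 hε1 hr
      rw [← hT] at h3
      have h4 : 0 ≤ ∏ i ∈ Finset.range N, ((2 * M + i : ℝ) / (M + i)) :=
        Finset.prod_nonneg fun i _ => by positivity
      have h5 := (mul_le_mul_of_nonneg_left hexp h4).trans h3
      rw [mul_div_assoc', div_le_iff₀ hε0] at h5
      linarith
  have h3 : (haarU M).real {U | 4 / ε < colDeviation (rowsOf R U)} ≤ ε / 4 := by
    refine measureReal_lt_le_of_integral_le (continuous_colDeviation R)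
      (fun U => colDeviation_nonneg _) (by positivity) ?_
    refine (integral_colDeviation_le hNM hR).trans (le_of_eq ?_)
    field_simp
  have hcompl : (haarU M).real (goodSet R ε η)ᶜ ≤ ε := by
    have hsub : (goodSet R ε η)ᶜ ⊆
        ({U | ε / 2 < ∑ l, seqProb (rowsOf R U) l * atypicalInd ε η l} ∪
          {U | T < ∑ l, seqProb (rowsOf R U) l * (prefixSum N l : ℝ)}) ∪
          {U | 4 / ε < colDeviation (rowsOf R U)} := fun U hU => by
      by_contra hcon
      simp only [Set.mem_union, Set.mem_ofPred_eq, not_or, not_lt] at hcon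
      exact hU hcon
    have h4 := (measureReal_mono (μ := haarU M) hsub).trans (measureReal_union_le _ _)
    have h5 := measureReal_union_le (μ := haarU M)
      {U | ε / 2 < ∑ l, seqProb (rowsOf R U) l * atypicalInd ε η l}
      {U | T < ∑ l, seqProb (rowsOf R U) l * (prefixSum N l : ℝ)}
    linarith
  rw [probReal_compl_eq_one_sub (measurableSet_goodSet R ε η)] at hcompl
  rw [ENNReal.ofReal_le_iff_le_toReal (measure_ne_top _ _)]
  change 1 - ε ≤ (haarU M).real (goodSet R ε η)
  linarith

/-! ### The number of operations -/

theorem lowerBound_le_of_typical {ε η : ℝ} (hN : 16 ≤ N) {l : Fin N → Fin M}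
    (hl : Typical ε η l) : 1 / 4 * lowerBound N M ε ≤ ((runCost N l + N ^ 2 : ℕ) : ℝ) := by
  have h1 := (le_runCost_of_two_le (by omega) l).1
  have h2 : (2 : ℝ) ^ ((1 - delta N M ε) / (1 + rho N M) * N) ≤
      4 * 2 ^ ((occPorts l : ℝ) - 2) := by
    rw [Real.rpow_sub two_pos]
    refine (Real.rpow_le_rpow_of_exponent_le one_le_two hl.1).trans (le_of_eq ?_)
    norm_num
    ring
  have h3 := mul_le_mul_of_nonneg_left h2 (Nat.cast_nonneg (α := ℝ) N)
  have h4 : (0 : ℝ) ≤ M * (N : ℝ) ^ 2 := by positivity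
  have h5 : (0 : ℝ) ≤ (N : ℝ) ^ 2 := by positivity
  rw [lowerBound]
  push_cast
  linarith

theorem runCost_add_le (hN : 1 ≤ N) [NeZero M] (l : Fin N → Fin M) :
    ((runCost N l + N ^ 2 : ℕ) : ℝ) ≤ 15 * N * prefixSum N l + 7 * (M * (N : ℝ) ^ 2) := by
  have hM := NeZero.pos M
  have h1 := runCost_le N l
  have h2 : runCost N l + N ^ 2 ≤ 15 * N * prefixSum N l + 7 * (M * N ^ 2) := by
    have h3 : N ≤ N ^ 2 := by nlinarith
    have h4 : N ^ 2 ≤ M * N ^ 2 := Nat.le_mul_of_pos_left _ hM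
    have h5 : M * N ≤ M * N ^ 2 := Nat.mul_le_mul_left _ h3
    nlinarith
  exact_mod_cast h2

theorem le_upperBound_of_typical [NeZero M] {ε η : ℝ} (hN : 16 ≤ N) (hNM : N ≤ M)
    {l : Fin N → Fin M} (hl : Typical ε η l) :
    ((runCost N l + N ^ 2 : ℕ) : ℝ) ≤ 15 * upperBound N M ε (maxBunch l) := by
  have h1 := runCost_add_le (by omega) l
  have h2 : (prefixSum N l : ℝ) ≤ maxBunch l * occProd l := by
    exact_mod_cast prefixSum_le_maxBunch_mul l
  have h3 : (occProd l : ℝ) ≤ (1 + rPar N M ε) ^ ((N : ℝ) / rPar N M ε) := by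
    obtain ⟨K, rfl⟩ : ∃ K, N = K + 1 := ⟨N - 1, by omega⟩
    refine (occProd_le_rpow l).trans (rpow_le_rPar (by exact_mod_cast occPorts_pos l) ?_)
    exact le_div_rPar (by omega) hNM (by exact_mod_cast occPorts_le l) hl.2.1
  have hT := one_add_rPar_rpow_pos (N := N) (M := M) (ε := ε)
  have h4 := h2.trans (mul_le_mul_of_nonneg_left h3 (Nat.cast_nonneg (maxBunch l)))
  have h5 := mul_le_mul_of_nonneg_left h4 (Nat.cast_nonneg (α := ℝ) N)
  have h6 : (0 : ℝ) ≤ M * (N : ℝ) ^ 2 := by positivity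
  have h7 : 0 ≤ N * (1 + rPar N M ε) ^ ((N : ℝ) / rPar N M ε) := by positivity
  rw [upperBound]
  linarith

theorem le_sum_seqProb_one_sub {B : Fin N → Fin M → ℂ} (hB : OrthonormalRows B) {ε η : ℝ}
    (hε0 : 0 < ε) (hε1 : ε < 1) (h : ∑ l, seqProb B l * atypicalInd ε η l ≤ ε / 2) :
    1 - ε ≤ ∑ l, seqProb B l * (1 - atypicalInd ε η l) ∧
      1 / 2 ≤ ∑ l, seqProb B l * (1 - atypicalInd ε η l) := by
  have h1 : ∑ l, seqProb B l * (1 - atypicalInd ε η l) =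
      1 - ∑ l, seqProb B l * atypicalInd ε η l := by
    simp only [mul_sub, mul_one, Finset.sum_sub_distrib, sum_seqProb hB]
  rw [h1]
  constructor <;> linarith

theorem lowerBound_le_mean {B : Fin N → Fin M → ℂ} (hB : OrthonormalRows B) {ε η : ℝ}
    (hN : 16 ≤ N) (hε0 : 0 < ε) (hε1 : ε < 1)
    (h : ∑ l, seqProb B l * atypicalInd ε η l ≤ ε / 2) :
    1 / 8 * lowerBound N M ε ≤ ∑ l, seqProb B l * ((runCost N l + N ^ 2 : ℕ) : ℝ) := by
  have hL : 0 ≤ lowerBound N M ε := by rw [lowerBound]; positivity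
  calc 1 / 8 * lowerBound N M ε = 1 / 2 * (1 / 4 * lowerBound N M ε) := by ring
    _ ≤ (∑ l, seqProb B l * (1 - atypicalInd ε η l)) * (1 / 4 * lowerBound N M ε) :=
        mul_le_mul_of_nonneg_right (le_sum_seqProb_one_sub hB hε0 hε1 h).2 (by positivity)
    _ ≤ ∑ l, seqProb B l * ((runCost N l + N ^ 2 : ℕ) : ℝ) := by
        rw [Finset.sum_mul]
        refine Finset.sum_le_sum fun l _ => ?_
        rw [mul_assoc]
        refine mul_le_mul_of_nonneg_left ?_ (seqProb_nonneg B l)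
        rw [atypicalInd]
        by_cases hl : Typical ε η l
        · rw [if_pos hl, sub_zero, one_mul]
          exact lowerBound_le_of_typical hN hl
        · rw [if_neg hl, sub_self, zero_mul]
          exact Nat.cast_nonneg _

theorem mean_le_upperBound [NeZero M] {B : Fin N → Fin M → ℂ} (hB : OrthonormalRows B) {ε : ℝ}
    (hN : 1 ≤ N) (hNM : N ≤ M) (hε0 : 0 < ε) (hε1 : ε < 1)
    (h : ∑ l, seqProb B l * (prefixSum N l : ℝ) ≤
      (1 + rPar N M ε) ^ ((N : ℝ) / rPar N M ε)) :
    ∑ l, seqProb B l * ((runCost N l + N ^ 2 : ℕ) : ℝ) ≤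
      15 * upperBound N M ε (bunchScale N M ε) := by
  have hb := bunchScale_nonneg hN hNM hε0 hε1
  calc ∑ l, seqProb B l * ((runCost N l + N ^ 2 : ℕ) : ℝ)
      ≤ ∑ l, seqProb B l * (15 * N * prefixSum N l + 7 * (M * (N : ℝ) ^ 2)) :=
        Finset.sum_le_sum fun l _ =>
          mul_le_mul_of_nonneg_left (runCost_add_le hN l) (seqProb_nonneg B l)
    _ = 15 * N * ∑ l, seqProb B l * (prefixSum N l : ℝ) + 7 * (M * (N : ℝ) ^ 2) := by
        simp only [mul_add, Finset.sum_add_distrib, ← Finset.sum_mul, sum_seqProb hB, one_mul,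
          Finset.mul_sum]
        congr 1
        exact Finset.sum_congr rfl fun l _ => by ring
    _ ≤ 15 * upperBound N M ε (bunchScale N M ε) := by
        have h1 := mul_le_mul_of_nonneg_left h (Nat.cast_nonneg (α := ℝ) N)
        have h2 := one_add_rPar_rpow_pos (N := N) (M := M) (ε := ε)
        have h3 : 0 ≤ bunchScale N M ε * N * (1 + rPar N M ε) ^ ((N : ℝ) / rPar N M ε) := by
          positivity
        have h4 : 0 ≤ N * (1 + rPar N M ε) ^ ((N : ℝ) / rPar N M ε) := by positivity
        have h5 : (0 : ℝ) ≤ M * (N : ℝ) ^ 2 := by positivity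
        rw [upperBound]
        linarith

/-- On average a run costs at least a constant times `N 2 ^ (N / (1 + ρ))`, without the loss of
`δ` in the exponent: the exponent `logOcc` is controlled in the mean, by the column weights, and
Jensen's inequality applies. -/
theorem le_mean_of_colDeviation_le [NeZero M] {B : Fin N → Fin M → ℂ} (hB : OrthonormalRows B)
    {ε : ℝ} (hN : 2 ≤ N) (hNM : N ≤ M) (h : colDeviation B ≤ 4 / ε) :
    N * (2 : ℝ) ^ ((N : ℝ) / (1 + rho N M) - 2 / ε - 5 / 2) ≤
      ∑ l, seqProb B l * ((runCost N l + N ^ 2 : ℕ) : ℝ) := by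
  have hr0 := rho_pos (by omega) hNM
  have hr1 := rho_le_one (by omega) hNM
  have hN' : (0 : ℝ) < N := by exact_mod_cast (by omega : 0 < N)
  have h1 := le_sum_seqProb_logOcc hN B hB
  rw [sum_colSq_sq hB] at h1
  have h2 : (N : ℝ) / (1 + rho N M) ≤ N - rho N M * N / 2 := by
    rw [div_le_iff₀ (by linarith)]
    nlinarith [mul_nonneg (mul_nonneg hN'.le hr0.le) (sub_nonneg.2 hr1)]
  have h3 : (N : ℝ) / (1 + rho N M) - 2 / ε - 5 / 2 ≤
      ∑ l, seqProb B l * (logOcc l - 5 / 2) := by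
    simp only [mul_sub, Finset.sum_sub_distrib, ← Finset.sum_mul, sum_seqProb hB]
    have : 4 / ε = 2 * (2 / ε) := by ring
    linarith
  have h4 := two_rpow_le_sum (seqProb B) (fun l => logOcc l - 5 / 2) (seqProb_nonneg B)
    (sum_seqProb hB) h3
  refine (mul_le_mul_of_nonneg_left h4 hN'.le).trans ?_
  rw [Finset.mul_sum]
  refine Finset.sum_le_sum fun l _ => ?_
  rw [mul_left_comm]
  refine mul_le_mul_of_nonneg_left ?_ (seqProb_nonneg B l)
  have h5 := (le_runCost_of_two_le hN l).2
  have h6 : (0 : ℝ) ≤ (N : ℝ) ^ 2 := by positivity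
  push_cast
  linarith

theorem mean_le_two_pow {n M' : ℕ} {B : Fin n → Fin M' → ℂ} (hB : OrthonormalRows B)
    (h : M' * n ≤ 2 ^ n) :
    ∑ l, seqProb B l * ((runCost n l + n ^ 2 : ℕ) : ℝ) ≤ 22 * (n * 2 ^ n) := by
  have hcost : ∀ l : Fin n → Fin M', runCost n l + n ^ 2 ≤ 22 * (n * 2 ^ n) := fun l => by
    have h1 := runCost_le n l
    have h2 := Nat.mul_le_mul_left (15 * n) (prefixSum_le_two_pow n l)
    have h3 := Nat.mul_le_mul_left n h
    have h4 := Nat.mul_le_mul_left n (Nat.lt_two_pow_self (n := n)).le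
    have h5 : M' * n ≤ n * 2 ^ n := by
      rcases n.eq_zero_or_pos with rfl | hn
      · simp
      · exact h.trans (Nat.le_mul_of_pos_left _ hn)
    nlinarith
  calc ∑ l, seqProb B l * ((runCost n l + n ^ 2 : ℕ) : ℝ)
      ≤ ∑ l, seqProb B l * (22 * (n * 2 ^ n)) :=
        Finset.sum_le_sum fun l _ =>
          mul_le_mul_of_nonneg_left (by exact_mod_cast hcost l) (seqProb_nonneg B l)
    _ = 22 * (n * 2 ^ n) := by rw [← Finset.sum_mul, sum_seqProb hB, one_mul]

theorem mul_two_pow_ceil_le (hN : 1 ≤ N) (hNM : N ≤ M) {n : ℕ}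
    (hn : n = ⌈(N : ℝ) / (1 + rho N M)⌉₊) :
    (n : ℝ) * 2 ^ n ≤ 2 * (N * (2 : ℝ) ^ ((N : ℝ) / (1 + rho N M))) := by
  have hr0 := rho_pos hN hNM
  have h1 : n ≤ N := by
    rw [hn, Nat.ceil_le]
    exact div_le_self (Nat.cast_nonneg N) (by linarith)
  have h2 : (n : ℝ) ≤ N / (1 + rho N M) + 1 := by
    rw [hn]
    exact (Nat.ceil_lt_add_one (by positivity)).le
  have h3 : (2 : ℝ) ^ n ≤ 2 * (2 : ℝ) ^ ((N : ℝ) / (1 + rho N M)) := by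
    rw [← Real.rpow_natCast, mul_comm, ← Real.rpow_add_one two_ne_zero]
    exact Real.rpow_le_rpow_of_exponent_le one_le_two h2
  calc (n : ℝ) * 2 ^ n ≤ N * (2 * (2 : ℝ) ^ ((N : ℝ) / (1 + rho N M))) :=
        mul_le_mul (by exact_mod_cast h1) h3 (by positivity) (Nat.cast_nonneg N)
    _ = 2 * (N * (2 : ℝ) ^ ((N : ℝ) / (1 + rho N M))) := by ring

theorem exists_threshold {ε η : ℝ} (hε0 : 0 < ε) (hη : 0 < η) :
    ∃ N₀ : ℕ, ∀ N : ℕ, N₀ ≤ N → 16 ≤ N ∧ 3 * (N : ℝ) ^ (-η) ≤ ε ^ 2 / 16 ∧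
      16 / ε ≤ Real.exp (√(N : ℝ) / 8) := by
  have h1 : Filter.Tendsto (fun N : ℕ => 3 * (N : ℝ) ^ (-η)) Filter.atTop (nhds 0) := by
    simpa using ((tendsto_rpow_neg_atTop hη).comp tendsto_natCast_atTop_atTop).const_mul (3 : ℝ)
  have h2 : Filter.Tendsto (fun N : ℕ => Real.exp (√(N : ℝ) / 8)) Filter.atTop Filter.atTop :=
    Real.tendsto_exp_atTop.comp ((Real.tendsto_sqrt_atTop.comp
      tendsto_natCast_atTop_atTop).atTop_div_const (by norm_num))
  exact Filter.eventually_atTop.1 (((Filter.eventually_ge_atTop 16).and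
    ((h1.eventually (ge_mem_nhds (by positivity : (0 : ℝ) < ε ^ 2 / 16))).and
      (h2.eventually_ge_atTop (16 / ε)))))

/-- In a run on a typical multiport the bounds hold with the required probability. -/
theorem le_sampler_bounds [NeZero M] {B : Matrix (Fin N) (Fin M) ℂ} (hB : OrthonormalRows B)
    {ε η : ℝ} (hN : 16 ≤ N) (hNM : N ≤ M) (hε0 : 0 < ε) (hε1 : ε < 1)
    (h : ∑ l, seqProb (M := M) B l * atypicalInd ε η l ≤ ε / 2) :
    ENNReal.ofReal (1 - ε) ≤ (sampler B).toOuterMeasure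
      {s | 1 / 8 * lowerBound N M ε ≤ (s.2 : ℝ) ∧
        (s.2 : ℝ) ≤ 15 * upperBound N M ε (maxBunch s.1) ∧
        (maxBunch s.1 : ℝ) ≤ (1 + η) * bunchScale N M ε} := by
  classical
  have hL : 0 ≤ lowerBound N M ε := by rw [lowerBound]; positivity
  rw [sampler_toOuterMeasure B hB]
  refine ENNReal.ofReal_le_ofReal ((le_sum_seqProb_one_sub hB hε0 hε1 h).1.trans ?_)
  rw [Finset.sum_filter]
  refine Finset.sum_le_sum fun l _ => ?_
  rw [atypicalInd]
  by_cases hl : Typical ε η l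
  · rw [if_pos hl, if_pos, sub_zero, mul_one]
    refine ⟨?_, le_upperBound_of_typical hN hNM hl, hl.2.2⟩
    have := lowerBound_le_of_typical hN hl
    linarith
  · rw [if_neg hl, sub_self, mul_zero]
    split_ifs
    · exact seqProb_nonneg B l
    · exact le_rfl

end

end BosonSampling

end

theorem theorem2 :
    (∀ (N M : ℕ) [NeZero M] (h : N ≤ M) (U : Matrix.unitaryGroup (Fin M) ℂ) (l : Fin N → Fin M),
      (BosonSampling.sampler (BosonSampling.inputRows h U)).toOuterMeasure
          {s | BosonSampling.occ s.1 = BosonSampling.occ l} =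
        ENNReal.ofReal (BosonSampling.outputProb (BosonSampling.inputRows h U) l)) ∧
    ∃ c C : ℝ, 0 < c ∧ 0 < C ∧ ∀ ε : ℝ, 0 < ε → ∃ κ : ℝ, 0 < κ ∧ ∀ η : ℝ, 0 < η → ∃ N₀ : ℕ,
      ∀ (N M : ℕ) [NeZero M] (h : N ≤ M), N₀ ≤ N →
        ∃ G : Set (Matrix.unitaryGroup (Fin M) ℂ), MeasurableSet G ∧
          ENNReal.ofReal (1 - ε) ≤ BosonSampling.haarU M G ∧
          ∀ U ∈ G,
            ENNReal.ofReal (1 - ε) ≤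
              (BosonSampling.sampler (BosonSampling.inputRows h U)).toOuterMeasure
                {s | c * BosonSampling.lowerBound N M ε ≤ (s.2 : ℝ) ∧
                  (s.2 : ℝ) ≤
                    C * BosonSampling.upperBound N M ε (BosonSampling.maxBunch s.1) ∧
                  (BosonSampling.maxBunch s.1 : ℝ) ≤
                    (1 + η) * BosonSampling.bunchScale N M ε} ∧
            ENNReal.ofReal (c * BosonSampling.lowerBound N M ε) ≤
              BosonSampling.meanOps (BosonSampling.inputRows h U) ∧
            BosonSampling.meanOps (BosonSampling.inputRows h U) ≤
              ENNReal.ofReal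
                (C * BosonSampling.upperBound N M ε (BosonSampling.bunchScale N M ε)) ∧
            ∀ (n M' : ℕ) [NeZero M'] (h' : n ≤ M') (V : Matrix.unitaryGroup (Fin M') ℂ),
              n = ⌈(N : ℝ) / (1 + (N : ℝ) / M)⌉₊ → M' * n ≤ 2 ^ n →
                ENNReal.ofReal κ * BosonSampling.meanOps (BosonSampling.inputRows h' V) ≤
                  BosonSampling.meanOps (BosonSampling.inputRows h U) := by
  open BosonSampling in
  refine ⟨fun N M _ h U l => sampler_occ _ (orthonormalRows_inputRows h U) l,
    1 / 8, 15, by norm_num, by norm_num, fun ε hε0 =>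
    ⟨2 ^ (-(2 / ε) - 5 / 2 : ℝ) / 44, by positivity, fun η hη => ?_⟩⟩
  obtain ⟨N₀, hN₀⟩ := exists_threshold hε0 hη
  refine ⟨N₀, fun N M _ h hN => ?_⟩
  obtain ⟨h16, hsmall, hexp⟩ := hN₀ N hN
  -- for `1 ≤ ε` the required Haar probability is not positive
  rcases le_or_gt 1 ε with hε1 | hε1
  · exact ⟨∅, MeasurableSet.empty, by simp [ENNReal.ofReal_of_nonpos (sub_nonpos.2 hε1)],
      fun U hU => absurd hU (Set.notMem_empty U)⟩
  have hR := Fin.castLE_injective h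
  refine ⟨goodSet (Fin.castLE h) ε η, measurableSet_goodSet _ ε η,
    le_haarU_goodSet h16 h hε0 hε1 hη hsmall hexp hR, fun U hU => ?_⟩
  obtain ⟨⟨hU1, hU2⟩, hU3⟩ := hU
  have hB := orthonormalRows_inputRows h U
  refine ⟨le_sampler_bounds hB h16 h hε0 hε1 hU1, ?_, ?_, ?_⟩
  · rw [meanOps_eq _ hB]
    exact ENNReal.ofReal_le_ofReal (lowerBound_le_mean hB h16 hε0 hε1 hU1)
  · rw [meanOps_eq _ hB]
    exact ENNReal.ofReal_le_ofReal (mean_le_upperBound hB (by omega) h hε0 hε1 hU2)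
  · intro n M' _ h' V hn hMn
    rw [meanOps_eq _ hB, meanOps_eq _ (orthonormalRows_inputRows h' V),
      ← ENNReal.ofReal_mul (by positivity)]
    refine ENNReal.ofReal_le_ofReal
      (le_trans ?_ (le_mean_of_colDeviation_le hB (by omega) h hU3))
    have h1 := mean_le_two_pow (orthonormalRows_inputRows h' V) hMn
    have h2 := mul_two_pow_ceil_le (by omega) h hn
    have h3 : (2 : ℝ) ^ ((N : ℝ) / (1 + rho N M) - 2 / ε - 5 / 2) =
        2 ^ (-(2 / ε) - 5 / 2 : ℝ) * 2 ^ ((N : ℝ) / (1 + rho N M)) := by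
      rw [← Real.rpow_add two_pos]
      congr 1
      ring
    have hκ : (0 : ℝ) ≤ 2 ^ (-(2 / ε) - 5 / 2 : ℝ) / 44 := by positivity
    refine (mul_le_mul_of_nonneg_left (h1.trans (mul_le_mul_of_nonneg_left h2 (by norm_num)))
      hκ).trans (le_of_eq ?_)
    rw [h3]
    ring
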